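/- **Theorem (Universal coefficients).** For a topological space $X$, let $D(X)$ be the unbounded derived category of sheaves of abelian groups on $X$ and $D(\mathbb Z)$ that of abelian groups. Let $\overset{\mathbb L}\otimes$ denote the derived tensor product, i.e. the total left derived functor (in both variables) of the tensor product of unbounded complexes. Let $\pi^{-1}\colon D(\mathbb Z)\to D(X)$ be the inverse image functor for the projection $\pi$ of $X$ to a point (induced by the exact functor sending an abelian group to its constant sheaf), and write $F\overset{\mathbb L}\otimes G:=F\overset{\mathbb L}\otimes\pi^{-1}G$ for $F\in D(X)$ and $G\in D(\mathbb Z)$. Assume that $\pi^{-1}$ has a left adjoint $\mathbb L(X,-)\colon D(X)\to D(\mathbb Z)$, and put $H_i(X,F):=H_i(\mathbb L(X,F))$, where $H_i(K):=H^{-i}(K)$. Then $\overset{\mathbb L}\otimes$ exists on $D(X)$ and on $D(\mathbb Z)$, and there is an isomorphism $$\mathbb L(X,F\overset{\mathbb L}\otimes G)\;\overset{\sim}\longrightarrow\;\mathbb L(X,F)\overset{\mathbb L}\otimes G$$ in $D(\mathbb Z)$, natural in $F\in D(X)$ and $G\in D(\mathbb Z)$. Moreover, for every $i\in\mathbb Z$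 there are short exact sequences $$0\to H_i(X,F)\otimes G\to H_i(X,F\overset{\mathbb L}\otimes G)\to \operatorname{Tor}_1(H_{i-1}(X,F),G)\to 0,$$ natural in $F\in D(X)$ and in the abelian group $G$ (regarded as a complex in degree $0$), and for each $F$ and $G$ this sequence splits. -/

import Mathlib

open CategoryTheory Limits MonoidalCategory

universe w₁ w₂

noncomputable section

namespace SheafHomology

/-! ### Derived functors of biadditive bifunctors on unbounded complexes -/

section Derived

variable {C : Type*} [Category* C] [Abelian C] [HasCountableCoproducts C]
  (T : C ⥤ C ⥤ C) [T.Additive] [∀ A, (T.obj A).Additive]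

/-- The bifunctor on unbounded cochain complexes induced by a biadditive bifunctor `T`: it sends
`(K, L)` to the total complex, formed with direct sums, of the double complex `T(K^p, L^q)`. -/
def complexBifunctor : CochainComplex C ℤ × CochainComplex C ℤ ⥤ CochainComplex C ℤ :=
  Functor.uncurry.obj T.map₂CochainComplex

/-- Pairs of quasi-isomorphisms of cochain complexes. -/
abbrev quasiIsoPairs (C : Type*) [Category* C] [Abelian C] :
    MorphismProperty (CochainComplex C ℤ × CochainComplex C ℤ) :=
  (HomologicalComplex.quasiIso C (ComplexShape.up ℤ)).prod
    (HomologicalComplex.quasiIso C (ComplexShape.up ℤ))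

/-- `T` has a total left derived functor on the unbounded derived category. -/
abbrev HasDerivedBifunctor [HasDerivedCategory C] : Prop :=
  (complexBifunctor T ⋙ DerivedCategory.Q).HasLeftDerivedFunctor (quasiIsoPairs C)

/-- The total left derived functor `D(C) × D(C) ⥤ D(C)` of `T`. -/
def derivedBifunctor [HasDerivedCategory C] [HasDerivedBifunctor T] :
    DerivedCategory C × DerivedCategory C ⥤ DerivedCategory C :=
  (complexBifunctor T ⋙ DerivedCategory.Q).totalLeftDerived
    (DerivedCategory.Q.prod DerivedCategory.Q) (quasiIsoPairs C)

end Derived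

/-! ### Abelian groups -/

/-- The category of abelian groups. -/
abbrev AbGrp : Type 1 := ModuleCat.{0} ℤ

/-- The derived tensor product of abelian groups exists on the unbounded derived category. -/
abbrev HasDerivedTensorAb [HasDerivedCategory.{w₁} AbGrp] : Prop :=
  HasDerivedBifunctor (curriedTensor AbGrp)

/-- `(K, L) ↦ K ⊗ᴸ L` on the unbounded derived category of abelian groups. -/
abbrev derivedTensorAb [HasDerivedCategory.{w₁} AbGrp] [HasDerivedTensorAb.{w₁}] :
    DerivedCategory AbGrp × DerivedCategory AbGrp ⥤ DerivedCategory AbGrp :=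
  derivedBifunctor (curriedTensor AbGrp)

/-- `H_i(K) := H^{-i}(K)` for `K` in the derived category of abelian groups. -/
abbrev homologyAb [HasDerivedCategory.{w₁} AbGrp] (i : ℤ) : DerivedCategory AbGrp ⥤ AbGrp :=
  DerivedCategory.homologyFunctor AbGrp (-i)

/-! ### Sheaves of abelian groups on a topological space -/

section Sheaves

variable (X : TopCat.{0})

/-- The category of sheaves of abelian groups on `X`. -/
abbrev Shv : Type 1 := Sheaf (Opens.grothendieckTopology X) AbGrp

instance : HasCountableCoproducts (Shv X) :=
  ⟨fun _ _ => CategoryTheory.Sheaf.instHasColimitsOfShape⟩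

/-- The tensor product of sheaves: `F ⊗ G` is the sheaf associated with the presheaf
`U ↦ F(U) ⊗ G(U)`. -/
def tensorShv : Shv X ⥤ Shv X ⥤ Shv X :=
  sheafToPresheaf (Opens.grothendieckTopology X) AbGrp ⋙
    curriedTensor ((TopologicalSpace.Opens X)ᵒᵖ ⥤ AbGrp) ⋙
    (Functor.whiskeringLeft _ _ _).obj (sheafToPresheaf (Opens.grothendieckTopology X) AbGrp) ⋙
    (Functor.whiskeringRight _ _ _).obj (presheafToSheaf (Opens.grothendieckTopology X) AbGrp)

instance : (tensorShv X).Additive where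
  map_add {F G f g} := by
    ext H : 2
    have h : (f + g).hom ▷ H.obj = f.hom ▷ H.obj + g.hom ▷ H.obj := by
      ext U : 2
      exact MonoidalPreadditive.add_whiskerRight _ _
    change (presheafToSheaf _ _).map ((f + g).hom ▷ H.obj) =
      (presheafToSheaf _ _).map (f.hom ▷ H.obj) + (presheafToSheaf _ _).map (g.hom ▷ H.obj)
    exact (congrArg _ h).trans (Functor.map_add _)

instance (F : Shv X) : ((tensorShv X).obj F).Additive where
  map_add {G H f g} := by
    have h : F.obj ◁ (f + g).hom = F.obj ◁ f.hom + F.obj ◁ g.hom := by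
      ext U : 2
      exact MonoidalPreadditive.whiskerLeft_add _ _
    change (presheafToSheaf _ _).map (F.obj ◁ (f + g).hom) =
      (presheafToSheaf _ _).map (F.obj ◁ f.hom) + (presheafToSheaf _ _).map (F.obj ◁ g.hom)
    exact (congrArg _ h).trans (Functor.map_add _)

/-- The functor sending an abelian group to the associated constant sheaf on `X`, i.e. the
inverse image functor for the projection of `X` to a point. -/
abbrev constShv : AbGrp ⥤ Shv X := constantSheaf (Opens.grothendieckTopology X) AbGrp

instance : PreservesFiniteLimits (constShv X) := by
  unfold constShv constantSheaf
  infer_instance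

instance : PreservesFiniteColimits (constShv X) :=
  have := (constantSheafAdj (Opens.grothendieckTopology X) AbGrp
    isTerminalTop).leftAdjoint_preservesColimits
  PreservesColimits.preservesFiniteColimits _

variable [HasDerivedCategory.{w₁} AbGrp] [HasDerivedCategory.{w₂} (Shv X)]

/-- The derived tensor product of sheaves exists on the unbounded derived category `D(X)`. -/
abbrev HasDerivedTensorShv : Prop := HasDerivedBifunctor (tensorShv X)

/-- `(F, F') ↦ F ⊗ᴸ F'` on the unbounded derived category `D(X)`. -/
abbrev derivedTensorShv [HasDerivedTensorShv.{w₂} X] :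
    DerivedCategory (Shv X) × DerivedCategory (Shv X) ⥤ DerivedCategory (Shv X) :=
  derivedBifunctor (tensorShv X)

/-- The inverse image functor `π⁻¹ : D(ℤ) ⥤ D(X)` for the projection `π` of `X` to a point. -/
abbrev constDerived : DerivedCategory AbGrp ⥤ DerivedCategory (Shv X) :=
  (constShv X).mapDerivedCategory

/-- The homology functor `𝕃(X, -) : D(X) ⥤ D(ℤ)`: the left adjoint of `π⁻¹`. -/
abbrev sheafHomology [(constDerived.{w₁, w₂} X).IsRightAdjoint] :
    DerivedCategory (Shv X) ⥤ DerivedCategory AbGrp :=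
  (constDerived X).leftAdjoint

/-- The functor `(F, G) ↦ F ⊗ᴸ π⁻¹G` from `D(X) × D(ℤ)` to `D(X)`. -/
abbrev tensorConst [HasDerivedTensorShv.{w₂} X] :
    DerivedCategory (Shv X) × DerivedCategory AbGrp ⥤ DerivedCategory (Shv X) :=
  (𝟭 _).prod (constDerived X) ⋙ derivedTensorShv X

end Sheaves

end SheafHomology

end

/-!
# Universal coefficients for the homology of sheaves

Abelian groups and sheaves of abelian groups have flat dimension at most one: subobjects of
projective abelian groups are projective, and subsheaves of torsion-free sheaves are torsion-free.
This is abstracted in `FlatResolution`, a class of objects for a bifunctor `T` which is closed under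
subobjects, on which `T` is exact in the other variable, and which comes with functorial
epimorphisms `P A ⟶ A` from objects of the class. The instances are `resolutionAb`
and `resolutionShv`.

*The derived tensor product.* The mapping cone of `ker (P K ⟶ K) ⟶ P K` is a functorial resolution
`R K ⟶ K` of an arbitrary unbounded complex by a complex with flat terms. Such a complex `L` is
acyclic for the tensor product without any boundedness condition: in the exact sequence of complexes
`0 → Z → L → L/Z → 0`, with `Z` the cycles, the outer complexes have zero differential and flat
terms, so they are coproducts of shifted flat objects, for which the claim is clear, and the claim
for `L` follows (`quasiIso_map₂_app`). Hence `(K, L) ↦ R K ⊗ R L` inverts quasi-isomorphisms, and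
the functor induced on derived categories has the universal property of the total left derived
functor (`isRightKanExtension_of_resolution`).

*The projection formula.* The functor `π⁻¹` is exact, preserves coproducts and flat objects, and
commutes with tensor products of objects, hence with derived tensor products
(`nonempty_derivedCompatibility`). The mate of this isomorphism with respect to the adjunction
`𝕃(X, -) ⊣ π⁻¹` is a natural morphism `𝕃(X, F ⊗ᴸ π⁻¹ G) ⟶ 𝕃(X, F) ⊗ᴸ G`. If `G` is a shift of `ℤ`,
then tensoring with `G` and with `π⁻¹ G` are equivalences of categories intertwined by `π⁻¹`, so the
left adjoint intertwines them as well (`isIso_homEquiv_symm`). Both sides preserve distinguished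
triangles and coproducts in `G`, and every complex of projective groups is built from shifts of `ℤ`
by coproducts, retracts and one triangle, the one attached to `0 → Z → L → L/Z → 0`. So the morphism
is an isomorphism for all `G` (`isIso_app_of_isIso_single`, `nonempty_projectionFormula`).

*Universal coefficients.* By the projection formula it suffices to treat a complex `K` of projective
abelian groups. Tensoring `K` with the resolution `0 → P₁ → P₀ → G → 0` yields a long exact
sequence, in which `Hⁿ(K ⊗ Pᵢ) ≅ Hⁿ(K) ⊗ Pᵢ` since `Pᵢ` is flat. The cokernels and kernels of
`Hⁿ(K) ⊗ P₁ ⟶ Hⁿ(K) ⊗ P₀` are `Hⁿ(K) ⊗ G` and `Tor₁(Hⁿ(K), G)`, whence the exact sequences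
`0 → Hⁿ(K) ⊗ G → Hⁿ(K ⊗ G) → Tor₁(Hⁿ⁺¹(K), G) → 0` (`kunnethHom`, `toTor`). The subgroup of cycles
is a direct factor of `Kⁿ`, so the class map extends to a map `Kⁿ ⟶ Hⁿ(K)`. The latter induces a
retraction of the first map (`exists_kunnethHom_comp_eq_id`). With `K` replaced by its functorial
resolution, the sequences are natural in complexes, and they descend to the derived category
(`exists_splitting_of_localization`, `exists_universalCoefficients`).
-/

universe w

noncomputable section

namespace SheafHomology

/-! ### Left derived functors from functorial resolutions -/

section Resolution

variable {C D H : Type*} [Category* C] [Category* D] [Category* H]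

/-- If `ρ : R ⟶ 𝟭` is a functorial resolution such that `R ⋙ F` inverts `W` and `F` inverts
`ρ` on resolved objects, then the functor induced by `R ⋙ F` on the localization is the left
derived functor of `F`, with counit induced by `ρ`. -/
theorem isRightKanExtension_of_resolution (F : C ⥤ H) (L : C ⥤ D) (W : MorphismProperty C)
    [L.IsLocalization W] (R : C ⥤ C) (ρ : R ⟶ 𝟭 C) (hρ : ∀ X, W (ρ.app X))
    (hR : ∀ X, IsIso (F.map (ρ.app (R.obj X))))
    (LF : D ⥤ H) (e : L ⋙ LF ≅ R ⋙ F) :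
    LF.IsRightKanExtension (e.hom ≫ Functor.whiskerRight ρ F) := by
  have hL (X : C) : IsIso (L.map (ρ.app X)) := Localization.inverts L W _ (hρ X)
  have hα (X : C) : IsIso ((e.hom ≫ Functor.whiskerRight ρ F).app (R.obj X)) := by
    have := hR X
    dsimp
    infer_instance
  have inst1 : IsIso (Functor.whiskerRight ρ L) := by
    have : ∀ X, IsIso ((Functor.whiskerRight ρ L).app X) := fun X ↦ hL X
    exact NatIso.isIso_of_isIso_app _
  let u (s : Functor.RightExtension L F) : s.left ⟶ LF :=
    (Localization.fullyFaithfulWhiskeringLeft L W H).preimage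
      ((Functor.leftUnitor _).inv ≫ Functor.whiskerRight (inv (Functor.whiskerRight ρ L)) s.left ≫
        Functor.whiskerLeft R s.hom ≫ e.inv)
  have hu (s : Functor.RightExtension L F) (X : C) : (u s).app (L.obj X) =
      s.left.map (inv (L.map (ρ.app X))) ≫ s.hom.app (R.obj X) ≫ e.inv.app X := by
    have := NatTrans.congr_app ((Localization.fullyFaithfulWhiskeringLeft L W H).map_preimage
      ((Functor.leftUnitor _).inv ≫ Functor.whiskerRight (inv (Functor.whiskerRight ρ L)) s.left ≫
        Functor.whiskerLeft R s.hom ≫ e.inv)) X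
    refine this.trans ?_
    dsimp
    simp only [Category.id_comp]
    congr 2
    rw [← cancel_epi (L.map (ρ.app X)), IsIso.hom_inv_id]
    exact NatTrans.congr_app (IsIso.hom_inv_id (Functor.whiskerRight ρ L)) X
  have hu' (s : Functor.RightExtension L F) (X : C) :
      (u s).app (L.obj X) ≫ (e.hom ≫ Functor.whiskerRight ρ F).app X = s.hom.app X := by
    rw [hu]
    have h1 : s.left.map (L.map (ρ.app X)) ≫ s.hom.app X = s.hom.app (R.obj X) ≫ F.map (ρ.app X) :=
      s.hom.naturality (ρ.app X)
    dsimp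
    simp only [Category.assoc, Iso.inv_hom_id_app_assoc]
    rw [← h1, ← Functor.map_comp_assoc, IsIso.inv_hom_id]
    simp
  refine ⟨⟨IsTerminal.ofUniqueHom (fun s ↦ CostructuredArrow.homMk (u s) ?_) ?_⟩⟩
  · ext X
    exact hu' s X
  · intro s m
    ext : 1
    refine Localization.natTrans_ext L W fun X ↦ ?_
    have hm (X : C) : m.left.app (L.obj X) ≫ (e.hom ≫ Functor.whiskerRight ρ F).app X =
        s.hom.app X := NatTrans.congr_app (CostructuredArrow.w m) X
    have h2 : m.left.app (L.obj (R.obj X)) = (u s).app (L.obj (R.obj X)) := by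
      have := hα X
      exact (cancel_mono ((e.hom ≫ Functor.whiskerRight ρ F).app (R.obj X))).1
        ((hm _).trans (hu' s _).symm)
    exact (cancel_epi (s.left.map (L.map (ρ.app X)))).1 ((m.left.naturality _).trans
      ((congrArg (· ≫ LF.map (L.map (ρ.app X))) h2).trans ((u s).naturality _).symm))

end Resolution

/-! ### Coproducts of quasi-isomorphisms -/

section Coproducts

variable {C : Type*} [Category* C] [Abelian C]

/-- A morphism of short complexes of functors is a quasi-isomorphism if it is so objectwise. -/
lemma quasiIso_of_evaluation {J : Type*} [Category* J] {S₁ S₂ : ShortComplex (J ⥤ C)}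
    (φ : S₁ ⟶ S₂)
    (h : ∀ j, ShortComplex.QuasiIso (((evaluation J C).obj j).mapShortComplex.map φ)) :
    ShortComplex.QuasiIso φ := by
  rw [ShortComplex.quasiIso_iff]
  have (j : J) : IsIso ((ShortComplex.homologyMap φ).app j) := by
    have := (ShortComplex.quasiIso_iff _).1 (h j)
    have e := ShortComplex.mapHomologyIso_hom_naturality φ ((evaluation J C).obj j)
    change ShortComplex.homologyMap _ ≫ _ = _ ≫ (ShortComplex.homologyMap φ).app j at e
    have e' : (ShortComplex.homologyMap φ).app j =
        (S₁.mapHomologyIso ((evaluation J C).obj j)).inv ≫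
        ShortComplex.homologyMap (((evaluation J C).obj j).mapShortComplex.map φ) ≫
        (S₂.mapHomologyIso ((evaluation J C).obj j)).hom := by
      rw [Iso.eq_inv_comp]
      exact e.symm
    rw [e']
    exact IsIso.comp_isIso' (Iso.isIso_inv _) (IsIso.comp_isIso' this (Iso.isIso_hom _))
  exact NatIso.isIso_of_isIso_app _

/-- A short complex of functors is exact if it is so objectwise. -/
lemma exact_of_evaluation {J : Type*} [Category* J] (S : ShortComplex (J ⥤ C))
    (h : ∀ j, (S.map ((evaluation J C).obj j)).Exact) : S.Exact := by
  rw [ShortComplex.exact_iff_isZero_homology]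
  refine Functor.isZero _ fun j ↦ ?_
  exact ((ShortComplex.exact_iff_isZero_homology _).1 (h j)).of_iso
    (S.mapHomologyIso ((evaluation J C).obj j)).symm

variable {J : Type} [HasCoproductsOfShape J C] [HasExactColimitsOfShape (Discrete J) C]

/-- The terms of a coproduct of complexes are coproducts of the terms. -/
def isColimitCofanEval {D : Type*} [Category* D] [HasZeroMorphisms D] {J : Type*}
    [HasCoproductsOfShape J D] {I : Type*} {c : ComplexShape I}
    {K : J → HomologicalComplex D c} {cK : Cofan K} (hK : IsColimit cK) (i : I) :
    IsColimit (Cofan.mk (cK.pt.X i) fun j ↦ (cK.inj j).f i) :=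
  isColimitCofanMkObjOfIsColimit (HomologicalComplex.eval D c i) _ _
    (hK.ofIsoColimit (Cofan.ext (Iso.refl _) (by intro j; exact Category.comp_id _)))

/-- Quasi-isomorphisms are stable under exact coproducts. -/
theorem quasiIso_of_isColimit_cofan {I : Type*} {c : ComplexShape I}
    {K L : J → HomologicalComplex C c}
    {cK : Cofan K} (hK : IsColimit cK) {cL : Cofan L} (hL : IsColimit cL)
    (φ : ∀ j, K j ⟶ L j) (hφ : ∀ j, QuasiIso (φ j)) (f : cK.pt ⟶ cL.pt)
    (hf : ∀ j, cK.inj j ≫ f = φ j ≫ cL.inj j) : QuasiIso f := by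
  rw [quasiIso_iff]
  intro i
  rw [quasiIsoAt_iff]
  let S (K : J → HomologicalComplex C c) : ShortComplex (Discrete J ⥤ C) :=
    ShortComplex.mk (X₁ := Discrete.functor fun j ↦ (K j).X (c.prev i))
      (X₂ := Discrete.functor fun j ↦ (K j).X i) (X₃ := Discrete.functor fun j ↦ (K j).X (c.next i))
      (Discrete.natTrans fun j ↦ (K j.as).d _ _) (Discrete.natTrans fun j ↦ (K j.as).d _ _)
      (by ext j; exact (K j.as).d_comp_d _ _ _)
  let ψ : S K ⟶ S L :=
    { τ₁ := Discrete.natTrans fun j ↦ (φ j.as).f _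
      τ₂ := Discrete.natTrans fun j ↦ (φ j.as).f _
      τ₃ := Discrete.natTrans fun j ↦ (φ j.as).f _
      comm₁₂ := by ext j; exact (φ j.as).comm _ _
      comm₂₃ := by ext j; exact (φ j.as).comm _ _ }
  have hψ : ShortComplex.QuasiIso ψ := quasiIso_of_evaluation ψ fun j ↦ by
    have := ((quasiIso_iff _).1 (hφ j.as)) i
    rw [quasiIsoAt_iff] at this
    exact this
  have hψ' : ShortComplex.QuasiIso ((colim (J := Discrete J) (C := C)).mapShortComplex.map ψ) := by
    have := HasExactColimitsOfShape.preservesFiniteLimits (J := Discrete J) (C := C)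
    infer_instance
  let e {K : J → HomologicalComplex C c} {cK : Cofan K} (hK : IsColimit cK) (n : I) :
      colimit (Discrete.functor fun j ↦ (K j).X n) ≅ cK.pt.X n :=
    (colimit.isColimit _).coconePointUniqueUpToIso (isColimitCofanEval hK n)
  have he {K : J → HomologicalComplex C c} {cK : Cofan K} (hK : IsColimit cK) (n : I)
      (j : Discrete J) : colimit.ι (Discrete.functor fun j ↦ (K j).X n) j ≫ (e hK n).hom =
        (cK.inj j.as).f n :=
    (colimit.isColimit _).comp_coconePointUniqueUpToIso_hom (isColimitCofanEval hK n) j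
  let E {K : J → HomologicalComplex C c} {cK : Cofan K} (hK : IsColimit cK) :
      (colim (J := Discrete J) (C := C)).mapShortComplex.obj (S K) ≅ cK.pt.sc i :=
    ShortComplex.isoMk (e hK _) (e hK _) (e hK _)
      (colimit.hom_ext fun j ↦ by
        refine ((reassoc_of% he hK _ j) _).trans (Eq.trans ?_
          ((ι_colimMap_assoc (S K).f j _).symm))
        exact ((cK.inj j.as).comm _ _).trans (congrArg _ (he hK _ j).symm))
      (colimit.hom_ext fun j ↦ by
        refine ((reassoc_of% he hK _ j) _).trans (Eq.trans ?_
          ((ι_colimMap_assoc (S K).g j _).symm))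
        exact ((cK.inj j.as).comm _ _).trans (congrArg _ (he hK _ j).symm))
  have key (n : I) : colim.map (Discrete.natTrans fun j ↦ (φ j.as).f n) ≫ (e hL n).hom =
      (e hK n).hom ≫ f.f n := colimit.hom_ext fun j ↦ by
    refine (ι_colimMap_assoc _ _ _).trans (Eq.trans (congrArg _ (he hL _ j)) ?_)
    exact (HomologicalComplex.congr_hom (hf j.as) n).symm.trans ((reassoc_of% he hK n j) _).symm
  have hh : ShortComplex.QuasiIso ((HomologicalComplex.shortComplexFunctor C c i).map f) :=
    (ShortComplex.quasiIso_iff_of_arrow_mk_iso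
      ((colim (J := Discrete J) (C := C)).mapShortComplex.map ψ)
      ((HomologicalComplex.shortComplexFunctor C c i).map f) (Arrow.isoMk (E hK) (E hL)
      (ShortComplex.hom_ext _ _ (key (c.prev i)).symm (key i).symm (key (c.next i)).symm))).1 hψ'
  exact hh

end Coproducts

/-! ### Total complexes of bifunctors -/

lemma comp_comp_of_comp_eq {D : Type*} [Category* D] {W X X' Y Z : D} {f : W ⟶ X} {g : X ⟶ Y}
    {f' : W ⟶ X'} {g' : X' ⟶ Y} (h : f ≫ g = f' ≫ g') (k : Y ⟶ Z) :
    f ≫ g ≫ k = f' ≫ g' ≫ k := by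
  rw [← Category.assoc, h, Category.assoc]

section Total

open HomologicalComplex

variable {C : Type*} [Category* C] [Abelian C] [HasCoproducts.{0} C]
  (T : C ⥤ C ⥤ C) [T.PreservesZeroMorphisms] [∀ A, (T.obj A).PreservesZeroMorphisms]

instance (K : CochainComplex C ℤ) : (T.map₂CochainComplex.obj K).PreservesZeroMorphisms where
  map_zero L M := by
    ext n : 1
    refine mapBifunctor.hom_ext fun p q h ↦ ?_
    refine (ι_mapBifunctorMap _ _ _ _ _ _ _ h).trans ?_
    simp only [Functor.map_zero, zero_comp, comp_zero, zero_f]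
    exact comp_zero.symm

/-- The index set of the summands in degree `n` of a total complex. -/
abbrev Antidiagonal (n : ℤ) : Type := { x : ℤ × ℤ // x.1 + x.2 = n }

/-- The degree `n` part of a total complex is the coproduct of the terms of total degree `n`. -/
def isColimitTotal (K L : CochainComplex C ℤ) (n : ℤ) :
    IsColimit (Cofan.mk (((T.map₂CochainComplex.obj K).obj L).X n) fun x : Antidiagonal n ↦
      ιMapBifunctor K L T (.up ℤ) x.1.1 x.1.2 n x.2) :=
  Cofan.IsColimit.mk _ (fun s ↦ mapBifunctorDesc fun p q h ↦ s.inj ⟨(p, q), h⟩)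
    (fun _ _ ↦ ι_mapBifunctorDesc _ _ _ _)
    (fun s _ hm ↦ mapBifunctor.hom_ext fun p q h ↦
      (hm ⟨(p, q), h⟩).trans (ι_mapBifunctorDesc (K₁ := K) (K₂ := L) (F := T) (c := .up ℤ)
        (fun p q h ↦ s.inj ⟨(p, q), h⟩) p q h).symm)

lemma ι_map₂_map (K : CochainComplex C ℤ) {L M : CochainComplex C ℤ} (g : L ⟶ M) (p q n : ℤ)
    (h : p + q = n) : ιMapBifunctor K L T (.up ℤ) p q n h ≫
      ((T.map₂CochainComplex.obj K).map g).f n =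
    (T.obj (K.X p)).map (g.f q) ≫ ιMapBifunctor K M T (.up ℤ) p q n h := by
  refine (ι_mapBifunctorMap _ _ _ _ _ _ _ h).trans ?_
  simp

lemma ι_map₂_map_app {K K' : CochainComplex C ℤ} (f : K ⟶ K') (L : CochainComplex C ℤ) (p q n : ℤ)
    (h : p + q = n) : ιMapBifunctor K L T (.up ℤ) p q n h ≫
      ((T.map₂CochainComplex.map f).app L).f n =
    (T.map (f.f p)).app (L.X q) ≫ ιMapBifunctor K' L T (.up ℤ) p q n h := by
  refine (ι_mapBifunctorMap _ _ _ _ _ _ _ h).trans ?_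
  simp

/-- Total complexes preserve short exact sequences that are preserved termwise. -/
theorem shortExact_map₂_obj [AB4OfSize.{0} C] (K : CochainComplex C ℤ)
    (S : ShortComplex (CochainComplex C ℤ))
    (h : ∀ p q, ((S.map (eval C _ q)).map (T.obj (K.X p))).ShortExact) :
    (S.map (T.map₂CochainComplex.obj K)).ShortExact := by
  refine shortExact_of_degreewise_shortExact _ fun n ↦ ?_
  let D (L : CochainComplex C ℤ) : Discrete (Antidiagonal n) ⥤ C :=
    Discrete.functor fun x : Antidiagonal n ↦ (T.obj (K.X x.1.1)).obj (L.X x.1.2)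
  let S' : ShortComplex (Discrete (Antidiagonal n) ⥤ C) :=
    ShortComplex.mk (X₁ := D S.X₁) (X₂ := D S.X₂) (X₃ := D S.X₃)
      (Discrete.natTrans fun x ↦ (T.obj (K.X x.as.1.1)).map (S.f.f x.as.1.2))
      (Discrete.natTrans fun x ↦ (T.obj (K.X x.as.1.1)).map (S.g.f x.as.1.2))
      (by ext x; exact ((S.map (eval C _ x.as.1.2)).map (T.obj (K.X x.as.1.1))).zero)
  have hS (x : Discrete (Antidiagonal n)) : (S'.map ((evaluation _ C).obj x)).ShortExact :=
    h x.as.1.1 x.as.1.2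
  have hf (x : Discrete (Antidiagonal n)) := ι_map₂_map T K S.f x.as.1.1 x.as.1.2 n x.as.2
  have hg (x : Discrete (Antidiagonal n)) := ι_map₂_map T K S.g x.as.1.1 x.as.1.2 n x.as.2
  have : Mono S'.f := by
    have : ∀ x, Mono (S'.f.app x) := fun x ↦ (hS x).mono_f
    exact NatTrans.mono_of_mono_app _
  have : ∀ x, Epi (S'.g.app x) := fun x ↦ (hS x).epi_g
  have hex : S'.Exact :=
    exact_of_evaluation S' fun x ↦ (hS x).exact
  have hpres := HasExactColimitsOfShape.preservesFiniteLimits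
    (J := Discrete (Antidiagonal n)) (C := C)
  exact
    { exact := colim.exact_mapShortComplex hex (isColimitTotal T K S.X₁ n)
        (isColimitTotal T K S.X₂ n) (isColimitTotal T K S.X₃ n) _ _ hf hg
      mono_f := colim.map_mono' S'.f (isColimitTotal T K S.X₁ n) (isColimitTotal T K S.X₂ n) _ hf
      epi_g := colim.map_epi' S'.g _ (isColimitTotal T K S.X₃ n) _ hg }

/-- An injection into a coproduct whose other summands vanish is an isomorphism. -/
lemma isIso_inj_of_isZero {D : Type*} [Category* D] [HasZeroMorphisms D] {J : Type*} {X : J → D}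
    {c : Cofan X} (hc : IsColimit c) (j : J) (h : ∀ i, i ≠ j → IsZero (X i)) :
    IsIso (c.inj j) := by
  classical
  let r : c.pt ⟶ X j := Cofan.IsColimit.desc hc fun i ↦
    if hi : i = j then eqToHom (by rw [hi]) else 0
  have hr : c.inj j ≫ r = 𝟙 _ := by simp [r]
  refine ⟨r, hr, Cofan.IsColimit.hom_ext hc _ _ fun i ↦ ?_⟩
  by_cases hi : i = j
  · subst hi
    rw [reassoc_of% hr]
    exact (Category.comp_id _).symm
  · exact (h i hi).eq_of_src _ _

/-- A cofan of complexes that is a coproduct in each degree is a coproduct. -/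
def isColimitCofanOfEval {D : Type*} [Category* D] [HasZeroMorphisms D] {J : Type*} {I : Type*}
    {c : ComplexShape I} {K : J → HomologicalComplex D c} (P : HomologicalComplex D c)
    (f : ∀ j, K j ⟶ P) (h : ∀ i, IsColimit (Cofan.mk (P.X i) fun j ↦ (f j).f i)) :
    IsColimit (Cofan.mk P f) :=
  isColimitOfEval _ _ fun i ↦ (isColimitMapCoconeCofanMkEquiv (eval D c i) _ _).symm (h i)

/-- Total complexes preserve coproducts if the bifunctor does. -/
def isColimitMap₂ {J : Type} (hT : ∀ A, PreservesColimitsOfShape (Discrete J) (T.obj A))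
    (K : CochainComplex C ℤ) {L : J → CochainComplex C ℤ} {c : Cofan L} (hc : IsColimit c) :
    IsColimit (Cofan.mk ((T.map₂CochainComplex.obj K).obj c.pt) fun j ↦
      (T.map₂CochainComplex.obj K).map (c.inj j)) :=
  isColimitCofanOfEval _ _ fun n ↦
    let h (x : Antidiagonal n) : IsColimit (Cofan.mk ((T.obj (K.X x.1.1)).obj (c.pt.X x.1.2))
        fun j ↦ (T.obj (K.X x.1.1)).map ((c.inj j).f x.1.2)) :=
      isColimitCofanMkObjOfIsColimit (T.obj (K.X x.1.1)) _ _ (isColimitCofanEval hc x.1.2)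
    Cofan.IsColimit.mk _
      (fun s ↦ Cofan.IsColimit.desc (isColimitTotal T K c.pt n) fun x ↦
        Cofan.IsColimit.desc (h x) fun j ↦
          ιMapBifunctor K (L j) T (.up ℤ) x.1.1 x.1.2 n x.2 ≫ s.inj j)
      (fun s j ↦ Cofan.IsColimit.hom_ext (isColimitTotal T K (L j) n) _ _ fun x ↦ by
        refine (comp_comp_of_comp_eq (ι_map₂_map T K (c.inj j) x.1.1 x.1.2 n x.2) _).trans ?_
        refine (congrArg _ (Cofan.IsColimit.fac (isColimitTotal T K c.pt n) _ x)).trans ?_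
        exact Cofan.IsColimit.fac (h x) _ j)
      (fun s m hm ↦ Cofan.IsColimit.hom_ext (isColimitTotal T K c.pt n) _ _ fun x ↦
        Cofan.IsColimit.hom_ext (h x) _ _ fun j ↦ by
          rw [Cofan.IsColimit.fac (isColimitTotal T K c.pt n), Cofan.IsColimit.fac (h x), ← hm j]
          exact (comp_comp_of_comp_eq (ι_map₂_map T K (c.inj j) x.1.1 x.1.2 n x.2) _).symm)

/-- A complex with zero differential is the coproduct of its terms. -/
def isColimitSingleOfZero (L : CochainComplex C ℤ) (hL : ∀ i j, L.d i j = 0) :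
    IsColimit (Cofan.mk L fun q : ℤ ↦ mkHomFromSingle (𝟙 (L.X q)) (fun k _ ↦ by simp [hL])) :=
  isColimitCofanOfEval _ _ fun n ↦
    let i : ((single C (.up ℤ) n).obj (L.X n)).X n ≅ L.X n := singleObjXSelf (.up ℤ) n (L.X n)
    have hi : (mkHomFromSingle (𝟙 (L.X n)) (fun k _ ↦ by simp [hL]) :
        (single C (.up ℤ) n).obj (L.X n) ⟶ L).f n = i.hom := by simp [i]
    Cofan.IsColimit.mk _ (fun s ↦ i.inv ≫ s.inj n)
      (fun s q ↦ by
        by_cases h : n = q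
        · subst h
          exact (congrArg (· ≫ i.inv ≫ s.inj n) hi).trans (Iso.hom_inv_id_assoc _ _)
        · exact (isZero_single_obj_X (.up ℤ) q (L.X q) n h).eq_of_src _ _)
      (fun s m hm ↦ by
        rw [← hm n]
        exact ((congrArg (fun f ↦ i.inv ≫ f ≫ m) hi).trans (Iso.inv_hom_id_assoc _ _)).symm)

end Total

/-! ### Tensor products with shifted objects -/

section Single

open HomologicalComplex

variable {C : Type*} [Category* C] [Abelian C] [HasCoproducts.{0} C]
  (T : C ⥤ C ⥤ C) [T.PreservesZeroMorphisms] [∀ A, (T.obj A).PreservesZeroMorphisms]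

lemma isIso_units_smul {D : Type*} [Category* D] [Preadditive D] {X Y : D} (u : ℤˣ) (f : X ⟶ Y)
    [IsIso f] : IsIso (u • f) :=
  ⟨u⁻¹ • inv f, by simp [smul_smul], by simp [smul_smul]⟩

/-- The inclusion of the summands `T(K^(m-n), A)` in the total complex of `K` and the single
complex on `A` in degree `n`. -/
def ιSingle (K : CochainComplex C ℤ) (A : C) (n p m : ℤ) (h : p + n = m) :
    (T.obj (K.X p)).obj A ⟶ ((T.map₂CochainComplex.obj K).obj ((single C (.up ℤ) n).obj A)).X m :=
  (T.obj (K.X p)).map (singleObjXSelf (.up ℤ) n A).inv ≫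
    ιMapBifunctor K ((single C (.up ℤ) n).obj A) T (.up ℤ) p n m h

instance isIso_ιSingle (K : CochainComplex C ℤ) (A : C) (n p m : ℤ) (h : p + n = m) :
    IsIso (ιSingle T K A n p m h) := by
  have := isIso_inj_of_isZero (isColimitTotal T K ((single C (.up ℤ) n).obj A) m) ⟨(p, n), h⟩
    (fun x hx ↦ (T.obj (K.X x.1.1)).map_isZero (isZero_single_obj_X (.up ℤ) n A _ fun hn ↦ hx (by
      ext <;> have := x.2 <;> dsimp at * <;> omega)))
  exact IsIso.comp_isIso' inferInstance this

lemma ι_mapBifunctor_d (K L : CochainComplex C ℤ) (p q n p' q' n' : ℤ) (h : p + q = n)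
    (hp : p + 1 = p') (hq : q + 1 = q') (hn : n + 1 = n') :
    ιMapBifunctor K L T (.up ℤ) p q n h ≫ (mapBifunctor K L T (.up ℤ)).d n n' =
      (T.map (K.d p p')).app (L.X q) ≫
        ιMapBifunctor K L T (.up ℤ) p' q n' (show p' + q = n' by omega) +
      p.negOnePow • ((T.obj (K.X p)).map (L.d q q') ≫
        ιMapBifunctor K L T (.up ℤ) p q' n' (show p + q' = n' by omega)) := by
  rw [mapBifunctor.d_eq, Preadditive.comp_add, mapBifunctor.ι_D₁, mapBifunctor.ι_D₂,
    mapBifunctor.d₁_eq _ _ _ _ hp _ _ (show p' + q = n' by omega),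
    mapBifunctor.d₂_eq _ _ _ _ _ hq _ (show p + q' = n' by omega)]
  congr 1
  exact one_smul _ _

lemma ιSingle_d (K : CochainComplex C ℤ) (A : C) (n p m p' m' : ℤ) (h : p + n = m)
    (h' : p' + n = m') (hm : m + 1 = m') :
    ιSingle T K A n p m h ≫
      ((T.map₂CochainComplex.obj K).obj ((single C (.up ℤ) n).obj A)).d m m' =
    (T.map (K.d p p')).app A ≫ ιSingle T K A n p' m' h' := by
  refine (Category.assoc _ _ _).trans ((congrArg _ (ι_mapBifunctor_d T K
    ((single C (.up ℤ) n).obj A) p n m p' (n + 1) m' h (by omega) rfl hm)).trans ?_)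
  simp only [single_obj_d, Functor.map_zero, zero_comp, smul_zero, add_zero, ιSingle]
  exact comp_comp_of_comp_eq ((T.map (K.d p p')).naturality _) _

lemma ιSingle_map_app {K L : CochainComplex C ℤ} (f : K ⟶ L) (A : C) (n p m : ℤ) (h : p + n = m) :
    ιSingle T K A n p m h ≫
      ((T.map₂CochainComplex.map f).app ((single C (.up ℤ) n).obj A)).f m =
    (T.map (f.f p)).app A ≫ ιSingle T L A n p m h := by
  refine (Category.assoc _ _ _).trans ((congrArg _ (ι_map₂_map_app T f _ p n m h)).trans ?_)
  exact comp_comp_of_comp_eq ((T.map (f.f p)).naturality _) _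

lemma ιSingle_map_map (K : CochainComplex C ℤ) {A B : C} (f : A ⟶ B) (n p m : ℤ) (h : p + n = m) :
    ιSingle T K A n p m h ≫
      ((T.map₂CochainComplex.obj K).map ((single C (.up ℤ) n).map f)).f m =
    (T.obj (K.X p)).map f ≫ ιSingle T K B n p m h := by
  refine (Category.assoc _ _ _).trans ((congrArg _ (ι_map₂_map T K _ p n m h)).trans ?_)
  refine comp_comp_of_comp_eq ?_ _
  rw [← Functor.map_comp, ← Functor.map_comp, single_map_f_self, Iso.inv_hom_id_assoc]

/-- The inclusions `ιSingle`, with the signs that make them commute with the differentials of the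
shifted complex. -/
def ιSingleIso (K : CochainComplex C ℤ) (A : C) (n p m : ℤ) (h : p + n = m) :
    (T.obj (K.X p)).obj A ≅ ((T.map₂CochainComplex.obj K).obj ((single C (.up ℤ) n).obj A)).X m :=
  have := isIso_units_smul (n * m).negOnePow (ιSingle T K A n p m h)
  asIso ((n * m).negOnePow • ιSingle T K A n p m h)

/-- Up to signs, the total complex of `K` and the single complex on `A` in degree `n` is the
shift by `-n` of the complex `T(K, A)`. -/
def tensorSingleIso (A : C) (n : ℤ) :
    (T.flip.obj A).mapHomologicalComplex (.up ℤ) ⋙ shiftFunctor (CochainComplex C ℤ) (-n) ≅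
      T.map₂CochainComplex.flip.obj ((single C (.up ℤ) n).obj A) :=
  NatIso.ofComponents (fun K ↦
    Hom.isoOfComponents (fun m ↦ ιSingleIso T K A n (m + -n) m (by omega)) (by
      intro m m' hm
      obtain rfl : m + 1 = m' := hm
      refine (Linear.units_smul_comp (n * m).negOnePow
        (ιSingle T K A n (m + -n) m (by omega)) _).trans ((congrArg _ (ιSingle_d T K A n (m + -n) m
        (m + 1 + -n) (m + 1) (by omega) (by omega) rfl)).trans ?_)
      change _ = ((-n).negOnePow • (T.map (K.d (m + -n) (m + 1 + -n))).app A) ≫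
        ((n * (m + 1)).negOnePow • ιSingle T K A n (m + 1 + -n) (m + 1) _)
      rw [Linear.units_smul_comp, Linear.comp_units_smul, smul_smul, ← Int.negOnePow_add]
      congr 2
      ring))
    (by
      intro K L f
      ext m : 1
      refine (Linear.comp_units_smul ((T.map (f.f (m + -n))).app A) (n * m).negOnePow
        (ιSingle T L A n (m + -n) m (by omega))).trans
        (Eq.trans ?_ (Linear.units_smul_comp (n * m).negOnePow
          (ιSingle T K A n (m + -n) m (by omega)) _).symm)
      exact congrArg _ (ιSingle_map_app T f A n (m + -n) m (by omega)).symm)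

end Single

/-! ### Total complexes and quasi-isomorphisms -/

section Flat

open HomologicalComplex

variable {C : Type*} [Category* C] [Abelian C]

/-- In a morphism of short exact sequences of complexes, the middle morphism is a
quasi-isomorphism if the outer ones are. -/
lemma quasiIso_τ₂ {S₁ S₂ : ShortComplex (CochainComplex C ℤ)} (φ : S₁ ⟶ S₂) (h₁ : S₁.ShortExact)
    (h₂ : S₂.ShortExact) (hφ₁ : QuasiIso φ.τ₁) (hφ₃ : QuasiIso φ.τ₃) : QuasiIso φ.τ₂ := by
  let := HasDerivedCategory.standard C
  rw [← DerivedCategory.isIso_Q_map_iff_quasiIso]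
  exact Pretriangulated.isIso₂_of_isIso₁₃ (DerivedCategory.triangleOfSES.map h₁ h₂ φ)
    (DerivedCategory.triangleOfSES_distinguished h₁)
    (DerivedCategory.triangleOfSES_distinguished h₂)
    ((DerivedCategory.isIso_Q_map_iff_quasiIso (φ := φ.τ₁)).2 hφ₁)
    ((DerivedCategory.isIso_Q_map_iff_quasiIso (φ := φ.τ₃)).2 hφ₃)

/-- The complex with zero differential and given terms. -/
def zeroComplex (X : ℤ → C) : CochainComplex C ℤ where
  X := X
  d _ _ := 0

/-- The short complex of complexes `0 → Z → L → L/Z → 0`, where `Z` consists of the cycles of `L`.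
The outer complexes have zero differential. -/
def cyclesSequence (L : CochainComplex C ℤ) : ShortComplex (CochainComplex C ℤ) where
  X₁ := zeroComplex fun n ↦ kernel (L.d n (n + 1))
  X₂ := L
  X₃ := zeroComplex fun n ↦ Abelian.coimage (L.d n (n + 1))
  f :=
    { f n := kernel.ι _
      comm' n m h := by
        obtain rfl : n + 1 = m := h
        exact (kernel.condition _).trans zero_comp.symm }
  g :=
    { f n := cokernel.π _
      comm' n m h := by
        obtain rfl : n + 1 = m := h
        have h : L.d n (n + 1) ≫ cokernel.π (kernel.ι (L.d (n + 1) (n + 1 + 1))) = 0 := by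
          have := kernel.lift_ι (L.d (n + 1) (n + 1 + 1)) (L.d n (n + 1)) (by simp)
          conv_lhs => enter [1]; rw [← this]
          rw [Category.assoc, cokernel.condition, comp_zero]
        exact comp_zero.trans h.symm }
  zero := by
    ext n
    exact cokernel.condition _

lemma cyclesSequence_shortExact_eval (L : CochainComplex C ℤ) (n : ℤ) :
    ((cyclesSequence L).map (eval C _ n)).ShortExact where
  exact := ShortComplex.exact_of_g_is_cokernel _ (cokernelIsCokernel (kernel.ι (L.d n (n + 1))))
  mono_f := inferInstanceAs (Mono (kernel.ι (L.d n (n + 1))))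
  epi_g := inferInstanceAs (Epi (cokernel.π (kernel.ι (L.d n (n + 1)))))

lemma cyclesSequence_shortExact (L : CochainComplex C ℤ) : (cyclesSequence L).ShortExact :=
  shortExact_of_degreewise_shortExact _ (cyclesSequence_shortExact_eval L)

lemma quasiIso_map_iff_of_iso {D : Type*} [Category* D] {F G : D ⥤ CochainComplex C ℤ}
    (e : F ≅ G) {X Y : D} (f : X ⟶ Y) : QuasiIso (F.map f) ↔ QuasiIso (G.map f) :=
  quasiIso_iff_of_arrow_mk_iso (F.map f) (G.map f)
    (Arrow.isoMk (e.app X) (e.app Y) (e.hom.naturality f).symm)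

variable [HasCoproducts.{0} C]
  (T : C ⥤ C ⥤ C) [T.PreservesZeroMorphisms] [∀ A, (T.obj A).PreservesZeroMorphisms]

lemma quasiIso_map₂_app_single {K L : CochainComplex C ℤ} (f : K ⟶ L) [QuasiIso f] (A : C)
    [PreservesFiniteLimits (T.flip.obj A)] [PreservesFiniteColimits (T.flip.obj A)] (n : ℤ) :
    QuasiIso ((T.map₂CochainComplex.map f).app ((single C (.up ℤ) n).obj A)) := by
  have : (T.flip.obj A).Additive := Functor.additive_of_preserves_binary_products _
  refine (quasiIso_map_iff_of_iso (tensorSingleIso T A n) f).1 ?_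
  dsimp only [Functor.comp_map]
  infer_instance

lemma quasiIso_map₂_map_iff (K : CochainComplex C ℤ) {L M : CochainComplex C ℤ} (f : L ⟶ M) :
    QuasiIso ((T.map₂CochainComplex.obj K).map f) ↔
      QuasiIso ((T.flip.map₂CochainComplex.map f).app K) :=
  (quasiIso_iff_of_arrow_mk_iso ((T.flip.map₂CochainComplex.map f).app K)
    ((T.map₂CochainComplex.obj K).map f) (Arrow.isoMk (mapBifunctorFlipIso K L T (.up ℤ))
    (mapBifunctorFlipIso K M T (.up ℤ))
    (mapBifunctorFlipIso_hom_naturality (𝟙 K) f T (.up ℤ)).symm)).symm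

variable [AB4OfSize.{0} C]

lemma quasiIso_map₂_app_zeroComplex {K L : CochainComplex C ℤ} (f : K ⟶ L) [QuasiIso f]
    (hT : ∀ A, PreservesColimitsOfShape (Discrete ℤ) (T.obj A)) (X : ℤ → C)
    (h₁ : ∀ n, PreservesFiniteLimits (T.flip.obj (X n)))
    (h₂ : ∀ n, PreservesFiniteColimits (T.flip.obj (X n))) :
    QuasiIso ((T.map₂CochainComplex.map f).app (zeroComplex X)) := by
  have hc := isColimitSingleOfZero (zeroComplex X) (fun _ _ ↦ rfl)
  exact quasiIso_of_isColimit_cofan (isColimitMap₂ T hT K hc) (isColimitMap₂ T hT L hc)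
    (fun q ↦ (T.map₂CochainComplex.map f).app ((single C (.up ℤ) q).obj (X q)))
    (fun q ↦ quasiIso_map₂_app_single T f (X q) q) _
    (fun q ↦ (T.map₂CochainComplex.map f).naturality _)

/-- Let `0 → Z → M → M/Z → 0` be the sequence `cyclesSequence M`. If it remains exact under the
functors `T(K^p, -)` and `T(L^p, -)`, and if the functors `T(-, Z^n)` and `T(-, M^n/Z^n)` are exact,
then `T(-, M)` preserves the quasi-isomorphism `f : K ⟶ L`. Indeed, `Z` and `M/Z` are coproducts of
shifted objects. -/
theorem quasiIso_map₂_app {K L : CochainComplex C ℤ} (f : K ⟶ L) [QuasiIso f]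
    (hT : ∀ A, PreservesColimitsOfShape (Discrete ℤ) (T.obj A))
    (hT' : ∀ A, PreservesFiniteColimits (T.flip.obj A)) (M : CochainComplex C ℤ)
    (hZ : ∀ n, PreservesFiniteLimits (T.flip.obj (kernel (M.d n (n + 1)))))
    (hB : ∀ n, PreservesFiniteLimits (T.flip.obj (Abelian.coimage (M.d n (n + 1)))))
    (hK : ∀ p q, (((cyclesSequence M).map (eval C _ q)).map (T.obj (K.X p))).ShortExact)
    (hL : ∀ p q, (((cyclesSequence M).map (eval C _ q)).map (T.obj (L.X p))).ShortExact) :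
    QuasiIso ((T.map₂CochainComplex.map f).app M) :=
  quasiIso_τ₂ ((cyclesSequence M).mapNatTrans (T.map₂CochainComplex.map f))
    (shortExact_map₂_obj T K _ hK) (shortExact_map₂_obj T L _ hL)
    (quasiIso_map₂_app_zeroComplex T f hT _ hZ (fun _ ↦ hT' _))
    (quasiIso_map₂_app_zeroComplex T f hT _ hB (fun _ ↦ hT' _))

end Flat

/-! ### Functorial flat resolutions of unbounded complexes -/

section FlatResolution

open HomologicalComplex

variable {C : Type*} [Category* C] [Abelian C]

/-- A bifunctor which preserves small colimits in each variable. -/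
class IsBicocontinuous (T : C ⥤ C ⥤ C) : Prop where
  obj (T) (A : C) : PreservesColimitsOfSize.{0, 0} (T.obj A)
  flip (T) (A : C) : PreservesColimitsOfSize.{0, 0} (T.flip.obj A)

attribute [instance] IsBicocontinuous.obj IsBicocontinuous.flip

instance (T : C ⥤ C ⥤ C) [IsBicocontinuous T] : IsBicocontinuous T.flip where
  obj := IsBicocontinuous.flip T
  flip := IsBicocontinuous.obj T

/-- A class of flat objects for a bifunctor `T` which is closed under subobjects (so that every
object has flat dimension at most one), together with functorial epimorphisms from flat objects.
The functor `P` is not required to be additive: it only has to preserve zero morphisms in order to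
act on complexes. -/
structure FlatResolution (T : C ⥤ C ⥤ C) where
  /-- the flat objects -/
  flat : ObjectProperty C
  flat_of_mono {A B : C} (f : A ⟶ B) [Mono f] : flat B → flat A
  flat_biprod {A B : C} : flat A → flat B → flat (A ⊞ B)
  exact_obj (A : C) : flat A → PreservesFiniteLimits (T.obj A)
  exact_flip (A : C) : flat A → PreservesFiniteLimits (T.flip.obj A)
  /-- the functor which sends an object to a flat object -/
  P : C ⥤ C
  preservesZeroMorphisms : P.PreservesZeroMorphisms
  /-- the natural epimorphism -/
  ε : P ⟶ 𝟭 C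
  epi_ε (A : C) : Epi (ε.app A)
  flat_P (A : C) : flat (P.obj A)

namespace FlatResolution

attribute [instance] preservesZeroMorphisms epi_ε

variable {T : C ⥤ C ⥤ C} (Λ : FlatResolution T)

/-- The same flat resolutions, for the flipped bifunctor. -/
def flip : FlatResolution T.flip where
  flat := Λ.flat
  flat_of_mono := Λ.flat_of_mono
  flat_biprod := Λ.flat_biprod
  exact_obj := Λ.exact_flip
  exact_flip := Λ.exact_obj
  P := Λ.P
  preservesZeroMorphisms := Λ.preservesZeroMorphisms
  ε := Λ.ε
  epi_ε := Λ.epi_ε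
  flat_P := Λ.flat_P

/-- The kernel of `P A ⟶ A`. -/
def P₁ : C ⥤ C where
  obj A := kernel (Λ.ε.app A)
  map f := kernel.map _ _ (Λ.P.map f) f (Λ.ε.naturality f).symm

/-- The inclusion of the kernel of `P A ⟶ A`. -/
def ι : Λ.P₁ ⟶ Λ.P where
  app A := kernel.ι (Λ.ε.app A)
  naturality _ _ _ := kernel.lift_ι _ _ _

instance (A : C) : Mono (Λ.ι.app A) := inferInstanceAs (Mono (kernel.ι _))

instance : Λ.P₁.PreservesZeroMorphisms where
  map_zero A B := by
    rw [← cancel_mono (Λ.ι.app B), NatTrans.naturality, Functor.map_zero, zero_comp, comp_zero]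

lemma flat_P₁ (A : C) : Λ.flat (Λ.P₁.obj A) := Λ.flat_of_mono (Λ.ι.app A) (Λ.flat_P A)

@[simp]
lemma ι_app_ε_app (A : C) : Λ.ι.app A ≫ Λ.ε.app A = 0 := kernel.condition _

/-- The functorial flat resolution of length one of an object. -/
def sequence (A : C) : ShortComplex C := ShortComplex.mk (Λ.ι.app A) (Λ.ε.app A) (by simp)

lemma sequence_shortExact (A : C) : (Λ.sequence A).ShortExact where
  exact := ShortComplex.exact_of_f_is_kernel _ (kernelIsKernel (Λ.ε.app A))
  mono_f := inferInstanceAs (Mono (Λ.ι.app A))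
  epi_g := Λ.epi_ε A

/-- The short exact sequence of complexes obtained from the functorial resolutions of the terms of
a complex. -/
def complexSequence : CochainComplex C ℤ ⥤ ShortComplex (CochainComplex C ℤ) where
  obj K :=
    { X₁ := (Λ.P₁.mapHomologicalComplex _).obj K
      X₂ := (Λ.P.mapHomologicalComplex _).obj K
      X₃ := K
      f := (NatTrans.mapHomologicalComplex Λ.ι _).app K
      g := { f n := Λ.ε.app (K.X n), comm' _ _ _ := (Λ.ε.naturality _).symm }
      zero := by ext n; exact Λ.ι_app_ε_app _ }
  map f :=
    { τ₁ := (Λ.P₁.mapHomologicalComplex _).map f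
      τ₂ := (Λ.P.mapHomologicalComplex _).map f
      τ₃ := f
      comm₁₂ := (NatTrans.mapHomologicalComplex Λ.ι _).naturality f
      comm₂₃ := by ext n; exact Λ.ε.naturality _ }

lemma complexSequence_shortExact (K : CochainComplex C ℤ) :
    (Λ.complexSequence.obj K).ShortExact :=
  shortExact_of_degreewise_shortExact _ fun n ↦ Λ.sequence_shortExact (K.X n)

/-- The functorial flat resolution of a complex: the mapping cone of the resolutions of length one
of its terms. -/
def R : CochainComplex C ℤ ⥤ CochainComplex C ℤ where
  obj K := CochainComplex.mappingCone (Λ.complexSequence.obj K).f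
  map φ := CochainComplex.mappingCone.map _ _ (Λ.complexSequence.map φ).τ₁
    (Λ.complexSequence.map φ).τ₂ (Λ.complexSequence.map φ).comm₁₂.symm
  map_id K := by
    simp only [CategoryTheory.Functor.map_id]
    exact CochainComplex.mappingCone.map_id _
  map_comp φ ψ := by
    simp only [CategoryTheory.Functor.map_comp]
    exact CochainComplex.mappingCone.map_comp _ _ _ _ _ _ _ _ _

/-- The natural quasi-isomorphism from the flat resolution. -/
def ρ : Λ.R ⟶ 𝟭 _ where
  app K := CochainComplex.mappingCone.descShortComplex (Λ.complexSequence.obj K)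
  naturality _ _ φ := CochainComplex.mappingCone.map_descShortComplex _ _ (Λ.complexSequence.map φ)

instance (K : CochainComplex C ℤ) : QuasiIso (Λ.ρ.app K) :=
  CochainComplex.mappingCone.quasiIso_descShortComplex (Λ.complexSequence_shortExact K)

instance {K L : CochainComplex C ℤ} (φ : K ⟶ L) [QuasiIso φ] : QuasiIso (Λ.R.map φ) := by
  have h : QuasiIso (Λ.R.map φ ≫ Λ.ρ.app L) := by
    rw [Λ.ρ.naturality]
    dsimp
    infer_instance
  exact quasiIso_of_comp_right (Λ.R.map φ) (Λ.ρ.app L)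

/-- A complex is flat if its terms are. Since flat objects are closed under subobjects, no
boundedness condition is needed for such a complex to be acyclic for the tensor product. -/
def flatComplex : ObjectProperty (CochainComplex C ℤ) := fun K ↦ ∀ n, Λ.flat (K.X n)

lemma flat_of_iso {A B : C} (e : A ≅ B) (h : Λ.flat A) : Λ.flat B := Λ.flat_of_mono e.inv h

lemma flatComplex_mappingCone {K L : CochainComplex C ℤ} (φ : K ⟶ L) (hK : Λ.flatComplex K)
    (hL : Λ.flatComplex L) : Λ.flatComplex (CochainComplex.mappingCone φ) := fun n ↦
  Λ.flat_of_iso (homotopyCofiber.XIsoBiprod φ n (n + 1) rfl).symm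
    (Λ.flat_biprod (hK _) (hL _))

lemma flatComplex_R (K : CochainComplex C ℤ) : Λ.flatComplex (Λ.R.obj K) :=
  Λ.flatComplex_mappingCone _ (fun _ ↦ Λ.flat_P₁ _) (fun _ ↦ Λ.flat_P _)

variable [HasCoproducts.{0} C] [T.PreservesZeroMorphisms]
  [∀ A, (T.obj A).PreservesZeroMorphisms] [AB4OfSize.{0} C] [IsBicocontinuous T]

lemma quasiIso_map₂_app {K L M : CochainComplex C ℤ} (f : K ⟶ L) [QuasiIso f]
    (hK : Λ.flatComplex K) (hL : Λ.flatComplex L) (hM : Λ.flatComplex M) :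
    QuasiIso ((T.map₂CochainComplex.map f).app M) :=
  SheafHomology.quasiIso_map₂_app T f inferInstance inferInstance M
    (fun n ↦ Λ.exact_flip _ (Λ.flat_of_mono (kernel.ι _) (hM n)))
    (fun n ↦ Λ.exact_flip _ (Λ.flat_of_mono (Abelian.factorThruCoimage _) (hM (n + 1))))
    (fun p q ↦ have := Λ.exact_obj _ (hK p)
      (cyclesSequence_shortExact_eval M q).map_of_exact _)
    (fun p q ↦ have := Λ.exact_obj _ (hL p)
      (cyclesSequence_shortExact_eval M q).map_of_exact _)

lemma quasiIso_map₂_map {K L M : CochainComplex C ℤ} (f : L ⟶ M) [QuasiIso f]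
    (hK : Λ.flatComplex K) (hL : Λ.flatComplex L) (hM : Λ.flatComplex M) :
    QuasiIso ((T.map₂CochainComplex.obj K).map f) :=
  (quasiIso_map₂_map_iff T K f).2 (Λ.flip.quasiIso_map₂_app f hL hM hK)

end FlatResolution

end FlatResolution

/-! ### The derived bifunctor -/

section DerivedBifunctor

variable {C : Type*} [Category* C] [Abelian C] [HasCountableCoproducts C] [HasCoproducts.{0} C]
  {T : C ⥤ C ⥤ C} [T.Additive] [∀ A, (T.obj A).Additive] [AB4OfSize.{0} C] [IsBicocontinuous T]
  (Λ : FlatResolution T)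

namespace FlatResolution

lemma quasiIso_complexBifunctor_map {K K' L L' : CochainComplex C ℤ} (f : K ⟶ K') (g : L ⟶ L')
    [QuasiIso f] [QuasiIso g] (hK : Λ.flatComplex K) (hK' : Λ.flatComplex K')
    (hL : Λ.flatComplex L) (hL' : Λ.flatComplex L') :
    QuasiIso ((complexBifunctor T).map (X := (K, L)) (Y := (K', L')) (Prod.mkHom f g)) := by
  have := Λ.quasiIso_map₂_app f hK hK' hL
  have := Λ.quasiIso_map₂_map g hK' hL hL'
  exact quasiIso_comp ((T.map₂CochainComplex.map f).app L) ((T.map₂CochainComplex.obj K').map g)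

variable [HasDerivedCategory.{w} C]

/-- The functorial flat resolution of a pair of complexes. -/
abbrev R₂ : CochainComplex C ℤ × CochainComplex C ℤ ⥤ CochainComplex C ℤ × CochainComplex C ℤ :=
  Λ.R.prod Λ.R

/-- The natural quasi-isomorphisms from the flat resolutions of a pair of complexes. -/
def ρ₂ : Λ.R₂ ⟶ 𝟭 _ where
  app X := Prod.mkHom (Λ.ρ.app X.1) (Λ.ρ.app X.2)
  naturality _ _ f := Prod.ext (Λ.ρ.naturality f.1) (Λ.ρ.naturality f.2)

lemma isInvertedBy :
    (quasiIsoPairs C).IsInvertedBy (Λ.R₂ ⋙ complexBifunctor T ⋙ DerivedCategory.Q) := by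
  rintro ⟨K, L⟩ ⟨K', L'⟩ ⟨f, g⟩ ⟨(hf : QuasiIso f), (hg : QuasiIso g)⟩
  exact (DerivedCategory.isIso_Q_map_iff_quasiIso _ _).2 (Λ.quasiIso_complexBifunctor_map
    (Λ.R.map f) (Λ.R.map g) (Λ.flatComplex_R _) (Λ.flatComplex_R _) (Λ.flatComplex_R _)
    (Λ.flatComplex_R _))

/-- The functor induced on the derived category by the tensor product of flat resolutions. -/
def derived : DerivedCategory C × DerivedCategory C ⥤ DerivedCategory C :=
  Localization.lift _ Λ.isInvertedBy (DerivedCategory.Q.prod DerivedCategory.Q)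

/-- The functor `Λ.derived` is induced by the tensor product of flat resolutions. -/
def derivedFac : (DerivedCategory.Q (C := C)).prod (DerivedCategory.Q (C := C)) ⋙ Λ.derived ≅
    Λ.R₂ ⋙ complexBifunctor T ⋙ DerivedCategory.Q :=
  Localization.Lifting.iso (DerivedCategory.Q.prod DerivedCategory.Q) (quasiIsoPairs C)
    (Λ.R₂ ⋙ complexBifunctor T ⋙ DerivedCategory.Q)
    (Localization.lift _ Λ.isInvertedBy (DerivedCategory.Q.prod DerivedCategory.Q))

instance : Λ.derived.IsLeftDerivedFunctor (Λ.derivedFac.hom ≫ Functor.whiskerRight Λ.ρ₂ _)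
    (quasiIsoPairs C) :=
  ⟨isRightKanExtension_of_resolution (complexBifunctor T ⋙ DerivedCategory.Q)
    (DerivedCategory.Q.prod DerivedCategory.Q) (quasiIsoPairs C) Λ.R₂ Λ.ρ₂
    (fun X ↦ ⟨(inferInstance : QuasiIso (Λ.ρ.app X.1)), (inferInstance : QuasiIso (Λ.ρ.app X.2))⟩)
    (fun X ↦ (DerivedCategory.isIso_Q_map_iff_quasiIso _ _).2 (Λ.quasiIso_complexBifunctor_map
      (Λ.ρ.app (Λ.R.obj X.1)) (Λ.ρ.app (Λ.R.obj X.2))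
      (Λ.flatComplex_R _) (Λ.flatComplex_R _) (Λ.flatComplex_R _) (Λ.flatComplex_R _))) _ _⟩

include Λ in
theorem hasDerivedBifunctor : HasDerivedBifunctor T :=
  Functor.HasLeftDerivedFunctor.mk' _ (Λ.derivedFac.hom ≫ Functor.whiskerRight Λ.ρ₂ _)

variable [HasDerivedBifunctor T]

variable (T) in
/-- The canonical morphism `K ⊗ᴸ L ⟶ K ⊗ L`. -/
abbrev derivedCounit : (DerivedCategory.Q (C := C)).prod (DerivedCategory.Q (C := C)) ⋙
    derivedBifunctor T ⟶ complexBifunctor T ⋙ DerivedCategory.Q :=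
  Functor.totalLeftDerivedCounit (complexBifunctor T ⋙ DerivedCategory.Q)
    ((DerivedCategory.Q (C := C)).prod (DerivedCategory.Q (C := C))) (quasiIsoPairs C)

instance : (derivedBifunctor T).IsLeftDerivedFunctor (derivedCounit T) (quasiIsoPairs C) :=
  inferInstanceAs (Functor.IsLeftDerivedFunctor (Functor.totalLeftDerived _ _ _)
    (Functor.totalLeftDerivedCounit (complexBifunctor T ⋙ DerivedCategory.Q)
      ((DerivedCategory.Q (C := C)).prod (DerivedCategory.Q (C := C))) (quasiIsoPairs C)) _)

/-- The derived bifunctor is computed by those complexes for which the flat resolutions induce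
a quasi-isomorphism. -/
lemma isIso_derivedCounit (X : CochainComplex C ℤ × CochainComplex C ℤ)
    (h : QuasiIso ((complexBifunctor T).map (Λ.ρ₂.app X))) :
    IsIso ((derivedCounit T).app X) := by
  let α := Λ.derivedFac.hom ≫ Functor.whiskerRight Λ.ρ₂ (complexBifunctor T ⋙ DerivedCategory.Q)
  let u : derivedBifunctor T ≅ Λ.derived :=
    Functor.leftDerivedUnique _ _ (derivedCounit T) α (quasiIsoPairs C)
  have hu : u.hom.app _ ≫ α.app X = (derivedCounit T).app X :=
    (Functor.leftDerivedNatTrans_app _ _ (derivedCounit T) α (quasiIsoPairs C) (𝟙 _) X).trans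
      (Category.comp_id _)
  rw [← hu]
  have : IsIso ((complexBifunctor T ⋙ DerivedCategory.Q).map (Λ.ρ₂.app X)) :=
    (DerivedCategory.isIso_Q_map_iff_quasiIso _ _).2 h
  dsimp [α]
  infer_instance

/-- The derived bifunctor is computed by flat complexes. -/
lemma isIso_derivedCounit_of_flat (K L : CochainComplex C ℤ) (hK : Λ.flatComplex K)
    (hL : Λ.flatComplex L) : IsIso ((derivedCounit T).app (K, L)) :=
  Λ.isIso_derivedCounit _ (Λ.quasiIso_complexBifunctor_map (Λ.ρ.app K) (Λ.ρ.app L)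
    (Λ.flatComplex_R _) hK (Λ.flatComplex_R _) hL)

/-- The derived bifunctor is computed by pairs whose first complex only is flat, provided that
the flat resolution of the second complex induces a quasi-isomorphism. -/
lemma isIso_derivedCounit_of_flat_left (K L : CochainComplex C ℤ) (hK : Λ.flatComplex K)
    (h : QuasiIso ((T.map₂CochainComplex.obj K).map (Λ.ρ.app L))) :
    IsIso ((derivedCounit T).app (K, L)) := by
  have := Λ.quasiIso_map₂_app (Λ.ρ.app K) (Λ.flatComplex_R _) hK (Λ.flatComplex_R L)
  exact Λ.isIso_derivedCounit _ (quasiIso_comp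
    ((T.map₂CochainComplex.map (Λ.ρ.app K)).app (Λ.R.obj L))
    ((T.map₂CochainComplex.obj K).map (Λ.ρ.app L)))

/-- The derived bifunctor is computed by pairs whose second complex only is flat, provided that
the flat resolution of the first complex induces a quasi-isomorphism. -/
lemma isIso_derivedCounit_of_flat_right (K L : CochainComplex C ℤ) (hL : Λ.flatComplex L)
    (h : QuasiIso ((T.map₂CochainComplex.map (Λ.ρ.app K)).app L)) :
    IsIso ((derivedCounit T).app (K, L)) := by
  have := Λ.quasiIso_map₂_map (Λ.ρ.app L) (Λ.flatComplex_R K) (Λ.flatComplex_R _) hL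
  have h' := quasiIso_comp ((T.map₂CochainComplex.obj (Λ.R.obj K)).map (Λ.ρ.app L))
    ((T.map₂CochainComplex.map (Λ.ρ.app K)).app L)
  exact Λ.isIso_derivedCounit _ ((congrArg (fun f ↦ QuasiIso f)
    ((T.map₂CochainComplex.map (Λ.ρ.app K)).naturality (Λ.ρ.app L))).mp h')

end FlatResolution

end DerivedBifunctor

/-! ### Coproducts in the derived category -/

section DerivedCoproducts

lemma nonempty_isColimit_cofan {D : Type*} [Category* D] {J : Type*} {X : J → D} (c : Cofan X)
    (h : ∀ {Y : D} (f : ∀ j, X j ⟶ Y), ∃ g : c.pt ⟶ Y, ∀ j, c.inj j ≫ g = f j)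
    (h' : ∀ {Y : D} (f g : c.pt ⟶ Y), (∀ j, c.inj j ≫ f = c.inj j ≫ g) → f = g) :
    Nonempty (IsColimit c) :=
  ⟨Cofan.IsColimit.mk _ (fun s ↦ (h s.inj).choose) (fun s ↦ (h s.inj).choose_spec)
    (fun s _ hm ↦ h' _ _ fun j ↦ (hm j).trans ((h s.inj).choose_spec j).symm)⟩

open HomologicalComplex

variable {C : Type*} [Category* C] [Abelian C]

/-- A morphism from a coproduct of complexes is nullhomotopic if its components are. -/
def homotopyOfIsColimit {J : Type*} [HasCoproductsOfShape J C] {K : J → CochainComplex C ℤ}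
    {c : Cofan K} (hc : IsColimit c) {L : CochainComplex C ℤ} (f : c.pt ⟶ L)
    (h : ∀ j, Homotopy (c.inj j ≫ f) 0) : Homotopy f 0 where
  hom p q := Cofan.IsColimit.desc (isColimitCofanEval hc p) fun j ↦ (h j).hom p q
  zero p q hpq := Cofan.IsColimit.hom_ext (isColimitCofanEval hc p) _ _ fun j ↦ by
    rw [Cofan.IsColimit.fac (isColimitCofanEval hc p), (h j).zero p q hpq, comp_zero]
  comm n := Cofan.IsColimit.hom_ext (isColimitCofanEval hc n) _ _ fun j ↦ by
    have H := (h j).comm n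
    rw [dNext_eq _ (show (ComplexShape.up ℤ).Rel n (n + 1) from rfl),
      prevD_eq _ (show (ComplexShape.up ℤ).Rel (n - 1) n from sub_add_cancel n 1)] at H ⊢
    simp only [zero_f, add_zero, Preadditive.comp_add, comp_f] at H ⊢
    refine H.trans (congrArg₂ _ ?_ ?_)
    · exact (congrArg _ (Cofan.IsColimit.fac (isColimitCofanEval hc (n + 1))
        (fun j ↦ (h j).hom (n + 1) n) j)).symm.trans
        (comp_comp_of_comp_eq ((c.inj j).comm n (n + 1)) _).symm
    · exact (congrArg (· ≫ L.d (n - 1) n)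
        (Cofan.IsColimit.fac (isColimitCofanEval hc n)
        (fun j ↦ (h j).hom n (n - 1)) j)).symm.trans (Category.assoc _ _ _)

variable [HasDerivedCategory.{w} C]

/-- A morphism of complexes which vanishes in the derived category is nullhomotopic after
composition with a quasi-isomorphism. -/
lemma exists_quasiIso_homotopy {K L : CochainComplex C ℤ} (f : K ⟶ L)
    (hf : DerivedCategory.Q.map f = 0) :
    ∃ (K' : CochainComplex C ℤ) (s : K' ⟶ K) (_ : QuasiIso s), Nonempty (Homotopy (s ≫ f) 0) := by
  have h : DerivedCategory.Qh.map ((HomotopyCategory.quotient C (.up ℤ)).map f) =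
      DerivedCategory.Qh.map 0 := by
    rw [Functor.map_zero, ← cancel_mono ((DerivedCategory.quotientCompQhIso C).hom.app L),
      DerivedCategory.quotientCompQhIso_hom_naturality, hf, comp_zero, zero_comp]
  obtain ⟨K', s, hs, H⟩ := (MorphismProperty.map_eq_iff_precomp DerivedCategory.Qh
    (HomotopyCategory.quasiIso C (.up ℤ)) _ _).1 h
  obtain ⟨K', rfl⟩ := HomotopyCategory.quotient_obj_surjective K'
  obtain ⟨s, rfl⟩ := (HomotopyCategory.quotient C (.up ℤ)).map_surjective s
  refine ⟨K', s, (HomotopyCategory.quotient_map_mem_quasiIso_iff s).1 hs,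
    ⟨HomotopyCategory.homotopyOfEq _ _ ?_⟩⟩
  rw [Functor.map_comp, H, comp_zero, Functor.map_zero]

variable [HasCoproducts.{0} C] [AB4OfSize.{0} C]

/-- The localization functor to the derived category preserves coproducts. Morphisms from a
coproduct are constructed and compared by calculus of fractions, since a coproduct of
quasi-isomorphisms is a quasi-isomorphism. -/
lemma nonempty_isColimit_Q {J : Type} {K : J → CochainComplex C ℤ} {c : Cofan K}
    (hc : IsColimit c) : Nonempty (IsColimit (Cofan.mk (DerivedCategory.Q.obj c.pt) fun j ↦
      DerivedCategory.Q.map (c.inj j))) := by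
  have key {K' : J → CochainComplex C ℤ} (s : ∀ j, K' j ⟶ K j) (hs : ∀ j, QuasiIso (s j)) :
    ∃ (t : ∐ K' ⟶ c.pt) (_ : QuasiIso t), ∀ j, Sigma.ι K' j ≫ t = s j ≫ c.inj j := by
    refine ⟨Sigma.desc fun j ↦ s j ≫ c.inj j, ?_, fun j ↦ Sigma.ι_desc _ _⟩
    exact quasiIso_of_isColimit_cofan (coproductIsCoproduct K') hc s hs _
      (fun j ↦ Sigma.ι_desc (fun j ↦ s j ≫ c.inj j) j)
  refine nonempty_isColimit_cofan _ (fun {Y} f ↦ ?_) (fun {Y} f g h ↦ ?_)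
  · obtain ⟨L, ⟨e⟩⟩ : ∃ L, Nonempty (DerivedCategory.Q.obj L ≅ Y) :=
      ⟨_, ⟨DerivedCategory.Q.objObjPreimageIso Y⟩⟩
    choose K' s hs g hg using fun j ↦ DerivedCategory.right_fac (f j ≫ e.inv)
    obtain ⟨t, ht, h⟩ := key s fun j ↦ (DerivedCategory.isIso_Q_map_iff_quasiIso _ _).1 (hs j)
    refine ⟨inv (DerivedCategory.Q.map t) ≫ DerivedCategory.Q.map (Sigma.desc g) ≫ e.hom,
      fun j ↦ ?_⟩
    have h1 : DerivedCategory.Q.map (c.inj j) ≫ inv (DerivedCategory.Q.map t) =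
        inv (DerivedCategory.Q.map (s j)) ≫ DerivedCategory.Q.map (Sigma.ι K' j) := by
      rw [IsIso.eq_inv_comp, ← Category.assoc, IsIso.comp_inv_eq, ← Functor.map_comp,
        ← Functor.map_comp, h]
    refine (comp_comp_of_comp_eq h1 _).trans ?_
    rw [← Functor.map_comp_assoc, Sigma.ι_desc, ← Category.assoc, ← hg, Category.assoc,
      e.inv_hom_id, Category.comp_id]
  · rw [← sub_eq_zero]
    obtain ⟨L, ⟨e⟩⟩ : ∃ L, Nonempty (DerivedCategory.Q.obj L ≅ Y) :=
      ⟨_, ⟨DerivedCategory.Q.objObjPreimageIso Y⟩⟩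
    obtain ⟨L', φ, s, hs, hφ⟩ := DerivedCategory.left_fac ((f - g) ≫ e.inv)
    have h1 (j : J) : DerivedCategory.Q.map (c.inj j ≫ φ) = 0 := by
      have : DerivedCategory.Q.map (c.inj j) ≫ (f - g) = 0 := by
        rw [Preadditive.comp_sub, sub_eq_zero]
        exact h j
      rw [← cancel_mono (inv (DerivedCategory.Q.map s)), Functor.map_comp, Category.assoc, ← hφ,
        reassoc_of% this, zero_comp, zero_comp]
    choose K' u hu H using fun j ↦ exists_quasiIso_homotopy _ (h1 j)
    obtain ⟨t, ht, h⟩ := key u hu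
    have h2 : DerivedCategory.Q.map (t ≫ φ) = DerivedCategory.Q.map 0 :=
      DerivedCategory.Q_map_eq_of_homotopy C
        (homotopyOfIsColimit (coproductIsCoproduct K') (t ≫ φ) fun j ↦
          (Homotopy.ofEq (by
            exact (comp_comp_of_comp_eq (h j) φ))).trans (H j).some)
    rw [Functor.map_comp, Functor.map_zero, Preadditive.IsIso.comp_left_eq_zero] at h2
    rw [← cancel_mono e.inv, hφ, h2, zero_comp, zero_comp]

end DerivedCoproducts

/-! ### Functors which preserve distinguished triangles -/

section PreservesDistinguished

open Pretriangulated

/-- A functor between pretriangulated categories which sends distinguished triangles to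
distinguished triangles, for some choice of the third morphism of the image triangle. No choice of
an isomorphism of commutation with the shift is required. -/
def PreservesDistinguished {D E : Type*} [Category* D] [Category* E] [Preadditive D]
    [Preadditive E] [HasZeroObject D] [HasZeroObject E] [HasShift D ℤ] [HasShift E ℤ]
    [∀ n : ℤ, (shiftFunctor D n).Additive] [∀ n : ℤ, (shiftFunctor E n).Additive]
    [Pretriangulated D] [Pretriangulated E] (F : D ⥤ E) : Prop :=
  ∀ T ∈ distTriang D, ∃ h : F.obj T.obj₃ ⟶ (F.obj T.obj₁)⟦(1 : ℤ)⟧,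
    Triangle.mk (F.map T.mor₁) (F.map T.mor₂) h ∈ distTriang E

lemma PreservesDistinguished.of_isTriangulated {D E : Type*} [Category* D] [Category* E]
    [Preadditive D]
    [Preadditive E] [HasZeroObject D] [HasZeroObject E] [HasShift D ℤ] [HasShift E ℤ]
    [∀ n : ℤ, (shiftFunctor D n).Additive] [∀ n : ℤ, (shiftFunctor E n).Additive]
    [Pretriangulated D] [Pretriangulated E] (F : D ⥤ E) [F.CommShift ℤ] [F.IsTriangulated] :
    PreservesDistinguished F := fun T hT ↦ ⟨_, F.map_distinguished T hT⟩

lemma PreservesDistinguished.comp {D E E' : Type*} [Category* D] [Category* E] [Category* E']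
    [Preadditive D] [Preadditive E] [Preadditive E'] [HasZeroObject D] [HasZeroObject E]
    [HasZeroObject E'] [HasShift D ℤ] [HasShift E ℤ] [HasShift E' ℤ]
    [∀ n : ℤ, (shiftFunctor D n).Additive] [∀ n : ℤ, (shiftFunctor E n).Additive]
    [∀ n : ℤ, (shiftFunctor E' n).Additive]
    [Pretriangulated D] [Pretriangulated E] [Pretriangulated E'] {F : D ⥤ E} {G : E ⥤ E'}
    (hF : PreservesDistinguished F) (hG : PreservesDistinguished G) :
    PreservesDistinguished (F ⋙ G) := fun T hT ↦
  have ⟨_, h⟩ := hF T hT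
  hG _ h

variable {D : Type*} [Category* D] [Preadditive D] [HasZeroObject D] [HasShift D ℤ]
  [∀ n : ℤ, (shiftFunctor D n).Additive] [Pretriangulated D]
  {C : Type*} [Category* C] [Abelian C] [HasDerivedCategory.{w} C]

lemma PreservesDistinguished.exact {F : D ⥤ DerivedCategory C} (hF : PreservesDistinguished F)
    (T : Triangle D) (hT : T ∈ distTriang D) (n : ℤ) :
    ∃ h, (ShortComplex.mk ((F ⋙ DerivedCategory.homologyFunctor C n).map T.mor₁)
      ((F ⋙ DerivedCategory.homologyFunctor C n).map T.mor₂) h).Exact := by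
  obtain ⟨h, hT⟩ := hF T hT
  exact ⟨_, DerivedCategory.HomologySequence.exact₂ _ hT n⟩

/-- Two out of three for a natural transformation between functors which preserve distinguished
triangles. Since these functors are not assumed to commute with shifts, the shifts of the outer
objects have to be considered as well. -/
lemma isIso_app_obj₂ {F G : D ⥤ DerivedCategory C} (hF : PreservesDistinguished F)
    (hG : PreservesDistinguished G) (φ : F ⟶ G) (T : Triangle D) (hT : T ∈ distTriang D)
    (h₁ : IsIso (φ.app T.obj₁)) (h₃ : IsIso (φ.app T.obj₃))
    (h₁' : IsIso (φ.app (T.obj₁⟦(1 : ℤ)⟧))) (h₃' : IsIso (φ.app (T.obj₃⟦(-1 : ℤ)⟧))) :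
    IsIso (φ.app T.obj₂) := by
  rw [DerivedCategory.isIso_iff]
  intro n
  let R : ComposableArrows D 4 := .mk₄ T.invRotate.mor₁ T.mor₁ T.mor₂ T.mor₃
  have hR {F : D ⥤ DerivedCategory C} (hF : PreservesDistinguished F) :
      ComposableArrows.Exact (n := 4) (R ⋙ (F ⋙ DerivedCategory.homologyFunctor C n)) :=
    have ⟨_, h₀⟩ := hF.exact _ (inv_rot_of_distTriang T hT) n
    have ⟨_, h₁⟩ := hF.exact _ hT n
    have ⟨h, h₂⟩ := hF.exact _ (rot_of_distTriang T hT) n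
    ComposableArrows.exact_of_δ₀ h₀.exact_toComposableArrows
      (ComposableArrows.exact_of_δ₀ h₁.exact_toComposableArrows
        (ComposableArrows.exact₂_mk _ h h₂))
  let ψ : R ⋙ (F ⋙ DerivedCategory.homologyFunctor C n) ⟶
      R ⋙ (G ⋙ DerivedCategory.homologyFunctor C n) :=
    Functor.whiskerLeft R (Functor.whiskerRight φ _)
  have hψ {X : D} (h : IsIso (φ.app X)) :
      IsIso ((DerivedCategory.homologyFunctor C n).map (φ.app X)) := inferInstance
  exact Abelian.isIso_of_epi_of_isIso_of_isIso_of_mono (hR hF) (hR hG) ψ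
    (have := hψ h₃'; inferInstanceAs (Epi ((DerivedCategory.homologyFunctor C n).map
      (φ.app (T.obj₃⟦(-1 : ℤ)⟧)))))
    (hψ h₁) (hψ h₃)
    (have := hψ h₁'; inferInstanceAs (Mono ((DerivedCategory.homologyFunctor C n).map
      (φ.app (T.obj₁⟦(1 : ℤ)⟧)))))

end PreservesDistinguished

/-! ### Triangles and coproducts for the derived bifunctor -/

section

variable {A E : Type*} [Category* A] [Category* E]

/-- A natural transformation which is an isomorphism on the vertices of a cofan transports the
property of being sent to a coproduct. -/
def isColimitCofanMapOfIsIso {F G : A ⥤ E} (α : F ⟶ G) {J : Type*} {X : J → A} (c : Cofan X)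
    (h : ∀ j, IsIso (α.app (X j))) (h' : IsIso (α.app c.pt))
    (hc : IsColimit (Cofan.mk (G.obj c.pt) fun j ↦ G.map (c.inj j))) :
    IsColimit (Cofan.mk (F.obj c.pt) fun j ↦ F.map (c.inj j)) :=
  Cofan.IsColimit.mk _
    (fun s ↦ α.app c.pt ≫ Cofan.IsColimit.desc hc fun j ↦ inv (α.app (X j)) ≫ s.inj j)
    (fun s j ↦ by
      refine (comp_comp_of_comp_eq (α.naturality (c.inj j)) _).trans ?_
      refine (congrArg _ (Cofan.IsColimit.fac hc _ j)).trans ?_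
      exact IsIso.hom_inv_id_assoc _ _)
    (fun s m hm ↦ by
      rw [← IsIso.inv_comp_eq]
      refine Cofan.IsColimit.hom_ext hc _ _ fun j ↦ ?_
      rw [Cofan.IsColimit.fac hc, ← hm j, IsIso.eq_inv_comp]
      refine (comp_comp_of_comp_eq (α.naturality (c.inj j)).symm _).trans ?_
      exact congrArg _ (IsIso.hom_inv_id_assoc _ _))

lemma isIso_of_isColimit_cofan {J : Type*} {X Y : J → E} {c : Cofan X} {d : Cofan Y}
    (hc : IsColimit c) (hd : IsColimit d) (φ : ∀ j, X j ⟶ Y j) (hφ : ∀ j, IsIso (φ j))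
    (f : c.pt ⟶ d.pt) (hf : ∀ j, c.inj j ≫ f = φ j ≫ d.inj j) : IsIso f := by
  refine ⟨Cofan.IsColimit.desc hd fun j ↦ inv (φ j) ≫ c.inj j,
    Cofan.IsColimit.hom_ext hc _ _ fun j ↦ ?_, Cofan.IsColimit.hom_ext hd _ _ fun j ↦ ?_⟩
  · rw [← Category.assoc, hf, Category.assoc, Cofan.IsColimit.fac hd, IsIso.hom_inv_id_assoc,
      Category.comp_id]
  · rw [← Category.assoc, Cofan.IsColimit.fac hd, Category.assoc, hf, IsIso.inv_hom_id_assoc,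
      Category.comp_id]

lemma isIso_app_of_isColimit_cofan {F G : A ⥤ E} (α : F ⟶ G) {J : Type*} {X : J → A} (c : Cofan X)
    (h : ∀ j, IsIso (α.app (X j)))
    (hF : IsColimit (Cofan.mk (F.obj c.pt) fun j ↦ F.map (c.inj j)))
    (hG : IsColimit (Cofan.mk (G.obj c.pt) fun j ↦ G.map (c.inj j))) : IsIso (α.app c.pt) :=
  isIso_of_isColimit_cofan hF hG _ h _ fun j ↦ α.naturality (c.inj j)

end

section Triangles

open Pretriangulated

variable {D : Type*} [Category* D] [Preadditive D] [HasZeroObject D] [HasShift D ℤ]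
  [∀ n : ℤ, (shiftFunctor D n).Additive] [Pretriangulated D]

lemma exists_distinguished_of_iso {X Y Z X' Y' Z' : D} {f : X ⟶ Y} {g : Y ⟶ Z} {f' : X' ⟶ Y'}
    {g' : Y' ⟶ Z'} (e₁ : X ≅ X') (e₂ : Y ≅ Y') (e₃ : Z ≅ Z') (h₁ : f ≫ e₂.hom = e₁.hom ≫ f')
    (h₂ : g ≫ e₃.hom = e₂.hom ≫ g') (h : ∃ h, Triangle.mk f' g' h ∈ distTriang D) :
    ∃ h, Triangle.mk f g h ∈ distTriang D := by
  obtain ⟨h', hT⟩ := h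
  refine ⟨e₃.hom ≫ h' ≫ e₁.inv⟦1⟧', isomorphic_distinguished _ hT _
    (Triangle.isoMk _ _ e₁ e₂ e₃ h₁ h₂ ?_)⟩
  change (e₃.hom ≫ h' ≫ e₁.inv⟦1⟧') ≫ e₁.hom⟦1⟧' = e₃.hom ≫ h'
  rw [Category.assoc, Category.assoc, ← Functor.map_comp, e₁.inv_hom_id,
    CategoryTheory.Functor.map_id, Category.comp_id]

lemma PreservesDistinguished.of_iso {E : Type*} [Category* E]
    [Preadditive E] [HasZeroObject E] [HasShift E ℤ] [∀ n : ℤ, (shiftFunctor E n).Additive]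
    [Pretriangulated E] {F G : D ⥤ E} (e : F ≅ G) (h : PreservesDistinguished F) :
    PreservesDistinguished G := fun T hT ↦
  exists_distinguished_of_iso (e.symm.app _) (e.symm.app _) (e.symm.app _)
    (e.symm.hom.naturality _) (e.symm.hom.naturality _) (h T hT)

end Triangles

namespace FlatResolution

open Pretriangulated HomologicalComplex

variable {C : Type*} [Category* C] [Abelian C]
  {T : C ⥤ C ⥤ C} (Λ : FlatResolution T)

/-- A functor on complexes which preserves coproducts of flat complexes. -/
def PreservesFlatCoproducts {E : Type*} [Category* E] (F : CochainComplex C ℤ ⥤ E) : Prop :=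
  ∀ ⦃J : Type⦄ (K : J → CochainComplex C ℤ) (c : Cofan K), IsColimit c →
    (∀ j, Λ.flatComplex (K j)) → Λ.flatComplex c.pt →
    Nonempty (IsColimit (Cofan.mk (F.obj c.pt) fun j ↦ F.map (c.inj j)))

variable {Λ} in
lemma PreservesFlatCoproducts.of_isIso {E : Type*} [Category* E] {F G : CochainComplex C ℤ ⥤ E}
    (α : F ⟶ G) (hα : ∀ K, Λ.flatComplex K → IsIso (α.app K)) (hG : Λ.PreservesFlatCoproducts G) :
    Λ.PreservesFlatCoproducts F := fun _ K c hc hK h ↦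
  ⟨isColimitCofanMapOfIsIso α c (fun j ↦ hα _ (hK j)) (hα _ h) (hG K c hc hK h).some⟩

variable {Λ} in
lemma PreservesFlatCoproducts.comp {E E' : Type*} [Category* E] [Category* E']
    {F : CochainComplex C ℤ ⥤ E} (hF : Λ.PreservesFlatCoproducts F) (G : E ⥤ E')
    [PreservesColimitsOfSize.{0, 0} G] : Λ.PreservesFlatCoproducts (F ⋙ G) := fun _ K c hc hK h ↦
  ⟨isColimitCofanMkObjOfIsColimit G _ _ (hF K c hc hK h).some⟩

section

variable [HasDerivedCategory.{w} C]

instance isIso_Q_map_ρ (K : CochainComplex C ℤ) : IsIso (DerivedCategory.Q.map (Λ.ρ.app K)) :=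
  (DerivedCategory.isIso_Q_map_iff_quasiIso _ (Λ.ρ.app K)).2 inferInstance

/-- A complex is isomorphic to its flat resolution in the derived category. -/
def isoQρ : Λ.R ⋙ DerivedCategory.Q ≅ DerivedCategory.Q (C := C) :=
  NatIso.ofComponents (fun K ↦ (asIso (DerivedCategory.Q.map (Λ.ρ.app K)) :))
    (fun f ↦ (DerivedCategory.Q.map_comp _ _).symm.trans
      ((congrArg _ (Λ.ρ.naturality f)).trans (DerivedCategory.Q.map_comp _ _)))

/-- Every distinguished triangle is obtained from a degreewise short exact sequence of flat
complexes. -/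
lemma exists_shortExact (T : Triangle (DerivedCategory C)) (hT : T ∈ distTriang _) :
    ∃ (S : ShortComplex (CochainComplex C ℤ)) (_ : ∀ n, (S.map (eval C _ n)).ShortExact)
      (_ : Λ.flatComplex S.X₁) (_ : Λ.flatComplex S.X₂) (_ : Λ.flatComplex S.X₃)
      (e₁ : T.obj₁ ≅ DerivedCategory.Q.obj S.X₁) (e₂ : T.obj₂ ≅ DerivedCategory.Q.obj S.X₂)
      (e₃ : T.obj₃ ≅ DerivedCategory.Q.obj S.X₃),
      T.mor₁ ≫ e₂.hom = e₁.hom ≫ DerivedCategory.Q.map S.f ∧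
      T.mor₂ ≫ e₃.hom = e₂.hom ≫ DerivedCategory.Q.map S.g := by
  obtain ⟨A, B, f, ⟨i⟩⟩ := (DerivedCategory.mem_distTriang_iff _).1 (inv_rot_of_distTriang T hT)
  let j : DerivedCategory.Q.mapTriangle.obj (CochainComplex.mappingCone.triangle f) ≅
      DerivedCategory.Q.mapTriangle.obj (CochainComplex.mappingCone.triangle (Λ.R.map f)) :=
    (isoTriangleOfIso₁₂ _ _ (DerivedCategory.mappingCone_triangle_distinguished (Λ.R.map f))
      (DerivedCategory.mappingCone_triangle_distinguished f) (Λ.isoQρ.app A) (Λ.isoQρ.app B)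
      (Λ.isoQρ.hom.naturality f)).symm
  let k : T ≅ (DerivedCategory.Q.mapTriangle.obj
      (CochainComplex.mappingCone.triangle (Λ.R.map f))).rotate :=
    (invRotCompRot.app T).symm ≪≫ (rotate _).mapIso (i ≪≫ j)
  refine ⟨CochainComplex.mappingCone.triangleRotateShortComplex (Λ.R.map f),
    fun n ↦ (CochainComplex.mappingCone.triangleRotateShortComplexSplitting
      (Λ.R.map f) n).shortExact, Λ.flatComplex_R _,
    Λ.flatComplex_mappingCone _ (Λ.flatComplex_R _) (Λ.flatComplex_R _),
    fun n ↦ Λ.flatComplex_R A _, Triangle.π₁.mapIso k, Triangle.π₂.mapIso k,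
    Triangle.π₃.mapIso k ≪≫ ((DerivedCategory.Q.commShiftIso (1 : ℤ)).app (Λ.R.obj A)).symm,
    k.hom.comm₁, ?_⟩
  refine (Category.assoc _ _ _).symm.trans ((congrArg (· ≫ _) k.hom.comm₂).trans ?_)
  refine (Category.assoc _ _ _).trans (congrArg _ ?_)
  refine (Category.assoc _ _ _).trans ((congrArg _
    ((DerivedCategory.Q.commShiftIso (1 : ℤ)).hom_inv_id_app (Λ.R.obj A))).trans ?_)
  exact Category.comp_id _

variable [HasCountableCoproducts C] [HasCoproducts.{0} C] [T.Additive] [∀ A, (T.obj A).Additive]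
  [AB4OfSize.{0} C] [IsBicocontinuous T] [HasDerivedBifunctor T]

variable (T) in
/-- The functor `X ⊗ᴸ -` on the derived category. -/
abbrev derivedLeft (X : DerivedCategory C) : DerivedCategory C ⥤ DerivedCategory C :=
  Prod.sectR X _ ⋙ derivedBifunctor T

variable (T) in
/-- The canonical natural transformation `K ⊗ᴸ - ⟶ K ⊗ -`. -/
abbrev derivedLeftCounit (K : CochainComplex C ℤ) :
    DerivedCategory.Q ⋙ derivedLeft T (DerivedCategory.Q.obj K) ⟶
      T.map₂CochainComplex.obj K ⋙ DerivedCategory.Q where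
  app L := (derivedCounit T).app (K, L)
  naturality L M f := by
    have h₁ : (derivedLeft T (DerivedCategory.Q.obj K)).map (DerivedCategory.Q.map f) =
        (DerivedCategory.Q.prod DerivedCategory.Q ⋙ derivedBifunctor T).map
          (Prod.mkHom (𝟙 K) f) :=
      congrArg (derivedBifunctor T).map (Prod.ext (DerivedCategory.Q.map_id K).symm rfl)
    have h₂ : (complexBifunctor T ⋙ DerivedCategory.Q).map (Prod.mkHom (𝟙 K) f) =
        (T.map₂CochainComplex.obj K ⋙ DerivedCategory.Q).map f :=
      congrArg DerivedCategory.Q.map ((congrArg (· ≫ _) (NatTrans.congr_app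
        (T.map₂CochainComplex.map_id K) L)).trans (Category.id_comp _))
    exact (congrArg (· ≫ _) h₁).trans (((derivedCounit T).naturality _).trans (congrArg _ h₂))

/-- The functors `X ⊗ᴸ -` and `Y ⊗ᴸ -` are isomorphic if `X` and `Y` are. -/
def derivedLeftIso {X Y : DerivedCategory C} (e : X ≅ Y) : derivedLeft T X ≅ derivedLeft T Y :=
  NatIso.ofComponents (fun Z ↦ (derivedBifunctor T).mapIso (Iso.prod e (Iso.refl Z)))
    (fun _ ↦ (Functor.map_comp _ _ _).symm.trans ((congrArg (derivedBifunctor T).map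
      (Prod.ext ((Category.id_comp _).trans (Category.comp_id _).symm)
        ((Category.comp_id _).trans (Category.id_comp _).symm))).trans (Functor.map_comp _ _ _)))

include Λ in
lemma preservesDistinguished_derivedLeft (X : DerivedCategory C) :
    PreservesDistinguished (derivedLeft T X) := by
  suffices h : ∀ K, Λ.flatComplex K →
      PreservesDistinguished (derivedLeft T (DerivedCategory.Q.obj K)) from
    (h _ (Λ.flatComplex_R (DerivedCategory.Q.objPreimage X))).of_iso (derivedLeftIso
      (Λ.isoQρ.app _ ≪≫ DerivedCategory.Q.objObjPreimageIso X))
  intro K hK T' hT'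
  obtain ⟨S, hS, h₁, h₂, h₃, e₁, e₂, e₃, hf, hg⟩ := Λ.exists_shortExact T' hT'
  have c {L : CochainComplex C ℤ} (hL : Λ.flatComplex L) :
      IsIso ((derivedLeftCounit T K).app L) := Λ.isIso_derivedCounit_of_flat K L hK hL
  have := c h₁
  have := c h₂
  have := c h₃
  have hS' := shortExact_map₂_obj T K S fun p q ↦
    have := Λ.exact_obj _ (hK p)
    (hS q).map_of_exact _
  refine exists_distinguished_of_iso ((derivedLeft T _).mapIso e₁)
    ((derivedLeft T _).mapIso e₂) ((derivedLeft T _).mapIso e₃)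
    ((Functor.map_comp _ _ _).symm.trans ((congrArg _ hf).trans (Functor.map_comp _ _ _)))
    ((Functor.map_comp _ _ _).symm.trans ((congrArg _ hg).trans (Functor.map_comp _ _ _))) ?_
  exact exists_distinguished_of_iso (asIso ((derivedLeftCounit T K).app S.X₁))
    (asIso ((derivedLeftCounit T K).app S.X₂)) (asIso ((derivedLeftCounit T K).app S.X₃))
    ((derivedLeftCounit T K).naturality S.f) ((derivedLeftCounit T K).naturality S.g)
    ⟨_, DerivedCategory.triangleOfSES_distinguished hS'⟩

lemma preservesFlatCoproducts_derivedLeft (X : DerivedCategory C) :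
    Λ.PreservesFlatCoproducts (DerivedCategory.Q ⋙ derivedLeft T X) := by
  suffices h : ∀ K, Λ.flatComplex K →
      Λ.PreservesFlatCoproducts (DerivedCategory.Q ⋙ derivedLeft T (DerivedCategory.Q.obj K)) from
    (h _ (Λ.flatComplex_R (DerivedCategory.Q.objPreimage X))).of_isIso (Functor.isoWhiskerLeft _
      (derivedLeftIso (Λ.isoQρ.app _ ≪≫ DerivedCategory.Q.objObjPreimageIso X))).inv
      (fun _ _ ↦ inferInstance)
  intro K hK
  have h : Λ.PreservesFlatCoproducts (T.map₂CochainComplex.obj K ⋙ DerivedCategory.Q) :=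
    fun J L c hc _ _ ↦ nonempty_isColimit_Q (isColimitMap₂ T (fun _ ↦ inferInstance) K hc)
  exact h.of_isIso (derivedLeftCounit T K) fun L hL ↦ Λ.isIso_derivedCounit_of_flat K L hK hL

end

end FlatResolution

/-! ### Dévissage to the shifts of a generator -/

namespace FlatResolution

open Pretriangulated HomologicalComplex

variable {C : Type*} [Category* C] [Abelian C] {T : C ⥤ C ⥤ C} (Λ : FlatResolution T)

include Λ in
lemma flat_of_isZero {A B : C} (hA : IsZero A) (hB : Λ.flat B) : Λ.flat A :=
  have : Mono (0 : A ⟶ B) := ⟨fun _ _ _ ↦ hA.eq_of_tgt _ _⟩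
  Λ.flat_of_mono (0 : A ⟶ B) hB

lemma flatComplex_single {A : C} (hA : Λ.flat A) (n : ℤ) :
    Λ.flatComplex ((single C (.up ℤ) n).obj A) := fun m ↦ by
  by_cases h : m = n
  · subst h
    exact Λ.flat_of_iso (singleObjXSelf (.up ℤ) m A).symm hA
  · exact Λ.flat_of_isZero (isZero_single_obj_X (.up ℤ) n A m h) hA

lemma flat_cycles {L : CochainComplex C ℤ} (hL : Λ.flatComplex L) :
    Λ.flatComplex (cyclesSequence L).X₁ := fun n ↦
  Λ.flat_of_mono (A := kernel (L.d n (n + 1))) (kernel.ι _) (hL n)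

lemma flat_coimage {L : CochainComplex C ℤ} (hL : Λ.flatComplex L) :
    Λ.flatComplex (cyclesSequence L).X₃ := fun n ↦
  Λ.flat_of_mono (A := Abelian.coimage (L.d n (n + 1))) (Abelian.factorThruCoimage _) (hL (n + 1))

variable {C' : Type*} [Category* C'] [Abelian C'] [HasDerivedCategory.{w₁} C]
  [HasDerivedCategory.{w₂} C']

/-- A natural transformation between functors on the derived category which preserve distinguished
triangles and coproducts of flat complexes is an isomorphism as soon as it is one on the shifts of
an object `U` such that each flat object is a retract of a coproduct of copies of `U`. -/
theorem isIso_app_of_isIso_single {F G : DerivedCategory C ⥤ DerivedCategory C'}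
    (hF : PreservesDistinguished F) (hG : PreservesDistinguished G)
    (hF' : Λ.PreservesFlatCoproducts (DerivedCategory.Q ⋙ F))
    (hG' : Λ.PreservesFlatCoproducts (DerivedCategory.Q ⋙ G)) (φ : F ⟶ G) {U : C} (hU : Λ.flat U)
    (h : ∀ A, Λ.flat A → ∃ (J : Type) (c : Cofan fun _ : J ↦ U) (_ : IsColimit c),
      Λ.flat c.pt ∧ Nonempty (Retract A c.pt))
    (hφ : ∀ n, IsIso (φ.app ((DerivedCategory.singleFunctor C n).obj U)))
    (X : DerivedCategory C) : IsIso (φ.app X) := by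
  have hc {J : Type} (K : J → CochainComplex C ℤ) (c : Cofan K) (hc : IsColimit c)
      (hK : ∀ j, Λ.flatComplex (K j)) (h' : Λ.flatComplex c.pt)
      (H : ∀ j, IsIso (φ.app (DerivedCategory.Q.obj (K j)))) :
      IsIso (φ.app (DerivedCategory.Q.obj c.pt)) :=
    isIso_app_of_isColimit_cofan (Functor.whiskerLeft DerivedCategory.Q φ) c H
      (hF' K c hc hK h').some (hG' K c hc hK h').some
  -- retracts of coproducts of copies of `U`, in a single degree
  have h₁ {A : C} (hA : Λ.flat A) (n : ℤ) :
      IsIso (φ.app (DerivedCategory.Q.obj ((single C (.up ℤ) n).obj A))) := by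
    obtain ⟨J, c, hcol, hfl, ⟨r⟩⟩ := h A hA
    have := hc _ (Cofan.mk _ fun j ↦ (single C (.up ℤ) n).map (c.inj j))
      (isColimitCofanMkObjOfIsColimit (single C (.up ℤ) n) _ _ hcol)
      (fun _ ↦ Λ.flatComplex_single hU n) (Λ.flatComplex_single hfl n) (fun _ ↦ hφ n)
    exact MorphismProperty.of_retract (P := .isomorphisms _)
      (NatTrans.retractArrowApp φ (r.map (single C (.up ℤ) n ⋙ DerivedCategory.Q))) this
  -- complexes with zero differential, and then their shifts
  have h₂ (L : CochainComplex C ℤ) (hL : ∀ i j, L.d i j = 0) (hfl : Λ.flatComplex L) :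
      IsIso (φ.app (DerivedCategory.Q.obj L)) :=
    hc _ _ (isColimitSingleOfZero L hL) (fun n ↦ Λ.flatComplex_single (hfl n) n) hfl
      (fun n ↦ h₁ (hfl n) n)
  have h₃ (L : CochainComplex C ℤ) (hL : ∀ i j, L.d i j = 0) (hfl : Λ.flatComplex L) (k : ℤ) :
      IsIso (φ.app ((DerivedCategory.Q.obj L)⟦k⟧)) :=
    (NatTrans.isIso_app_iff_of_iso φ ((DerivedCategory.Q.commShiftIso k).app L)).1
      (h₂ (L⟦k⟧) (fun i j ↦
        show k.negOnePow • L.d (i + k) (j + k) = 0 by rw [hL, smul_zero]) (fun n ↦ hfl (n + k)))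
  -- flat complexes, by the triangle of `0 → Z → L → L/Z → 0`
  have h₄ (L : CochainComplex C ℤ) (hfl : Λ.flatComplex L) :
      IsIso (φ.app (DerivedCategory.Q.obj L)) :=
    isIso_app_obj₂ hF hG φ _
      (DerivedCategory.triangleOfSES_distinguished (cyclesSequence_shortExact L))
      (h₂ _ (fun _ _ ↦ rfl) (Λ.flat_cycles hfl)) (h₂ _ (fun _ _ ↦ rfl) (Λ.flat_coimage hfl))
      (h₃ _ (fun _ _ ↦ rfl) (Λ.flat_cycles hfl) 1)
      (h₃ _ (fun _ _ ↦ rfl) (Λ.flat_coimage hfl) (-1))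
  exact (NatTrans.isIso_app_iff_of_iso φ
    (Λ.isoQρ.app _ ≪≫ DerivedCategory.Q.objObjPreimageIso X)).1 (h₄ _ (Λ.flatComplex_R _))

end FlatResolution

/-! ### Tensor products with invertible objects -/

/-- If a right adjoint `G` intertwines the equivalences `S` and `S'`, so does the left adjoint
`F`, by means of the mate. -/
lemma isIso_homEquiv_symm {D E : Type*} [Category* D] [Category* E] {F : D ⥤ E} {G : E ⥤ D}
    (adj : F ⊣ G) (S : D ⥤ D) (S' : E ⥤ E) [S.IsEquivalence] [S'.IsEquivalence]
    (m : G ⋙ S ≅ S' ⋙ G) (X : D) :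
    IsIso ((adj.homEquiv _ _).symm (S.map (adj.unit.app X) ≫ m.hom.app (F.obj X))) := by
  set f := (adj.homEquiv _ _).symm (S.map (adj.unit.app X) ≫ m.hom.app (F.obj X))
  have hf {H : E} (u : F.obj X ⟶ H) : adj.homEquiv _ _ (f ≫ S'.map u) =
      S.map (adj.homEquiv _ _ u) ≫ m.hom.app H := by
    have := m.hom.naturality u
    dsimp at this
    rw [adj.homEquiv_naturality_right, Equiv.apply_symm_apply, Category.assoc, ← this,
      adj.homEquiv_unit, Functor.map_comp, Category.assoc]
  -- by `hf`, the map `f ≫ -` is a composite of bijections on the essential image of `S'`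
  rw [isIso_iff_coyoneda_map_bijective]
  intro T
  let e := S'.objObjPreimageIso T
  refine ⟨fun x y hxy ↦ ?_, fun v ↦ ?_⟩
  · obtain ⟨x', hx⟩ := S'.map_surjective (x ≫ e.inv)
    obtain ⟨y', hy⟩ := S'.map_surjective (y ≫ e.inv)
    have h : adj.homEquiv _ _ (f ≫ S'.map x') = adj.homEquiv _ _ (f ≫ S'.map y') := by
      rw [hx, hy, ← Category.assoc, ← Category.assoc]
      exact congrArg (fun g ↦ adj.homEquiv _ _ (g ≫ e.inv)) hxy
    rw [hf, hf, cancel_mono] at h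
    have h' : x' = y' := (adj.homEquiv _ _).injective (S.map_injective h)
    rw [← cancel_mono e.inv, ← hx, ← hy, h']
  · obtain ⟨w, hw⟩ := S.map_surjective (adj.homEquiv _ _ (v ≫ e.inv) ≫ m.inv.app _)
    refine ⟨S'.map ((adj.homEquiv _ _).symm w) ≫ e.hom, ?_⟩
    have h : f ≫ S'.map ((adj.homEquiv _ _).symm w) = v ≫ e.inv := by
      apply (adj.homEquiv _ _).injective
      rw [hf, Equiv.apply_symm_apply, hw, Category.assoc, m.inv_hom_id_app]
      exact Category.comp_id _
    dsimp
    rw [← Category.assoc, h, Category.assoc, e.inv_hom_id, Category.comp_id]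

namespace FlatResolution

open HomologicalComplex

variable {C : Type*} [Category* C] [Abelian C] {T : C ⥤ C ⥤ C} (Λ : FlatResolution T)
  [HasDerivedCategory.{w} C] [HasCountableCoproducts C] [HasCoproducts.{0} C] [T.Additive]
  [∀ A, (T.obj A).Additive] [AB4OfSize.{0} C] [IsBicocontinuous T] [HasDerivedBifunctor T]

variable (T) in
/-- The functor `- ⊗ᴸ Y` on the derived category. -/
abbrev derivedRight (Y : DerivedCategory C) : DerivedCategory C ⥤ DerivedCategory C :=
  Prod.sectL _ Y ⋙ derivedBifunctor T

variable (T) in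
/-- The canonical natural transformation `- ⊗ᴸ L ⟶ - ⊗ L`. -/
abbrev derivedRightCounit (L : CochainComplex C ℤ) :
    DerivedCategory.Q ⋙ derivedRight T (DerivedCategory.Q.obj L) ⟶
      T.map₂CochainComplex.flip.obj L ⋙ DerivedCategory.Q where
  app K := (derivedCounit T).app (K, L)
  naturality K M f := by
    have h₁ : (derivedRight T (DerivedCategory.Q.obj L)).map (DerivedCategory.Q.map f) =
        (DerivedCategory.Q.prod DerivedCategory.Q ⋙ derivedBifunctor T).map
          (Prod.mkHom f (𝟙 L)) :=
      congrArg (derivedBifunctor T).map (Prod.ext rfl (DerivedCategory.Q.map_id L).symm)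
    have h₂ : (complexBifunctor T ⋙ DerivedCategory.Q).map (Prod.mkHom f (𝟙 L)) =
        (T.map₂CochainComplex.flip.obj L ⋙ DerivedCategory.Q).map f :=
      congrArg DerivedCategory.Q.map ((congrArg (_ ≫ ·)
        ((T.map₂CochainComplex.obj M).map_id L)).trans (Category.comp_id _))
    exact (congrArg (· ≫ _) h₁).trans (((derivedCounit T).naturality _).trans (congrArg _ h₂))

include Λ in
lemma isIso_derivedRightCounit_single {A : C} (hA : Λ.flat A) (n : ℤ) :
    IsIso (derivedRightCounit T ((single C (.up ℤ) n).obj A)) := by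
  have (K : CochainComplex C ℤ) :
      IsIso ((derivedRightCounit T ((single C (.up ℤ) n).obj A)).app K) :=
    have := Λ.exact_flip A hA
    Λ.isIso_derivedCounit_of_flat_right _ _ (Λ.flatComplex_single hA n)
      (quasiIso_map₂_app_single T (Λ.ρ.app K) A n)
  exact NatIso.isIso_of_isIso_app _

include Λ in
/-- The tensor product with a shift of a unit object is a shift functor. -/
lemma isEquivalence_derivedRight_single {A : C} (hA : Λ.flat A) (e : T.flip.obj A ≅ 𝟭 C) (n : ℤ) :
    (derivedRight T (DerivedCategory.Q.obj ((single C (.up ℤ) n).obj A))).IsEquivalence := by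
  have := Λ.isIso_derivedRightCounit_single hA n
  let i : T.map₂CochainComplex.flip.obj ((single C (.up ℤ) n).obj A) ≅
      shiftFunctor (CochainComplex C ℤ) (-n) :=
    (tensorSingleIso T A n).symm ≪≫ Functor.isoWhiskerRight
      (NatIso.mapHomologicalComplex e _ ≪≫ Functor.mapHomologicalComplexIdIso C _) _ ≪≫
      Functor.leftUnitor _
  let j : DerivedCategory.Q ⋙
      derivedRight T (DerivedCategory.Q.obj ((single C (.up ℤ) n).obj A)) ≅
      DerivedCategory.Q ⋙ shiftFunctor (DerivedCategory C) (-n) :=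
    asIso (derivedRightCounit T ((single C (.up ℤ) n).obj A)) ≪≫
      Functor.isoWhiskerRight i _ ≪≫ DerivedCategory.Q.commShiftIso (-n)
  exact Functor.isEquivalence_of_iso ((Localization.fullyFaithfulWhiskeringLeft DerivedCategory.Q
    (HomologicalComplex.quasiIso C (.up ℤ)) _).preimageIso j).symm

end FlatResolution

/-! ### Exact functors compatible with bifunctors -/

section Compatibility

open HomologicalComplex

lemma add_units_smul_comp {D : Type*} [Category* D] [Preadditive D] {X Y Y' Z W : D} (a : X ⟶ Y)
    (i : Y ⟶ Z) (s : ℤˣ) (b : X ⟶ Y') (j : Y' ⟶ Z) (f : Z ⟶ W) :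
    (a ≫ i + s • (b ≫ j)) ≫ f = a ≫ i ≫ f + s • (b ≫ j ≫ f) := by
  rw [Preadditive.add_comp, Linear.units_smul_comp, Category.assoc, Category.assoc]

lemma comp_map_add_units_smul {D D' : Type*} [Category* D] [Preadditive D] [Category* D']
    [Preadditive D'] (F : D ⥤ D') [F.Additive] {V : D'} {X Y Y' Z : D} (m : V ⟶ F.obj X)
    (a : X ⟶ Y) (i : Y ⟶ Z) (s : ℤˣ) (b : X ⟶ Y') (j : Y' ⟶ Z) :
    m ≫ F.map (a ≫ i + s • (b ≫ j)) = m ≫ F.map a ≫ F.map i + s • (m ≫ F.map b ≫ F.map j) := by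
  rw [Functor.map_add, Functor.map_units_smul, Preadditive.comp_add, Linear.comp_units_smul,
    Functor.map_comp, Functor.map_comp]

variable {C C' : Type*} [Category* C] [Abelian C] [Category* C'] [Abelian C'] [HasCoproducts.{0} C]
  [HasCoproducts.{0} C']
  {T : C ⥤ C ⥤ C} [T.Additive] [∀ A, (T.obj A).Additive]
  {T' : C' ⥤ C' ⥤ C'} [T'.Additive] [∀ A, (T'.obj A).Additive]
  (π : C ⥤ C') [π.Additive]
  (μ : π ⋙ T' ⋙ (Functor.whiskeringLeft _ _ _).obj π ≅ T ⋙ (Functor.whiskeringRight _ _ _).obj π)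

/-- The morphism `T'(π K, π L)^n ⟶ π T(K, L)^n` induced by the isomorphisms
`T'(π A, π B) ≅ π T(A, B)`. -/
def complexCompatibilityX (K L : CochainComplex C ℤ) (n : ℤ) :
    ((T'.map₂CochainComplex.obj ((π.mapHomologicalComplex _).obj K)).obj
      ((π.mapHomologicalComplex _).obj L)).X n ⟶
      π.obj (((T.map₂CochainComplex.obj K).obj L).X n) :=
  mapBifunctorDesc fun p q h ↦
    (μ.hom.app (K.X p)).app (L.X q) ≫ π.map (ιMapBifunctor K L T (.up ℤ) p q n h)

lemma ι_complexCompatibilityX (K L : CochainComplex C ℤ) (p q n : ℤ) (h : p + q = n) :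
    ιMapBifunctor ((π.mapHomologicalComplex _).obj K) ((π.mapHomologicalComplex _).obj L) T'
      (.up ℤ) p q n h ≫ complexCompatibilityX π μ K L n =
    (μ.hom.app (K.X p)).app (L.X q) ≫ π.map (ιMapBifunctor K L T (.up ℤ) p q n h) :=
  ι_mapBifunctorDesc _ _ _ _

instance isIso_complexCompatibilityX [PreservesColimitsOfSize.{0, 0} π]
    (K L : CochainComplex C ℤ) (n : ℤ) : IsIso (complexCompatibilityX π μ K L n) := by
  exact isIso_of_isColimit_cofan (isColimitTotal T' ((π.mapHomologicalComplex _).obj K)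
    ((π.mapHomologicalComplex _).obj L) n)
    (isColimitCofanMkObjOfIsColimit π _ _ (isColimitTotal T K L n))
    (fun x ↦ (μ.hom.app (K.X x.1.1)).app (L.X x.1.2))
    (fun x ↦ ((μ.app (K.X x.1.1)).app (L.X x.1.2)).isIso_hom) _
    (fun x ↦ ι_complexCompatibilityX π μ K L x.1.1 x.1.2 n x.2)

/-- The morphism of total complexes induced by the isomorphisms `T'(π A, π B) ≅ π T(A, B)`. -/
def complexCompatibility (K L : CochainComplex C ℤ) :
    (T'.map₂CochainComplex.obj ((π.mapHomologicalComplex _).obj K)).obj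
      ((π.mapHomologicalComplex _).obj L) ⟶
      (π.mapHomologicalComplex _).obj ((T.map₂CochainComplex.obj K).obj L) where
  f n := complexCompatibilityX π μ K L n
  comm' n n' hn := by
    refine mapBifunctor.hom_ext fun p q h ↦ ?_
    obtain rfl : n + 1 = n' := hn
    refine (comp_comp_of_comp_eq (ι_complexCompatibilityX π μ K L p q n h) _).trans ?_
    refine Eq.trans ?_ (((Category.assoc _ _ _).symm.trans (congrArg
      (· ≫ complexCompatibilityX π μ K L (n + 1)) (ι_mapBifunctor_d T' _ _ p q n (p + 1) (q + 1)
      (n + 1) h rfl rfl rfl))).symm)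
    refine (congrArg _ ((π.map_comp _ _).symm.trans (congrArg π.map
      (ι_mapBifunctor_d T K L p q n (p + 1) (q + 1) (n + 1) h rfl rfl rfl)))).trans ?_
    refine (comp_map_add_units_smul π _ _ _ _ _ _).trans
      (Eq.trans (congrArg₂ _ ?_ (congrArg _ ?_)) (add_units_smul_comp _ _ _ _ _ _).symm)
    · exact (comp_comp_of_comp_eq (NatTrans.congr_app (μ.hom.naturality (K.d p (p + 1))) _).symm
        _).trans (congrArg _ (ι_complexCompatibilityX π μ K L _ _ _ _).symm)
    · exact (comp_comp_of_comp_eq ((μ.hom.app (K.X p)).naturality (L.d q (q + 1))).symm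
        _).trans (congrArg _ (ι_complexCompatibilityX π μ K L _ _ _ _).symm)

lemma complexCompatibility_naturality_left {K K' : CochainComplex C ℤ} (f : K ⟶ K')
    (L : CochainComplex C ℤ) :
    (T'.map₂CochainComplex.map ((π.mapHomologicalComplex _).map f)).app
      ((π.mapHomologicalComplex _).obj L) ≫ complexCompatibility π μ K' L =
    complexCompatibility π μ K L ≫
      (π.mapHomologicalComplex _).map ((T.map₂CochainComplex.map f).app L) := by
  ext n : 1
  refine mapBifunctor.hom_ext fun p q h ↦ ?_
  refine (comp_comp_of_comp_eq (ι_map₂_map_app T' ((π.mapHomologicalComplex _).map f)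
    ((π.mapHomologicalComplex _).obj L) p q n h) _).trans ?_
  refine (congrArg _ (ι_complexCompatibilityX π μ K' L p q n h)).trans ?_
  refine Eq.trans ?_ (comp_comp_of_comp_eq (ι_complexCompatibilityX π μ K L p q n h) _).symm
  refine (comp_comp_of_comp_eq (NatTrans.congr_app (μ.hom.naturality (f.f p)) _) _).trans
    (congrArg _ ?_)
  exact (π.map_comp _ _).symm.trans ((congrArg π.map (ι_map₂_map_app T f L p q n h).symm).trans
    (π.map_comp _ _))

lemma complexCompatibility_naturality_right (K : CochainComplex C ℤ)
    {L L' : CochainComplex C ℤ} (g : L ⟶ L') :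
    (T'.map₂CochainComplex.obj ((π.mapHomologicalComplex _).obj K)).map
      ((π.mapHomologicalComplex _).map g) ≫ complexCompatibility π μ K L' =
    complexCompatibility π μ K L ≫
      (π.mapHomologicalComplex _).map ((T.map₂CochainComplex.obj K).map g) := by
  ext n : 1
  refine mapBifunctor.hom_ext fun p q h ↦ ?_
  refine (comp_comp_of_comp_eq (ι_map₂_map T' ((π.mapHomologicalComplex _).obj K)
    ((π.mapHomologicalComplex _).map g) p q n h) _).trans ?_
  refine (congrArg _ (ι_complexCompatibilityX π μ K L' p q n h)).trans ?_
  refine Eq.trans ?_ (comp_comp_of_comp_eq (ι_complexCompatibilityX π μ K L p q n h) _).symm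
  refine (comp_comp_of_comp_eq ((μ.hom.app (K.X p)).naturality (g.f q)) _).trans (congrArg _ ?_)
  exact (π.map_comp _ _).symm.trans ((congrArg π.map (ι_map₂_map T K g p q n h).symm).trans
    (π.map_comp _ _))

instance isIso_complexCompatibility [PreservesColimitsOfSize.{0, 0} π]
    (K L : CochainComplex C ℤ) : IsIso (complexCompatibility π μ K L) :=
  have (n : ℤ) : IsIso ((complexCompatibility π μ K L).f n) :=
    isIso_complexCompatibilityX π μ K L n
  Hom.isIso_of_components _

/-- The isomorphisms of total complexes induced by the isomorphisms `T'(π A, π B) ≅ π T(A, B)`. -/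
def complexCompatibilityIso [PreservesColimitsOfSize.{0, 0} π] :
    ((π.mapHomologicalComplex (.up ℤ)).prod (π.mapHomologicalComplex (.up ℤ))) ⋙
      complexBifunctor T' ≅ complexBifunctor T ⋙ π.mapHomologicalComplex (.up ℤ) :=
  NatIso.ofComponents (fun X ↦ (asIso (complexCompatibility π μ X.1 X.2) :))
    (fun {X Y} f ↦ by
      refine (Category.assoc _ _ _).trans ((congrArg _
        (complexCompatibility_naturality_right π μ Y.1 f.2)).trans ?_)
      refine (comp_comp_of_comp_eq (complexCompatibility_naturality_left π μ f.1 X.2) _).trans ?_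
      exact congrArg _ (Functor.map_comp _ _ _).symm)

namespace FlatResolution

variable [AB4OfSize.{0} C] [IsBicocontinuous T] [AB4OfSize.{0} C'] [IsBicocontinuous T']
  [HasDerivedCategory.{w₁} C] [HasDerivedCategory.{w₂} C'] [HasDerivedBifunctor T]
  [HasDerivedBifunctor T'] [PreservesColimitsOfSize.{0, 0} π] [PreservesFiniteLimits π]
  [PreservesFiniteColimits π]
  (Λ : FlatResolution T) (Λ' : FlatResolution T')

include μ Λ Λ' in
/-- An exact functor which is compatible with bifunctors, preserves coproducts and flat objects is
compatible with the derived bifunctors. -/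
lemma nonempty_derivedCompatibility (hπ : ∀ A, Λ.flat A → Λ'.flat (π.obj A)) :
    Nonempty (π.mapDerivedCategory.prod π.mapDerivedCategory ⋙ derivedBifunctor T' ≅
      derivedBifunctor T ⋙ π.mapDerivedCategory) := by
  let Q₂ := (DerivedCategory.Q (C := C)).prod (DerivedCategory.Q (C := C))
  let Q₂' := (DerivedCategory.Q (C := C')).prod (DerivedCategory.Q (C := C'))
  let π₂ := (π.mapHomologicalComplex (.up ℤ)).prod (π.mapHomologicalComplex (.up ℤ))
  let πD := π.mapDerivedCategory
  let r : Λ.R₂ ⋙ Q₂ ≅ Q₂ := NatIso.prod Λ.isoQρ Λ.isoQρ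
  let a : Q₂ ⋙ πD.prod πD ≅ π₂ ⋙ Q₂' :=
    NatIso.prod π.mapDerivedCategoryFactors π.mapDerivedCategoryFactors
  have h₁ : IsIso (Functor.whiskerLeft Λ.R₂ (derivedCounit T)) := by
    have (X : CochainComplex C ℤ × CochainComplex C ℤ) :
        IsIso ((Functor.whiskerLeft Λ.R₂ (derivedCounit T)).app X) :=
      Λ.isIso_derivedCounit_of_flat _ _ (Λ.flatComplex_R _) (Λ.flatComplex_R _)
    exact NatIso.isIso_of_isIso_app _
  have h₂ : IsIso (Functor.whiskerLeft (Λ.R₂ ⋙ π₂) (derivedCounit T')) := by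
    have (X : CochainComplex C ℤ × CochainComplex C ℤ) :
        IsIso ((Functor.whiskerLeft (Λ.R₂ ⋙ π₂) (derivedCounit T')).app X) :=
      Λ'.isIso_derivedCounit_of_flat _ _ (fun n ↦ hπ _ (Λ.flatComplex_R _ n))
        (fun n ↦ hπ _ (Λ.flatComplex_R _ n))
    exact NatIso.isIso_of_isIso_app _
  let c := asIso (Functor.whiskerLeft Λ.R₂ (derivedCounit T))
  let c' := asIso (Functor.whiskerLeft (Λ.R₂ ⋙ π₂) (derivedCounit T'))
  let e : Q₂ ⋙ (πD.prod πD ⋙ derivedBifunctor T') ≅ Q₂ ⋙ (derivedBifunctor T ⋙ πD) :=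
    calc Q₂ ⋙ (πD.prod πD ⋙ derivedBifunctor T')
      _ ≅ (Λ.R₂ ⋙ Q₂) ⋙ (πD.prod πD ⋙ derivedBifunctor T') := Functor.isoWhiskerRight r.symm _
      _ ≅ Λ.R₂ ⋙ (π₂ ⋙ Q₂') ⋙ derivedBifunctor T' :=
        Functor.isoWhiskerLeft Λ.R₂ (Functor.isoWhiskerRight a _)
      _ ≅ (Λ.R₂ ⋙ π₂) ⋙ complexBifunctor T' ⋙ DerivedCategory.Q := c'
      _ ≅ Λ.R₂ ⋙ (complexBifunctor T ⋙ π.mapHomologicalComplex (.up ℤ)) ⋙ DerivedCategory.Q :=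
        Functor.isoWhiskerLeft Λ.R₂ (Functor.isoWhiskerRight (complexCompatibilityIso π μ) _)
      _ ≅ (Λ.R₂ ⋙ complexBifunctor T) ⋙ DerivedCategory.Q ⋙ πD :=
        Functor.isoWhiskerLeft (Λ.R₂ ⋙ complexBifunctor T) π.mapDerivedCategoryFactors.symm
      _ ≅ (Λ.R₂ ⋙ Q₂ ⋙ derivedBifunctor T) ⋙ πD := Functor.isoWhiskerRight c.symm πD
      _ ≅ Q₂ ⋙ (derivedBifunctor T ⋙ πD) := Functor.isoWhiskerRight r (derivedBifunctor T ⋙ πD)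
  exact ⟨(Localization.fullyFaithfulWhiskeringLeft Q₂ (quasiIsoPairs C) _).preimageIso e⟩

end FlatResolution

end Compatibility

/-! ### The projection formula for the left adjoint of an exact functor -/

section ProjectionFormula

/-- The natural transformation `P ⋙ F ⟶ N` adjoint to `P ⟶ N ⋙ G`. -/
def adjointNatTrans {A D E : Type*} [Category* A] [Category* D] [Category* E] {F : D ⥤ E}
    {G : E ⥤ D} (adj : F ⊣ G) {P : A ⥤ D} {N : A ⥤ E} (ψ : P ⟶ N ⋙ G) : P ⋙ F ⟶ N where
  app X := (adj.homEquiv _ _).symm (ψ.app X)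
  naturality _ _ f := (adj.homEquiv_naturality_left_symm _ _).symm.trans
    ((congrArg _ (ψ.naturality f)).trans (adj.homEquiv_naturality_right_symm _ _))

open HomologicalComplex

variable {C C' : Type*} [Category* C] [Abelian C] [Category* C'] [Abelian C']
  {T : C ⥤ C ⥤ C} {T' : C' ⥤ C' ⥤ C'} (π : C ⥤ C') [π.Additive]
  [HasCoproducts.{0} C] [PreservesColimitsOfSize.{0, 0} π]

lemma nonempty_isColimit_mapHomologicalComplex {J : Type} {K : J → CochainComplex C ℤ} {c : Cofan K}
    (hc : IsColimit c) : Nonempty (IsColimit (Cofan.mk ((π.mapHomologicalComplex _).obj c.pt)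
      fun j ↦ (π.mapHomologicalComplex _).map (c.inj j))) :=
  ⟨isColimitCofanOfEval _ _ fun n ↦
    isColimitCofanMkObjOfIsColimit π _ _ (isColimitCofanEval hc n)⟩

variable [HasDerivedCategory.{w₁} C] [HasDerivedCategory.{w₂} C'] [PreservesFiniteLimits π]
  [PreservesFiniteColimits π]

namespace FlatResolution

variable (Λ : FlatResolution T) (Λ' : FlatResolution T')

variable {Λ Λ'} in
lemma PreservesFlatCoproducts.precomp {E : Type*} [Category* E] {F : DerivedCategory C' ⥤ E}
    (hF : Λ'.PreservesFlatCoproducts (DerivedCategory.Q ⋙ F))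
    (hπ : ∀ A, Λ.flat A → Λ'.flat (π.obj A)) :
    Λ.PreservesFlatCoproducts (DerivedCategory.Q ⋙ π.mapDerivedCategory ⋙ F) := by
  have h : Λ.PreservesFlatCoproducts (π.mapHomologicalComplex _ ⋙ DerivedCategory.Q ⋙ F) :=
    fun J K c hc hK h ↦ hF _ _ (nonempty_isColimit_mapHomologicalComplex π hc).some
      (fun j n ↦ hπ _ (hK j n)) (fun n ↦ hπ _ (h n))
  exact h.of_isIso (Functor.isoWhiskerRight π.mapDerivedCategoryFactors F).hom
    (fun _ _ ↦ inferInstance)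

variable [HasCoproducts.{0} C'] [HasCountableCoproducts C] [HasCountableCoproducts C']
  [T.Additive] [∀ A, (T.obj A).Additive] [T'.Additive] [∀ A, (T'.obj A).Additive]
variable [AB4OfSize.{0} C] [IsBicocontinuous T] [AB4OfSize.{0} C'] [IsBicocontinuous T']
  [HasDerivedBifunctor T] [HasDerivedBifunctor T']

/-- The functors `- ⊗ᴸ X` and `- ⊗ᴸ Y` are isomorphic if `X` and `Y` are. -/
def derivedRightIso {X Y : DerivedCategory C} (e : X ≅ Y) : derivedRight T X ≅ derivedRight T Y :=
  NatIso.ofComponents (fun Z ↦ (derivedBifunctor T).mapIso (Iso.prod (Iso.refl Z) e))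
    (fun _ ↦ (Functor.map_comp _ _ _).symm.trans ((congrArg (derivedBifunctor T).map
      (Prod.ext ((Category.comp_id _).trans (Category.id_comp _).symm)
        ((Category.id_comp _).trans (Category.comp_id _).symm))).trans (Functor.map_comp _ _ _)))

include Λ Λ' in
/-- The projection formula `F (X ⊗ᴸ π Y) ≅ F X ⊗ᴸ Y` for a left adjoint `F` of the functor induced
by an exact functor `π` on derived categories. The morphism is the mate of the compatibility of `π`
with tensor products. It is an isomorphism if `Y` is a shift of the unit object `U`, since the
tensor product with such objects is an equivalence, and the general case follows by dévissage. -/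
theorem nonempty_projectionFormula
    (μ : π ⋙ T' ⋙ (Functor.whiskeringLeft _ _ _).obj π ≅
      T ⋙ (Functor.whiskeringRight _ _ _).obj π)
    (hπ : ∀ A, Λ.flat A → Λ'.flat (π.obj A))
    {F : DerivedCategory C' ⥤ DerivedCategory C} (adj : F ⊣ π.mapDerivedCategory)
    {U : C} (hU : Λ.flat U) (e : T.flip.obj U ≅ 𝟭 C) (e' : T'.flip.obj (π.obj U) ≅ 𝟭 C')
    (h : ∀ A, Λ.flat A → ∃ (J : Type) (c : Cofan fun _ : J ↦ U) (_ : IsColimit c),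
      Λ.flat c.pt ∧ Nonempty (Retract A c.pt)) :
    Nonempty (((𝟭 _).prod π.mapDerivedCategory ⋙ derivedBifunctor T') ⋙ F ≅
      F.prod (𝟭 _) ⋙ derivedBifunctor T) := by
  obtain ⟨m⟩ := nonempty_derivedCompatibility π μ Λ Λ' hπ
  let πD := π.mapDerivedCategory
  let u : (𝟭 _).prod πD ⟶ (F ⋙ πD).prod πD := NatTrans.prod adj.unit (𝟙 πD)
  let ψ : (𝟭 _).prod πD ⋙ derivedBifunctor T' ⟶ (F.prod (𝟭 _) ⋙ derivedBifunctor T) ⋙ πD :=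
    Functor.whiskerRight u (derivedBifunctor T') ≫ Functor.whiskerLeft (F.prod (𝟭 _)) m.hom
  let φ := adjointNatTrans adj ψ
  have hφ (X : DerivedCategory C' × DerivedCategory C) : IsIso (φ.app X) := by
    obtain ⟨X, Y⟩ := X
    let φX : πD ⋙ derivedLeft T' X ⋙ F ⟶ derivedLeft T (F.obj X) :=
      { app Y := φ.app (X, Y)
        naturality Y Z f := (φ.naturality (Prod.mkHom (𝟙 X) f)).trans (congrArg (_ ≫ ·)
          (congrArg (derivedBifunctor T).map (Prod.ext (F.map_id X) rfl))) }
    let := adj.leftAdjointCommShift ℤ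
    have := adj.commShift_of_rightAdjoint ℤ
    have : F.IsTriangulated := adj.isTriangulated_leftAdjoint
    have : PreservesColimitsOfSize.{0, 0} F := adj.leftAdjoint_preservesColimits
    refine Λ.isIso_app_of_isIso_single (F := πD ⋙ derivedLeft T' X ⋙ F)
      (G := derivedLeft T (F.obj X))
      ((PreservesDistinguished.of_isTriangulated πD).comp
        ((Λ'.preservesDistinguished_derivedLeft X).comp (.of_isTriangulated F)))
      (Λ.preservesDistinguished_derivedLeft _)
      (((Λ'.preservesFlatCoproducts_derivedLeft X).precomp π hπ).comp F)
      (Λ.preservesFlatCoproducts_derivedLeft _) φX hU h (fun n ↦ ?_) Y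
    -- for the shifts of `U`, the tensor products are equivalences
    let S := derivedRight T' (πD.obj ((DerivedCategory.singleFunctor C n).obj U))
    let S' := derivedRight T ((DerivedCategory.singleFunctor C n).obj U)
    have hS' : S'.IsEquivalence := Λ.isEquivalence_derivedRight_single hU e n
    have hS'' := Λ'.isEquivalence_derivedRight_single (hπ _ hU) e' n
    let i : πD.obj ((DerivedCategory.singleFunctor C n).obj U) ≅
        DerivedCategory.Q.obj ((single C' (.up ℤ) n).obj (π.obj U)) :=
      (π.mapDerivedCategorySingleFunctor n).app U
    have hS : S.IsEquivalence := Functor.isEquivalence_of_iso (derivedRightIso i).symm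
    let Y := (DerivedCategory.singleFunctor C n).obj U
    have h₁ {Z W : DerivedCategory C} (f : Z ⟶ W) : (πD ⋙ S).map f =
        (πD.prod πD ⋙ derivedBifunctor T').map (Prod.mkHom f (𝟙 Y)) :=
      congrArg (derivedBifunctor T').map (Prod.ext rfl (πD.map_id _).symm)
    let mS : πD ⋙ S ≅ S' ⋙ πD := NatIso.ofComponents (fun Z ↦ m.app (Z, Y))
      (fun f ↦ (congrArg (· ≫ _) (h₁ f)).trans (m.hom.naturality (Prod.mkHom f (𝟙 Y))))
    exact isIso_homEquiv_symm adj S S' mS X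
  exact ⟨@asIso _ _ _ _ φ (NatIso.isIso_of_isIso_app _)⟩

end FlatResolution

end ProjectionFormula

/-! ### Projective resolutions of abelian groups -/

section AbGrp

/-- A quotient of an injective abelian group is injective: a morphism from an ideal of `ℤ` to the
quotient lifts, since the ideal is a projective module. -/
lemma injective_of_epi {I J : AbGrp} (p : I ⟶ J) [Epi p] [Injective I] : Injective J := by
  have hI := Module.Baer.of_injective (Module.injective_module_of_injective_object ℤ I)
  have hJ : Module.Baer ℤ J := fun a g ↦ by
    obtain ⟨g', hg'⟩ := Module.projective_lifting_property p.hom g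
      ((ModuleCat.epi_iff_surjective p).mp inferInstance)
    obtain ⟨k, hk⟩ := hI a g'
    exact ⟨p.hom ∘ₗ k, fun x hx ↦
      (congrArg p.hom (hk x hx)).trans (LinearMap.congr_fun hg' ⟨x, hx⟩)⟩
  have := hJ.injective
  exact Module.injective_object_of_injective_module ℤ J

/-- A subgroup of a projective abelian group is projective. To lift `g : A ⟶ B` along `p : E ⟶ B`,
embed `E` into an injective group `I`. The morphism from `A` to the injective quotient `I / ker p`
extends to the projective group, hence lifts to `I`. -/
lemma projective_of_mono {A P : AbGrp} (f : A ⟶ P) [Mono f] [Projective P] : Projective A where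
  factors {E B} g p _ := by
    let i := Injective.ι E
    let q := cokernel.π (kernel.ι p ≫ i)
    have : Injective (cokernel (kernel.ι p ≫ i)) := injective_of_epi q
    -- `B` is the cokernel of the kernel of `p`
    let b : B ⟶ cokernel (kernel.ι p ≫ i) :=
      (Abelian.epiIsCokernelOfKernel _ (kernelIsKernel p)).desc (CokernelCofork.ofπ (i ≫ q)
        ((Category.assoc _ _ _).symm.trans (cokernel.condition _)))
    have hb : p ≫ b = i ≫ q :=
      (Abelian.epiIsCokernelOfKernel _ (kernelIsKernel p)).fac _ WalkingParallelPair.one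
    let k := f ≫ Projective.factorThru (Injective.factorThru (g ≫ b) f) q
    have hk : k ≫ q = g ≫ b := by simp [k]
    -- the square formed by `p`, `i`, `b` and `q` is a pullback square
    have hE (x : A) : ∃ y : E, i y = k x ∧ p y = g x := by
      obtain ⟨y, hy⟩ := (ModuleCat.epi_iff_surjective p).mp inferInstance (g x)
      have h₁ : q (k x - i y) = 0 := by
        have h₂ : q (k x) = b (g x) := congr($hk x)
        have h₃ : q (i y) = b (p y) := congr($hb.symm y)
        rw [map_sub, h₂, h₃, hy, sub_self]
      have hS : (ShortComplex.mk (kernel.ι p ≫ i) q (cokernel.condition _)).Exact :=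
        ShortComplex.exact_of_g_is_cokernel _ (cokernelIsCokernel _)
      obtain ⟨z, hz⟩ := (ShortComplex.moduleCat_exact_iff _).mp hS _ h₁
      have hz' : i (kernel.ι p z) = k x - i y := hz
      refine ⟨y + kernel.ι p z, ?_, ?_⟩
      · rw [map_add, hz', add_sub_cancel]
      · have h₀ : p (kernel.ι p z) = 0 := congr($(kernel.condition p) z)
        rw [map_add, h₀, hy, add_zero]
    have hi : Function.Injective i := (ModuleCat.mono_iff_injective i).mp inferInstance
    choose s hs hs' using hE
    refine ⟨ModuleCat.ofHom
      { toFun := s, map_add' := fun x y ↦ hi ?_, map_smul' := fun n x ↦ hi ?_ }, ?_⟩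
    · rw [hs, map_add, map_add, hs, hs]
    · exact (hs _).trans ((k.hom.map_smul n x).trans
        ((congrArg (LinearMap.lsmul ℤ _ n) (hs x).symm).trans (i.hom.map_smul n (s x)).symm))
    · ext x
      exact hs' x

/-- The free abelian group on the underlying set of an abelian group. -/
def freeForget : AbGrp ⥤ AbGrp := forget AbGrp ⋙ ModuleCat.free ℤ

/-- The canonical epimorphism from a free group. -/
def freeForgetε : freeForget ⟶ 𝟭 AbGrp := (ModuleCat.adj ℤ).counit

instance (A : AbGrp) : Epi (freeForgetε.app A) :=
  inferInstanceAs (Epi ((ModuleCat.adj ℤ).counit.app A))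

/-- The basis of the free abelian group on a set. -/
def basisFree (J : Type) : Module.Basis J ℤ ((ModuleCat.free ℤ).obj J) :=
  Finsupp.basisSingleOne

instance (A : AbGrp) : Projective (freeForget.obj A) :=
  ModuleCat.projective_of_free (basisFree A)

/-- The kernel of the endomorphism of `freeForget.obj A` induced by zero. The functor `freeForget`
does not preserve zero morphisms, but this subfunctor does. -/
def reducedFree : AbGrp ⥤ AbGrp where
  obj A := kernel (freeForget.map (0 : A ⟶ A))
  map f := kernel.map _ _ (freeForget.map f) (freeForget.map f) (by
    simp only [← Functor.map_comp, zero_comp, comp_zero])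
  map_id A := by
    rw [← cancel_mono (kernel.ι _)]
    exact (kernel.lift_ι _ _ _).trans
      ((congrArg _ (freeForget.map_id A)).trans
        ((Category.comp_id _).trans (Category.id_comp _).symm))
  map_comp f g := by
    rw [← cancel_mono (kernel.ι _)]
    simp

/-- The inclusion of `reducedFree` in `freeForget`. -/
def reducedFreeι : reducedFree ⟶ freeForget where
  app _ := kernel.ι _
  naturality _ _ _ := kernel.lift_ι _ _ _

instance (A : AbGrp) : Mono (reducedFreeι.app A) := inferInstanceAs (Mono (kernel.ι _))

instance : reducedFree.PreservesZeroMorphisms where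
  map_zero A B := by
    rw [← cancel_mono (reducedFreeι.app B), NatTrans.naturality, zero_comp]
    have h : freeForget.map (0 : A ⟶ B) = freeForget.map (0 : A ⟶ A) ≫ freeForget.map 0 := by
      rw [← Functor.map_comp, zero_comp]
    rw [h]
    exact (Category.assoc _ _ _).symm.trans
      ((congrArg (· ≫ _) (kernel.condition _)).trans zero_comp)

instance (A : AbGrp) : Epi ((reducedFreeι ≫ freeForgetε).app A) := by
  have h₁ : (𝟙 _ - freeForget.map (0 : A ⟶ A)) ≫ freeForget.map (0 : A ⟶ A) = 0 := by
    rw [Preadditive.sub_comp, ← Functor.map_comp, Category.id_comp, zero_comp, sub_self]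
  have h₂ : freeForget.map (0 : A ⟶ A) ≫ freeForgetε.app A = 0 :=
    (freeForgetε.naturality (0 : A ⟶ A)).trans comp_zero
  have h₃ : kernel.lift _ _ h₁ ≫ (reducedFreeι ≫ freeForgetε).app A = freeForgetε.app A := by
    refine (Category.assoc _ _ _).symm.trans
      ((congrArg (· ≫ freeForgetε.app A) (kernel.lift_ι _ _ h₁)).trans ?_)
    rw [Preadditive.sub_comp, h₂, sub_zero, Category.id_comp]
  exact epi_of_epi_fac h₃

instance (A : AbGrp) : Projective (reducedFree.obj A) := projective_of_mono (reducedFreeι.app A)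

instance : IsBicocontinuous (curriedTensor AbGrp) where
  obj A := inferInstanceAs (PreservesColimitsOfSize.{0, 0} (tensorLeft A))
  flip A := inferInstanceAs (PreservesColimitsOfSize.{0, 0} (tensorRight A))

lemma preservesFiniteLimits_tensorLeft (A : AbGrp) [Module.Flat ℤ A] :
    PreservesFiniteLimits ((curriedTensor AbGrp).obj A) :=
  inferInstanceAs (PreservesFiniteLimits (tensorLeft A))

lemma preservesFiniteLimits_tensorRight (A : AbGrp) [Module.Flat ℤ A] :
    PreservesFiniteLimits ((curriedTensor AbGrp).flip.obj A) :=
  inferInstanceAs (PreservesFiniteLimits (tensorRight A))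

/-- The functorial resolutions of abelian groups by projective groups. -/
def resolutionAb : FlatResolution (curriedTensor AbGrp) where
  flat := Projective
  flat_of_mono f _ _ := projective_of_mono f
  flat_biprod _ _ := inferInstance
  exact_obj A (_ : Projective A) := preservesFiniteLimits_tensorLeft A
  exact_flip A (_ : Projective A) := preservesFiniteLimits_tensorRight A
  P := reducedFree
  preservesZeroMorphisms := inferInstance
  ε := reducedFreeι ≫ freeForgetε
  epi_ε _ := inferInstance
  flat_P _ := inferInstance

/-- A projective abelian group is a direct factor of a coproduct of copies of `ℤ`. -/
lemma exists_retract_coproduct (A : AbGrp) [Projective A] :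
    ∃ (J : Type) (c : Cofan fun _ : J ↦ 𝟙_ AbGrp) (_ : IsColimit c),
      Projective c.pt ∧ Nonempty (Retract A c.pt) := by
  have : Projective (𝟙_ AbGrp) :=
    ModuleCat.projective_of_free (Module.Basis.singleton Unit ℤ)
  let c := coproductIsCoproduct fun _ : A ↦ 𝟙_ AbGrp
  let p : (∐ fun _ : A ↦ 𝟙_ AbGrp) ⟶ A :=
    Sigma.desc fun a ↦ ModuleCat.ofHom (LinearMap.toSpanSingleton ℤ A a)
  have : Epi p := (ModuleCat.epi_iff_surjective p).mpr fun a ↦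
    ⟨Sigma.ι (fun _ : A ↦ 𝟙_ AbGrp) a (1 : ℤ), by
      have h : Sigma.ι (fun _ : A ↦ 𝟙_ AbGrp) a ≫ p =
          ModuleCat.ofHom (LinearMap.toSpanSingleton ℤ A a) :=
        Sigma.ι_desc _ _
      exact congr($h (1 : ℤ)).trans (LinearMap.toSpanSingleton_apply_one ℤ A a)⟩
  exact ⟨A, _, c, inferInstanceAs (Projective (∐ fun _ : A ↦ 𝟙_ AbGrp)),
    ⟨⟨Projective.factorThru (𝟙 A) p, p, Projective.factorThru_comp _ _⟩⟩⟩

end AbGrp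

/-! ### Torsion-free resolutions of sheaves of abelian groups -/

section

variable {C : Type*} [Category* C] [Preadditive C]

/-- The objects on which multiplication by every nonzero integer is a monomorphism. -/
def torsionFree (C : Type*) [Category* C] [Preadditive C] : ObjectProperty C :=
  fun A ↦ ∀ n : ℤ, n ≠ 0 → Mono (n • 𝟙 A)

lemma torsionFree_of_mono {A B : C} (f : A ⟶ B) [Mono f] (h : torsionFree C B) :
    torsionFree C A := fun n hn ↦ by
  have := h n hn
  have h' : (n • 𝟙 A) ≫ f = f ≫ (n • 𝟙 B) := by simp
  have : Mono ((n • 𝟙 A) ≫ f) := h' ▸ mono_comp _ _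
  exact mono_of_mono (n • 𝟙 A) f

lemma torsionFree_biprod [HasBinaryBiproducts C] {A B : C} (hA : torsionFree C A)
    (hB : torsionFree C B) : torsionFree C (A ⊞ B) := fun n hn ↦ by
  have := hA n hn
  have := hB n hn
  have h : n • 𝟙 (A ⊞ B) = biprod.map (n • 𝟙 A) (n • 𝟙 B) := by
    ext <;> simp
  rw [h]
  infer_instance

lemma torsionFree_map {D : Type*} [Category* D] [Preadditive D] (F : C ⥤ D) [F.Additive]
    [F.PreservesMonomorphisms] {A : C} (hA : torsionFree C A) : torsionFree D (F.obj A) :=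
  fun n hn ↦ by
    have := hA n hn
    rw [← F.map_id, ← F.map_zsmul]
    infer_instance

lemma torsionFree_functor {J : Type*} [Category* J] {F : J ⥤ C}
    (hF : ∀ j, torsionFree C (F.obj j)) : torsionFree (J ⥤ C) F := fun n hn ↦ by
  have (j : J) : Mono ((n • 𝟙 F : F ⟶ F).app j) := hF j n hn
  exact NatTrans.mono_of_mono_app _

lemma zsmul_id_apply {A : AbGrp} (n : ℤ) (x : A) :
    (n • 𝟙 A : A ⟶ A) x = LinearMap.lsmul ℤ A n x := by
  let φ : (A ⟶ A) →+ A := AddMonoidHom.mk' (fun f ↦ f x) fun _ _ ↦ rfl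
  exact (map_zsmul φ n (𝟙 A)).trans (int_smul_eq_zsmul A.isModule n x).symm

lemma flat_of_torsionFree {A : AbGrp} (hA : torsionFree AbGrp A) : Module.Flat ℤ A := by
  have : Module.IsTorsionFree ℤ A := ⟨fun n hn x y hxy ↦
    (ModuleCat.mono_iff_injective (n • 𝟙 A)).mp (hA n hn.ne_zero)
      ((zsmul_id_apply n x).trans (Eq.trans hxy (zsmul_id_apply n y).symm))⟩
  infer_instance

lemma torsionFree_of_flat (A : AbGrp) [Module.Flat ℤ A] : torsionFree AbGrp A := fun n hn ↦
  (ModuleCat.mono_iff_injective _).mpr fun x y hxy ↦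
    Module.IsTorsionFree.isSMulRegular (M := A) (IsRegular.of_ne_zero hn)
      ((zsmul_id_apply n x).symm.trans (Eq.trans hxy (zsmul_id_apply n y)))

end


/-- Colimits in a reflective subcategory are obtained by reflecting colimits. -/
lemma preservesColimitsOfSize_of_reflection {C D E : Type*} [Category* C] [Category* D]
    [Category* E] {L : C ⥤ D} {i : D ⥤ C} (adj : L ⊣ i) [i.Full] [i.Faithful]
    [HasColimitsOfSize.{0, 0} C] (H : D ⥤ E) [PreservesColimitsOfSize.{0, 0} (L ⋙ H)] :
    PreservesColimitsOfSize.{0, 0} H where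
  preservesColimitsOfShape :=
    { preservesColimit {K} := by
        have := adj.leftAdjoint_preservesColimits
        have h : IsColimit (H.mapCocone (L.mapCocone (colimit.cocone (K ⋙ i)))) :=
          isColimitOfPreserves (L ⋙ H) (colimit.isColimit (K ⋙ i))
        have : PreservesColimit ((K ⋙ i) ⋙ L) H := preservesColimit_of_preserves_colimit_cocone
          (isColimitOfPreserves L (colimit.isColimit (K ⋙ i))) h
        exact preservesColimit_of_iso_diagram (K₁ := (K ⋙ i) ⋙ L) H
          (Functor.isoWhiskerLeft K (asIso adj.counit) ≪≫ K.rightUnitor) }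

/-! ### Tensor products and flat resolutions of sheaves -/

section Shv

open MonoidalClosed.FunctorCategory

variable (X : TopCat.{0})

/-- The category of presheaves of abelian groups on `X`. -/
abbrev PShv : Type 1 := (TopologicalSpace.Opens X)ᵒᵖ ⥤ AbGrp

/-- The inclusion of sheaves in presheaves. -/
abbrev toPresheaf : Shv X ⥤ PShv X := sheafToPresheaf _ _

/-- The associated sheaf functor. -/
abbrev sheafify : PShv X ⥤ Shv X := presheafToSheaf _ _

/-- The adjunction between the associated sheaf functor and the inclusion. -/
abbrev sheafifyAdj : sheafify X ⊣ toPresheaf X := sheafificationAdjunction _ _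

variable {X} in
lemma isIso_sheafify_map {F G : PShv X} {f : F ⟶ G}
    (hf : (Opens.grothendieckTopology X).W f) : IsIso ((sheafify X).map f) :=
  ((Opens.grothendieckTopology X).W_iff f).mp hf

variable {X} in
lemma W_unit (F : PShv X) :
    (Opens.grothendieckTopology X).W ((sheafifyAdj X).unit.app F) :=
  (Opens.grothendieckTopology X).W_toSheafify F

variable {X} in
lemma isIso_sheafify_whiskerLeft (F P : PShv X) :
    IsIso ((sheafify X).map (F ◁ (sheafifyAdj X).unit.app P)) :=
  isIso_sheafify_map ((W_unit P).whiskerLeft F)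

/-- The tensor product of the sheaf `F` and the sheaf associated with a presheaf `P` is associated
with the tensor product of `F` and `P`. -/
def tensorShvObjIso (F : Shv X) : sheafify X ⋙ (tensorShv X).obj F ≅
    tensorLeft F.obj ⋙ sheafify X :=
  (NatIso.ofComponents (F := tensorLeft F.obj ⋙ sheafify X) (G := sheafify X ⋙ (tensorShv X).obj F)
    (fun P ↦ @asIso _ _ _ _ _ (isIso_sheafify_whiskerLeft F.obj P)) fun {P Q} f ↦ by
    have h : F.obj ◁ f ≫ F.obj ◁ (sheafifyAdj X).unit.app Q =
        F.obj ◁ (sheafifyAdj X).unit.app P ≫ F.obj ◁ ((sheafify X).map f).hom :=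
      (whiskerLeft_comp _ _ _).symm.trans
        ((congrArg _ ((sheafifyAdj X).unit.naturality f)).trans (whiskerLeft_comp _ _ _))
    exact ((sheafify X).map_comp _ _).symm.trans
      ((congrArg (sheafify X).map h).trans ((sheafify X).map_comp _ _))).symm

lemma preservesColimits_tensorLeft (F : PShv X) :
    PreservesColimitsOfSize.{0, 0} (tensorLeft F) :=
  (ihom.adjunction F).leftAdjoint_preservesColimits

instance (F : Shv X) : PreservesColimitsOfSize.{0, 0} ((tensorShv X).obj F) := by
  have := preservesColimits_tensorLeft X F.obj
  have : PreservesColimitsOfSize.{0, 0} (sheafify X) :=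
    (sheafifyAdj X).leftAdjoint_preservesColimits
  have : PreservesColimitsOfSize.{0, 0} (sheafify X ⋙ (tensorShv X).obj F) :=
    preservesColimits_of_natIso (tensorShvObjIso X F).symm
  exact preservesColimitsOfSize_of_reflection (sheafifyAdj X) _

/-- The tensor product of sheaves is commutative. -/
def tensorShvFlipIso (F : Shv X) : (tensorShv X).flip.obj F ≅ (tensorShv X).obj F :=
  NatIso.ofComponents (fun G ↦ (sheafify X).mapIso (β_ G.obj F.obj)) fun {G H} f ↦ by
    have h : f.hom ▷ F.obj ≫ (β_ H.obj F.obj).hom = (β_ G.obj F.obj).hom ≫ F.obj ◁ f.hom :=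
      BraidedCategory.braiding_naturality_left f.hom F.obj
    exact ((sheafify X).map_comp _ _).symm.trans
      ((congrArg (sheafify X).map h).trans ((sheafify X).map_comp _ _))

instance : IsBicocontinuous (tensorShv X) where
  obj _ := inferInstance
  flip F := preservesColimits_of_natIso (tensorShvFlipIso X F).symm

/-- The sections of sheaves over an open subset. -/
abbrev sections (U : (TopologicalSpace.Opens X)ᵒᵖ) : Shv X ⥤ AbGrp :=
  toPresheaf X ⋙ (evaluation _ _).obj U

instance (U : (TopologicalSpace.Opens X)ᵒᵖ) : (sections X U).Additive where
  map_add := rfl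

instance (U : (TopologicalSpace.Opens X)ᵒᵖ) : (sections X U).PreservesMonomorphisms :=
  inferInstance

variable {X} in
lemma preservesFiniteLimits_tensorShv_obj {F : Shv X} (hF : torsionFree (Shv X) F) :
    PreservesFiniteLimits ((tensorShv X).obj F) := by
  have h (U : (TopologicalSpace.Opens X)ᵒᵖ) :
      PreservesFiniteLimits ((curriedTensor AbGrp).obj (F.obj.obj U)) :=
    have : Module.Flat ℤ (F.obj.obj U) := flat_of_torsionFree (torsionFree_map (sections X U) hF)
    preservesFiniteLimits_tensorLeft _
  have h' (U : (TopologicalSpace.Opens X)ᵒᵖ) :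
      PreservesFiniteLimits (tensorLeft F.obj ⋙ (evaluation _ AbGrp).obj U) :=
    @comp_preservesFiniteLimits _ _ _ _ _ _ ((evaluation _ _).obj U)
      ((curriedTensor AbGrp).obj (F.obj.obj U)) inferInstance (h U)
  have : PreservesFiniteLimits (tensorLeft F.obj) := preservesFiniteLimits_of_evaluation _ h'
  have : PreservesFiniteLimits (tensorLeft F.obj ⋙ sheafify X) := inferInstance
  exact comp_preservesFiniteLimits (toPresheaf X) (tensorLeft F.obj ⋙ sheafify X)

/-- The functor which sends a sheaf `F` to the sheaf associated with `U ↦ reducedFree.obj F(U)`. -/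
def freeShv : Shv X ⥤ Shv X :=
  toPresheaf X ⋙ (Functor.whiskeringRight _ _ _).obj reducedFree ⋙ sheafify X

/-- The canonical epimorphism from `freeShv`. -/
def freeShvε : freeShv X ⟶ 𝟭 _ :=
  Functor.whiskerLeft (toPresheaf X) (Functor.whiskerRight
    ((Functor.whiskeringRight _ _ _).map (reducedFreeι ≫ freeForgetε)) (sheafify X)) ≫
    (sheafifyAdj X).counit

instance (F : Shv X) : Epi ((freeShvε X).app F) := by
  let f : F.obj ⋙ reducedFree ⟶ F.obj :=
    ((Functor.whiskeringRight (TopologicalSpace.Opens X)ᵒᵖ _ _).map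
      (reducedFreeι ≫ freeForgetε)).app F.obj
  have (U : (TopologicalSpace.Opens X)ᵒᵖ) : Epi (f.app U) :=
    inferInstanceAs (Epi ((reducedFreeι ≫ freeForgetε).app (F.obj.obj U)))
  have : Epi f := NatTrans.epi_of_epi_app f
  have : PreservesColimitsOfSize.{0, 0} (sheafify X) :=
    (sheafifyAdj X).leftAdjoint_preservesColimits
  have : Epi ((sheafify X).map f) := inferInstance
  exact epi_comp ((sheafify X).map f) ((sheafifyAdj X).counit.app F)

instance : (freeShv X).PreservesZeroMorphisms where
  map_zero F G := by
    have h : ((Functor.whiskeringRight _ _ _).obj reducedFree).map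
        ((toPresheaf X).map (0 : F ⟶ G)) = 0 := by
      ext U : 2
      exact reducedFree.map_zero _ _
    exact (congrArg (sheafify X).map h).trans ((sheafify X).map_zero _ _)

/-- The functorial resolutions of sheaves by torsion-free sheaves. -/
def resolutionShv : FlatResolution (tensorShv X) where
  flat := torsionFree (Shv X)
  flat_of_mono := torsionFree_of_mono
  flat_biprod := torsionFree_biprod
  exact_obj _ := preservesFiniteLimits_tensorShv_obj
  exact_flip F hF :=
    have := preservesFiniteLimits_tensorShv_obj hF
    preservesFiniteLimits_of_natIso (tensorShvFlipIso X F).symm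
  P := freeShv X
  preservesZeroMorphisms := inferInstance
  ε := freeShvε X
  epi_ε _ := inferInstance
  flat_P F := torsionFree_map (A := F.obj ⋙ reducedFree) (sheafify X)
    (torsionFree_functor fun U ↦
      have : Projective (reducedFree.obj (F.obj.obj U)) := inferInstance
      torsionFree_of_flat (reducedFree.obj (F.obj.obj U)))

end Shv

/-! ### Constant sheaves -/

section ConstShv

open MonoidalClosed.FunctorCategory

variable (X : TopCat.{0})

instance : (constShv X).Additive where
  map_add {A B f g} := by
    have h : (Functor.const (TopologicalSpace.Opens X)ᵒᵖ).map (f + g) =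
      (Functor.const _).map f + (Functor.const _).map g := rfl
    exact (congrArg (sheafify X).map h).trans ((sheafify X).map_add)

instance : PreservesColimitsOfSize.{0, 0} (constShv X) :=
  (constantSheafAdj (Opens.grothendieckTopology X) AbGrp
    isTerminalTop).leftAdjoint_preservesColimits

lemma torsionFree_constShv {A : AbGrp} (_ : Projective A) :
    torsionFree (Shv X) ((constShv X).obj A) :=
  torsionFree_map (constShv X) (torsionFree_of_flat A)

/-- The constant presheaf on an abelian group. -/
abbrev constPShv : AbGrp ⥤ PShv X := Functor.const _

/-- The constant presheaf of a tensor product is the tensor product of the constant presheaves. -/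
def constTensorIso (A B : AbGrp) : (constPShv X).obj (A ⊗ B) ≅
    (constPShv X).obj A ⊗ (constPShv X).obj B :=
  NatIso.ofComponents (fun _ ↦ Iso.refl _) fun _ ↦
    (Category.comp_id _).trans (Eq.trans (id_tensorHom_id A B).symm (Category.id_comp _).symm)

/-- The morphism from the tensor product of two presheaves to the tensor product of the associated
sheaves. -/
def unitTensor (P Q : PShv X) : P ⊗ Q ⟶ ((sheafify X).obj P).obj ⊗ ((sheafify X).obj Q).obj :=
  (sheafifyAdj X).unit.app P ⊗ₘ (sheafifyAdj X).unit.app Q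

lemma isIso_sheafify_map_unitTensor (P Q : PShv X) :
    IsIso ((sheafify X).map (unitTensor X P Q)) := by
  refine isIso_sheafify_map ?_
  rw [unitTensor, MonoidalCategory.tensorHom_def]
  exact MorphismProperty.comp_mem _ _ _ ((W_unit P).whiskerRight _) ((W_unit Q).whiskerLeft _)

lemma unitTensor_naturality {P P' Q Q' : PShv X} (f : P ⟶ P') (g : Q ⟶ Q') :
    (f ⊗ₘ g) ≫ unitTensor X P' Q' =
      unitTensor X P Q ≫ (((sheafify X).map f).hom ⊗ₘ ((sheafify X).map g).hom) :=
  (tensorHom_comp_tensorHom _ _ _ _).trans ((congrArg₂ (· ⊗ₘ ·)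
    ((sheafifyAdj X).unit.naturality f) ((sheafifyAdj X).unit.naturality g)).trans
      (tensorHom_comp_tensorHom _ _ _ _).symm)

/-- The constant sheaf of a tensor product is the tensor product of the constant sheaves, on
objects. -/
def constShvTensorObjIso (A B : AbGrp) : (constShv X).obj (A ⊗ B) ≅
    ((tensorShv X).obj ((constShv X).obj A)).obj ((constShv X).obj B) :=
  (sheafify X).mapIso (constTensorIso X A B) ≪≫
    @asIso _ _ _ _ _ (isIso_sheafify_map_unitTensor X _ _)

lemma constShvTensorObjIso_naturality {A A' B B' : AbGrp} (f : A ⟶ A') (g : B ⟶ B') :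
    (constShv X).map (f ⊗ₘ g) ≫ (constShvTensorObjIso X A' B').hom =
      (constShvTensorObjIso X A B).hom ≫ (sheafify X).map
        (((constShv X).map f).hom ⊗ₘ ((constShv X).map g).hom) := by
  have h : (constPShv X).map (f ⊗ₘ g) ≫ (constTensorIso X A' B').hom =
      (constTensorIso X A B).hom ≫ ((constPShv X).map f ⊗ₘ (constPShv X).map g) := by
    ext U : 2
    exact (Category.comp_id _).trans (Category.id_comp _).symm
  have h' : ((constPShv X).map (f ⊗ₘ g) ≫ (constTensorIso X A' B').hom) ≫ unitTensor X _ _ =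
      ((constTensorIso X A B).hom ≫ unitTensor X _ _) ≫
        (((sheafify X).map ((constPShv X).map f)).hom ⊗ₘ
          ((sheafify X).map ((constPShv X).map g)).hom) := by
    rw [h, Category.assoc, Category.assoc, unitTensor_naturality]
  have h₁ := congrArg (sheafify X).map h'
  rw [Functor.map_comp, Functor.map_comp, Functor.map_comp, Functor.map_comp] at h₁
  exact (Category.assoc _ _ _).symm.trans h₁

lemma tensorShv_obj_map (F : Shv X) {G H : Shv X} (g : G ⟶ H) :
    ((tensorShv X).obj F).map g = (sheafify X).map (𝟙 F.obj ⊗ₘ g.hom) :=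
  congrArg (sheafify X).map (id_tensorHom F.obj g.hom).symm

lemma tensorShv_map_app {F G : Shv X} (f : F ⟶ G) (H : Shv X) :
    ((tensorShv X).map f).app H = (sheafify X).map (f.hom ⊗ₘ 𝟙 H.obj) :=
  congrArg (sheafify X).map (tensorHom_id f.hom H.obj).symm

/-- The constant sheaf of a tensor product is the tensor product of the constant sheaves. -/
def constShvTensorIso :
    constShv X ⋙ tensorShv X ⋙ (Functor.whiskeringLeft _ _ _).obj (constShv X) ≅
      curriedTensor AbGrp ⋙ (Functor.whiskeringRight _ _ _).obj (constShv X) :=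
  (NatIso.ofComponents (F := curriedTensor AbGrp ⋙ (Functor.whiskeringRight _ _ _).obj (constShv X))
    (G := constShv X ⋙ tensorShv X ⋙ (Functor.whiskeringLeft _ _ _).obj (constShv X))
    (fun A ↦ NatIso.ofComponents (fun B ↦ constShvTensorObjIso X A B) fun {B B'} g ↦ by
      have h := constShvTensorObjIso_naturality X (𝟙 A) g
      rw [id_tensorHom, CategoryTheory.Functor.map_id] at h
      exact h.trans (congrArg (_ ≫ ·) (tensorShv_obj_map X _ _).symm))
    fun {A A'} f ↦ by
      ext B : 2
      have h := constShvTensorObjIso_naturality X f (𝟙 B)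
      rw [tensorHom_id, CategoryTheory.Functor.map_id] at h
      exact h.trans (congrArg (_ ≫ ·) (tensorShv_map_app X _ _).symm)).symm

/-- The constant sheaf `ℤ` is a unit for the tensor product. -/
def tensorShvUnitIso : (tensorShv X).flip.obj ((constShv X).obj (𝟙_ AbGrp)) ≅ 𝟭 (Shv X) := by
  have h (F : Shv X) : IsIso ((sheafify X).map (F.obj ◁ (sheafifyAdj X).unit.app
      ((constPShv X).obj (𝟙_ AbGrp)))) := isIso_sheafify_whiskerLeft F.obj _
  let r : toPresheaf X ⋙ tensorRight (𝟙_ (PShv X)) ⋙ sheafify X ≅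
      (tensorShv X).flip.obj ((constShv X).obj (𝟙_ AbGrp)) :=
    NatIso.ofComponents (fun F ↦ @asIso _ _ _ _ _ (h F)) fun {F G} f ↦
      ((sheafify X).map_comp _ _).symm.trans ((congrArg (sheafify X).map
        (whisker_exchange f.hom _).symm).trans ((sheafify X).map_comp _ _))
  exact r.symm ≪≫ Functor.isoWhiskerLeft (toPresheaf X)
      (Functor.isoWhiskerRight (rightUnitorNatIso (PShv X)) (sheafify X)) ≪≫
    asIso (sheafifyAdj X).counit

end ConstShv

/-! ### The projection formula for the homology of sheaves -/

section Sheaves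

variable (X : TopCat.{0}) [HasDerivedCategory.{w₁} AbGrp] [HasDerivedCategory.{w₂} (Shv X)]

instance : HasDerivedTensorAb.{w₁} := resolutionAb.hasDerivedBifunctor

instance : HasDerivedTensorShv.{w₂} X := (resolutionShv X).hasDerivedBifunctor

/-- The projection formula for the homology of sheaves. -/
theorem nonempty_tensorConst_sheafHomology_iso [(constDerived.{w₁, w₂} X).IsRightAdjoint] :
    Nonempty (tensorConst X ⋙ sheafHomology X ≅
      (sheafHomology X).prod (𝟭 (DerivedCategory AbGrp)) ⋙ derivedTensorAb) := by
  have : Projective (𝟙_ AbGrp) :=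
    ModuleCat.projective_of_free (Module.Basis.singleton Unit ℤ)
  exact FlatResolution.nonempty_projectionFormula (constShv X) resolutionAb (resolutionShv X)
    (constShvTensorIso X) (fun _ ↦ torsionFree_constShv X)
    (Adjunction.ofIsRightAdjoint (constDerived X)) (U := 𝟙_ AbGrp) this (rightUnitorNatIso AbGrp)
    (tensorShvUnitIso X) (fun A (_ : Projective A) ↦ exists_retract_coproduct A)

end Sheaves

/-! ### The derived tensor product with a single object -/

section TermwiseTensor

open HomologicalComplex

variable {C : Type*} [Category* C] [Abelian C]
  (T : C ⥤ C ⥤ C) [T.PreservesZeroMorphisms] [∀ A, (T.obj A).PreservesZeroMorphisms]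

/-- The functor `(K, A) ↦ T(K, A)`, where `T(-, A)` is applied to the terms of the complex `K`. -/
def termwise : CochainComplex C ℤ × C ⥤ CochainComplex C ℤ where
  obj X := ((T.flip.obj X.2).mapHomologicalComplex _).obj X.1
  map {X Y} f :=
    { f n := (T.map (f.1.f n)).app X.2 ≫ (T.obj (Y.1.X n)).map f.2
      comm' n m _ := by
        have h : (T.map (f.1.f n)).app X.2 ≫ (T.map (Y.1.d n m)).app X.2 =
            (T.map (X.1.d n m)).app X.2 ≫ (T.map (f.1.f m)).app X.2 := by
          rw [← NatTrans.comp_app, ← NatTrans.comp_app, ← T.map_comp, ← T.map_comp, f.1.comm]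
        refine (Category.assoc _ _ _).trans ((congrArg (_ ≫ ·)
          ((T.map (Y.1.d n m)).naturality f.2)).trans ?_)
        exact (Category.assoc _ _ _).symm.trans
          ((congrArg (· ≫ _) h).trans (Category.assoc _ _ _)) }
  map_id X := by
    ext n
    change (T.map (𝟙 (X.1.X n))).app X.2 ≫ (T.obj (X.1.X n)).map (𝟙 X.2) = 𝟙 _
    rw [CategoryTheory.Functor.map_id, CategoryTheory.Functor.map_id]
    exact Category.id_comp _
  map_comp {X Y Z} f g := by
    ext n
    change (T.map (f.1.f n ≫ g.1.f n)).app X.2 ≫ (T.obj (Z.1.X n)).map (f.2 ≫ g.2) =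
      ((T.map (f.1.f n)).app X.2 ≫ (T.obj (Y.1.X n)).map f.2) ≫
        (T.map (g.1.f n)).app Y.2 ≫ (T.obj (Z.1.X n)).map g.2
    rw [T.map_comp, NatTrans.comp_app, CategoryTheory.Functor.map_comp, Category.assoc,
      Category.assoc, NatTrans.naturality_assoc]

namespace FlatResolution

variable {T} in
/-- If the terms of `K` are projective, then the exact sequences `0 → Z → K → K/Z → 0` are split in
each degree, hence remain exact after tensoring with any object. -/
lemma quasiIso_map₂_map_of_projective (Λ : FlatResolution T) [HasCoproducts.{0} C] [T.Additive]
    [AB4OfSize.{0} C] [IsBicocontinuous T] (hΛ : ∀ A, Λ.flat A → Projective A)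
    {K L M : CochainComplex C ℤ} (hK : Λ.flatComplex K) (f : L ⟶ M) [QuasiIso f] :
    QuasiIso ((T.map₂CochainComplex.obj K).map f) := by
  have h (A : C) (q : ℤ) :
      (((cyclesSequence K).map (eval C _ q)).map (T.flip.obj A)).ShortExact := by
    have : (T.flip.obj A).Additive := ⟨fun {_ _ f g} ↦ NatTrans.congr_app (T.map_add (f := f)) A⟩
    have : Projective ((cyclesSequence K).map (eval C _ q)).X₃ := hΛ _ (Λ.flat_coimage hK q)
    exact ((cyclesSequence_shortExact_eval K q).splittingOfProjective.map (T.flip.obj A)).shortExact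
  exact (quasiIso_map₂_map_iff T K f).2 (SheafHomology.quasiIso_map₂_app T.flip f inferInstance
    inferInstance K (fun n ↦ Λ.exact_obj _ (Λ.flat_cycles hK n))
    (fun n ↦ Λ.exact_obj _ (Λ.flat_coimage hK n)) (fun p q ↦ h _ q) (fun p q ↦ h _ q))

end FlatResolution

variable [HasCoproducts.{0} C] [HasCountableCoproducts C] [T.Additive] [∀ A, (T.obj A).Additive]

/-- The total complex of `K` and the single complex on `A` in degree zero is `T(K, A)`. -/
def termwiseIso : termwise T ≅ (𝟭 _).prod (single C (.up ℤ) 0) ⋙ complexBifunctor T :=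
  NatIso.ofComponents (fun X ↦ Hom.isoOfComponents
    (fun n ↦ @asIso _ _ _ _ _ (isIso_ιSingle T X.1 X.2 0 n n (add_zero n)))
    (fun n m hnm ↦ ιSingle_d T X.1 X.2 0 n n m m (add_zero n) (add_zero m) hnm))
    (fun {X Y} f ↦ by
      ext n
      refine Eq.trans (Category.assoc _ _ _) ?_
      refine (congrArg (_ ≫ ·) (ιSingle_map_map T Y.1 f.2 0 n n (add_zero n)).symm).trans ?_
      exact (Category.assoc _ _ _).symm.trans ((congrArg (· ≫ _)
        (ιSingle_map_app T f.1 X.2 0 n n (add_zero n)).symm).trans (Category.assoc _ _ _)))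

variable [AB4OfSize.{0} C] [IsBicocontinuous T]

namespace FlatResolution

variable {T} (Λ : FlatResolution T)

variable [HasDerivedCategory.{w} C] [HasDerivedBifunctor T]

variable (T) in
/-- The functor `(K, A) ↦ K ⊗ᴸ A`, for objects `A` regarded as complexes in degree zero. -/
abbrev derivedSingle : DerivedCategory C × C ⥤ DerivedCategory C :=
  (𝟭 _).prod (DerivedCategory.singleFunctor C 0) ⋙ derivedBifunctor T

/-- If the flat objects are projective, then the derived tensor product of a complex `K` with an
object is computed by the flat resolution of `K`. -/
def derivedSingleIso (hΛ : ∀ A, Λ.flat A → Projective A) :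
    (DerivedCategory.Q (C := C)).prod (𝟭 C) ⋙ derivedSingle T ≅
      (Λ.R.prod (𝟭 C) ⋙ termwise T) ⋙ DerivedCategory.Q :=
  let s := single C (.up ℤ) 0
  have h (X : CochainComplex C ℤ × C) :
      IsIso ((derivedCounit T).app ((Λ.R.prod s).obj X)) :=
    Λ.isIso_derivedCounit_of_flat_left _ _ (Λ.flatComplex_R X.1)
      (Λ.quasiIso_map₂_map_of_projective hΛ (Λ.flatComplex_R X.1) _)
  let c : Λ.R.prod s ⋙ (DerivedCategory.Q (C := C)).prod (DerivedCategory.Q (C := C)) ⋙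
      derivedBifunctor T ≅ Λ.R.prod s ⋙ complexBifunctor T ⋙ DerivedCategory.Q :=
    NatIso.ofComponents (fun X ↦ @asIso _ _ _ _ _ (h X))
      (fun f ↦ (derivedCounit T).naturality ((Λ.R.prod s).map f))
  let q : (DerivedCategory.Q (C := C)).prod (DerivedCategory.singleFunctor C 0) ≅
      (Λ.R ⋙ DerivedCategory.Q (C := C)).prod (s ⋙ DerivedCategory.Q (C := C)) :=
    NatIso.prod Λ.isoQρ.symm (DerivedCategory.singleFunctorIsoCompQ C 0)
  Functor.isoWhiskerRight q (derivedBifunctor T) ≪≫ c ≪≫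
    Functor.isoWhiskerRight (Functor.isoWhiskerLeft (Λ.R.prod (𝟭 C)) (termwiseIso T).symm)
      DerivedCategory.Q

end FlatResolution

end TermwiseTensor

/-- Split short exact sequences of functors descend along a localization functor. -/
lemma exists_splitting_of_localization {A D V : Type*} [Category* A] [Category* D] [Category* V]
    [Preadditive V] (L : A ⥤ D) (W : MorphismProperty A) [L.IsLocalization W]
    {E₁ E₂ E₃ : D ⥤ V} {S₁ S₂ S₃ : A ⥤ V} (e₁ : L ⋙ E₁ ≅ S₁) (e₂ : L ⋙ E₂ ≅ S₂)
    (e₃ : L ⋙ E₃ ≅ S₃) (f : S₁ ⟶ S₂) (g : S₂ ⟶ S₃)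
    (H : ∀ X, ∃ h : f.app X ≫ g.app X = 0, Nonempty (ShortComplex.mk _ _ h).Splitting) :
    ∃ (α : E₁ ⟶ E₂) (β : E₂ ⟶ E₃), ∀ X, ∃ h : α.app X ≫ β.app X = 0,
      Nonempty (ShortComplex.mk _ _ h).Splitting := by
  have := Localization.full_whiskeringLeft L W V
  obtain ⟨α, hα⟩ := ((Functor.whiskeringLeft A D V).obj L).map_surjective (e₁.hom ≫ f ≫ e₂.inv)
  obtain ⟨β, hβ⟩ := ((Functor.whiskeringLeft A D V).obj L).map_surjective (e₂.hom ≫ g ≫ e₃.inv)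
  refine ⟨α, β, fun X ↦ ?_⟩
  have := Localization.essSurj L W
  let Y := L.objPreimage X
  let u : L.obj Y ≅ X := L.objObjPreimageIso X
  obtain ⟨h, ⟨s⟩⟩ := H Y
  have hα' : α.app (L.obj Y) = e₁.hom.app Y ≫ f.app Y ≫ e₂.inv.app Y := NatTrans.congr_app hα Y
  have hβ' : β.app (L.obj Y) = e₂.hom.app Y ≫ g.app Y ≫ e₃.inv.app Y := NatTrans.congr_app hβ Y
  let i₁ : S₁.obj Y ≅ E₁.obj X := e₁.symm.app Y ≪≫ E₁.mapIso u
  let i₂ : S₂.obj Y ≅ E₂.obj X := e₂.symm.app Y ≪≫ E₂.mapIso u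
  let i₃ : S₃.obj Y ≅ E₃.obj X := e₃.symm.app Y ≪≫ E₃.mapIso u
  have h₁ : i₁.hom ≫ α.app X = f.app Y ≫ i₂.hom := by
    refine (Category.assoc _ _ _).trans ((congrArg (_ ≫ ·) (α.naturality u.hom)).trans ?_)
    rw [hα']
    simp [i₂]
  have h₂ : i₂.hom ≫ β.app X = g.app Y ≫ i₃.hom := by
    refine (Category.assoc _ _ _).trans ((congrArg (_ ≫ ·) (β.naturality u.hom)).trans ?_)
    rw [hβ']
    simp [i₃]
  have h₀ : α.app X ≫ β.app X = 0 := by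
    rw [← cancel_epi i₁.hom, reassoc_of% h₁, h₂, reassoc_of% h, zero_comp, comp_zero]
  exact ⟨h₀, ⟨s.ofIso (ShortComplex.isoMk (S₂ := ShortComplex.mk _ _ h₀) i₁ i₂ i₃ h₁ h₂)⟩⟩

/-! ### The homology of a tensor product -/

section Kunneth

open HomologicalComplex

section

variable {R : Type} [CommRing R] (A : ModuleCat.{0} R) {B G : ModuleCat.{0} R}

/-- The morphism `a ↦ a ⊗ x` from `A` to `A ⊗ G`. -/
def tmulHom (x : G) : A ⟶ A ⊗ G := ModuleCat.ofHom ((TensorProduct.mk R A G).flip x)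

lemma tmulHom_add (x y : G) : tmulHom A (x + y) = tmulHom A x + tmulHom A y := by
  ext a
  exact TensorProduct.tmul_add a x y

variable {A}

lemma tmulHom_whiskerRight (f : A ⟶ B) (x : G) :
    tmulHom A x ≫ f ▷ G = f ≫ tmulHom B x := rfl

lemma hom_ext_tmulHom {f g : A ⊗ G ⟶ B} (h : ∀ x : G, tmulHom A x ≫ f = tmulHom A x ≫ g) :
    f = g :=
  ModuleCat.MonoidalCategory.tensor_ext fun a x ↦ congr($(h x) a)

end

/-- The natural transformation `a ↦ a ⊗ x`. -/
def tmulNatTrans {G : AbGrp} (x : G) : 𝟭 AbGrp ⟶ (curriedTensor AbGrp).flip.obj G where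
  app A := tmulHom A x
  naturality _ _ f := (tmulHom_whiskerRight f x).symm

/-- The tensor product of a complex and an abelian group. -/
abbrev tensorComplex : CochainComplex AbGrp ℤ × AbGrp ⥤ CochainComplex AbGrp ℤ :=
  termwise (curriedTensor AbGrp)

/-- The morphism of complexes `a ↦ a ⊗ x` from `K` to `K ⊗ G`. -/
def tmulComplex (K : CochainComplex AbGrp ℤ) {G : AbGrp} (x : G) :
    K ⟶ tensorComplex.obj (K, G) where
  f n := tmulHom (K.X n) x
  comm' n m _ := tmulHom_whiskerRight (K.d n m) x

lemma tmulComplex_add (K : CochainComplex AbGrp ℤ) {G : AbGrp} (x y : G) :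
    tmulComplex K (x + y) = tmulComplex K x + tmulComplex K y := by
  ext n : 1
  exact tmulHom_add _ x y

lemma tmulComplex_map {K L : CochainComplex AbGrp ℤ} (f : K ⟶ L) {G H : AbGrp} (g : G ⟶ H) (x : G) :
    tmulComplex K x ≫ tensorComplex.map (Prod.mkHom f g) = f ≫ tmulComplex L (g x) := rfl

/-- The canonical morphism `H^n(K) ⊗ G ⟶ H^n(K ⊗ G)` which sends `h ⊗ x` to the image of `h` under
the morphism induced by `a ↦ a ⊗ x`. -/
def kunnethHom (n : ℤ) (K : CochainComplex AbGrp ℤ) (G : AbGrp) :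
    K.homology n ⊗ G ⟶ (tensorComplex.obj (K, G)).homology n :=
  have h (h : K.homology n) (x y : G) : homologyMap (tmulComplex K (x + y)) n h =
      homologyMap (tmulComplex K x) n h + homologyMap (tmulComplex K y) n h := by
    rw [tmulComplex_add, homologyMap_add]
    rfl
  ModuleCat.MonoidalCategory.tensorLift (fun h x ↦ homologyMap (tmulComplex K x) n h)
    (fun _ _ _ ↦ map_add _ _ _) (fun a h x ↦ (homologyMap (tmulComplex K x) n).hom.map_smul a h) h
    (fun a h' x ↦ map_intCast_smul (AddMonoidHom.mk'
      (fun x ↦ homologyMap (tmulComplex K x) n h') (h h')) ℤ ℤ a x)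

lemma tmulHom_kunnethHom (n : ℤ) (K : CochainComplex AbGrp ℤ) {G : AbGrp} (x : G) :
    tmulHom _ x ≫ kunnethHom n K G = homologyMap (tmulComplex K x) n := rfl

lemma kunnethHom_naturality (n : ℤ) {K L : CochainComplex AbGrp ℤ} (f : K ⟶ L) {G H : AbGrp}
    (g : G ⟶ H) :
    (homologyMap f n ▷ G ≫ L.homology n ◁ g) ≫ kunnethHom n L H =
      kunnethHom n K G ≫ homologyMap (tensorComplex.map (Prod.mkHom f g)) n := by
  refine hom_ext_tmulHom fun x ↦ ?_
  refine Eq.trans (b := homologyMap f n ≫ tmulHom (L.homology n) (g x) ≫ kunnethHom n L H) rfl ?_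
  rw [tmulHom_kunnethHom, ← homologyMap_comp, ← tmulComplex_map f g x, homologyMap_comp,
    ← tmulHom_kunnethHom, Category.assoc]

/-- The tensor product with a flat group `G` commutes with homology. The canonical morphism of
`kunnethHom` is inverse to this isomorphism because the latter is natural with respect to the
transformations `a ↦ a ⊗ x`. -/
lemma isIso_kunnethHom (n : ℤ) (K : CochainComplex AbGrp ℤ) (G : AbGrp) [Module.Flat ℤ G] :
    IsIso (kunnethHom n K G) := by
  have := preservesFiniteLimits_tensorRight G
  let i : (tensorComplex.obj (K, G)).homology n ≅ K.homology n ⊗ G :=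
    (K.sc n).mapHomologyIso ((curriedTensor AbGrp).flip.obj G)
  let e : K.homology n ≅ K.homology n := (K.sc n).mapHomologyIso (𝟭 AbGrp)
  have h (x : G) : tmulHom (K.homology n) x =
      e.inv ≫ homologyMap (tmulComplex K x) n ≫ i.hom :=
    NatTrans.app_homology (tmulNatTrans x) (K.sc n)
  have h' : kunnethHom n K G = e.hom ▷ G ≫ i.inv := by
    refine hom_ext_tmulHom fun x ↦ ?_
    rw [tmulHom_kunnethHom, reassoc_of% tmulHom_whiskerRight e.hom x, h]
    simp
  rw [h']
  infer_instance

/-- If the terms of `K` are projective, then the class map from the cycles to the homology extends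
to the terms of `K`, since the subgroup of cycles is a direct factor. -/
lemma exists_extension_homologyπ (n : ℤ) (K : CochainComplex AbGrp ℤ) [∀ n, Projective (K.X n)] :
    ∃ p : K.X n ⟶ K.homology n, K.iCycles n ≫ p = K.homologyπ n := by
  have : Projective (Abelian.coimage (K.d n (n + 1))) :=
    projective_of_mono (Abelian.factorThruCoimage (K.d n (n + 1)))
  obtain ⟨r, hr⟩ : ∃ r : K.X n ⟶ kernel (K.d n (n + 1)), kernel.ι _ ≫ r = 𝟙 _ :=
    have : Projective ((cyclesSequence K).map (HomologicalComplex.eval _ _ n)).X₃ := this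
    let s := (cyclesSequence_shortExact_eval K n).splittingOfProjective
    ⟨s.r, s.f_r⟩
  let k : kernel (K.d n (n + 1)) ⟶ K.cycles n :=
    K.liftCycles (kernel.ι _) (n + 1) (by simp) (kernel.condition _)
  have hk : k ≫ K.iCycles n = kernel.ι _ := K.liftCycles_i _ _ _ _
  let l := kernel.lift (K.d n (n + 1)) (K.iCycles n) (K.iCycles_d n (n + 1))
  have hl : l ≫ kernel.ι _ = K.iCycles n := kernel.lift_ι _ _ _
  have hlk : l ≫ k = 𝟙 _ := by
    rw [← cancel_mono (K.iCycles n), Category.assoc, hk, hl, Category.id_comp]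
  refine ⟨r ≫ k ≫ K.homologyπ n, ?_⟩
  rw [← hl, Category.assoc, reassoc_of% hr, reassoc_of% hlk]

/-- If the terms of `K` are projective, then `kunnethHom` has a retraction: it is induced by an
extension of the class map from the cycles to the terms of `K`. -/
lemma exists_kunnethHom_comp_eq_id (n : ℤ) (K : CochainComplex AbGrp ℤ) [∀ n, Projective (K.X n)]
    (G : AbGrp) : ∃ r : (tensorComplex.obj (K, G)).homology n ⟶ K.homology n ⊗ G,
      kunnethHom n K G ≫ r = 𝟙 _ := by
  obtain ⟨p, hp⟩ := exists_extension_homologyπ n K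
  have hd : K.d (n - 1) n ≫ p = 0 := by
    rw [← K.toCycles_i, Category.assoc, hp, K.toCycles_comp_homologyπ]
  have hd' : (tensorComplex.obj (K, G)).d (n - 1) n ≫ p ▷ G = 0 := by
    refine (comp_whiskerRight (K.d (n - 1) n) p G).symm.trans ?_
    rw [hd]
    exact MonoidalPreadditive.zero_whiskerRight
  -- the extension `p` kills boundaries, hence so does `p ▷ G`
  let q := K.descOpcycles p (n - 1) (by simp) hd
  let qG := (tensorComplex.obj (K, G)).descOpcycles (p ▷ G) (n - 1) (by simp) hd'
  have hq : K.homologyι n ≫ q = 𝟙 _ := by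
    rw [← cancel_epi (K.homologyπ n), K.homology_π_ι_assoc, K.p_descOpcycles, hp, Category.comp_id]
  refine ⟨(tensorComplex.obj (K, G)).homologyι n ≫ qG, hom_ext_tmulHom fun x ↦ ?_⟩
  have hx : opcyclesMap (tmulComplex K x) n ≫ qG = q ≫ tmulHom _ x := by
    rw [← cancel_epi (K.pOpcycles n), p_opcyclesMap_assoc, K.p_descOpcycles_assoc]
    exact congrArg (_ ≫ ·) ((tensorComplex.obj (K, G)).p_descOpcycles _ _ _ _)
  rw [← Category.assoc, tmulHom_kunnethHom, homologyι_naturality_assoc, hx, reassoc_of% hq,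
    Category.comp_id]

end Kunneth

/-! ### First derived functors and resolutions of length one -/

section Tor

open HomologicalComplex ZeroObject

variable {C D : Type*} [Category* C] [Abelian C] [Category* D] [Abelian D]

/-- The complex `⋯ ⟶ 0 ⟶ A ⟶ B` attached to a morphism. -/
def twoTermComplex {A B : C} (f : A ⟶ B) : ChainComplex C ℕ where
  X
    | 0 => B
    | 1 => A
    | _ + 2 => 0
  d
    | 1, 0 => f
    | 0, _ => 0
    | 1, _ + 1 => 0
    | _ + 2, _ => 0
  shape
    | 1, 0, h => (h rfl).elim
    | 0, _, _ => rfl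
    | 1, _ + 1, _ => rfl
    | _ + 2, _, _ => rfl
  d_comp_d'
    | 0, _, _, _, _ => zero_comp
    | 1, 0, 0, _, _ => comp_zero
    | 1, 0, _ + 1, _, _ => comp_zero
    | 1, _ + 1, _, _, _ => zero_comp
    | _ + 2, _, _, _, _ => zero_comp

/-- The morphism of two-term complexes attached to a commutative square. -/
def twoTermComplexMap {A B A' B' : C} {f : A ⟶ B} {f' : A' ⟶ B'} (a : A ⟶ A') (b : B ⟶ B')
    (h : a ≫ f' = f ≫ b) : twoTermComplex f ⟶ twoTermComplex f' where
  f
    | 0 => b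
    | 1 => a
    | _ + 2 => 0
  comm'
    | 1, 0, _ => h
    | 0, _, _ => comp_zero.trans zero_comp.symm
    | 1, _ + 1, _ => comp_zero.trans zero_comp.symm
    | _ + 2, _, _ => comp_zero.trans zero_comp.symm

/-- A short exact sequence `0 → P₁ → P₀ → A → 0` with `P₁` and `P₀` projective, as a projective
resolution. -/
def twoTermResolution {S : ShortComplex C} (hS : S.ShortExact) [Projective S.X₁]
    [Projective S.X₂] : ProjectiveResolution S.X₃ where
  complex := twoTermComplex S.f
  projective
    | 0 => inferInstanceAs (Projective S.X₂)
    | 1 => inferInstanceAs (Projective S.X₁)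
    | _ + 2 => inferInstanceAs (Projective (0 : C))
  π := (ChainComplex.toSingle₀Equiv _ _).symm ⟨S.g, S.zero⟩
  quasiIso := ⟨fun n => by
    have := hS.epi_g
    match n with
    | 0 =>
      rw [ChainComplex.quasiIsoAt₀_iff, ShortComplex.quasiIso_iff_of_zeros' _ rfl rfl rfl]
      refine (ShortComplex.exact_and_epi_g_iff_of_iso (S₂ := S) ?_).2 ⟨hS.exact, hS.epi_g⟩
      exact ShortComplex.isoMk (Iso.refl _) (Iso.refl _) (Iso.refl _)
        ((Category.id_comp _).trans (Category.comp_id _).symm)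
        ((Category.id_comp _).trans (Eq.trans (ChainComplex.toSingle₀Equiv_symm_apply_f_zero
          (C := twoTermComplex S.f) S.g S.zero).symm (Category.comp_id _).symm))
    | 1 =>
      have := hS.mono_f
      rw [quasiIsoAt_iff_exactAt' _ _ (ChainComplex.exactAt_succ_single_obj _ _),
        exactAt_iff' _ 2 1 0 (by simp) (by simp)]
      exact (ShortComplex.exact_iff_mono _ rfl).2 (inferInstanceAs (Mono S.f))
    | n + 2 =>
      rw [quasiIsoAt_iff_exactAt' _ _ (ChainComplex.exactAt_succ_single_obj _ _), exactAt_iff]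
      exact ShortComplex.exact_of_isZero_X₂ _ (Limits.isZero_zero C)⟩

/-- The inclusion of the homology in degree one of a complex which vanishes in degree two. -/
def homologyOneι (K : ChainComplex D ℕ) (h : IsZero (K.X 2)) : K.homology 1 ⟶ K.X 1 :=
  K.homologyι 1 ≫ (K.pOpcyclesIso 2 1 (by simp) (h.eq_of_src _ _)).inv

lemma homologyOneι_pOpcycles (K : ChainComplex D ℕ) (h : IsZero (K.X 2)) :
    homologyOneι K h ≫ K.pOpcycles 1 = K.homologyι 1 := by
  simp [homologyOneι]

lemma mono_homologyOneι (K : ChainComplex D ℕ) (h : IsZero (K.X 2)) : Mono (homologyOneι K h) :=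
  mono_comp _ _

lemma homologyOneι_d (K : ChainComplex D ℕ) (h : IsZero (K.X 2)) :
    homologyOneι K h ≫ K.d 1 0 = 0 := by
  rw [← K.p_fromOpcycles, ← Category.assoc, homologyOneι_pOpcycles, K.homologyι_comp_fromOpcycles]

lemma homologyOneι_exact (K : ChainComplex D ℕ) (h : IsZero (K.X 2)) :
    (ShortComplex.mk _ _ (homologyOneι_d K h)).Exact := by
  let e : ShortComplex.mk _ _ (homologyOneι_d K h) ≅
      ShortComplex.mk _ _ (K.homologyι_comp_fromOpcycles 1 0) :=
    ShortComplex.isoMk (Iso.refl _) (K.pOpcyclesIso 2 1 (by simp) (h.eq_of_src _ _)) (Iso.refl _)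
      ((Category.id_comp _).trans (homologyOneι_pOpcycles K h).symm)
      ((K.p_fromOpcycles 1 0).trans (Category.comp_id _).symm)
  exact (ShortComplex.exact_iff_of_iso e).2
    (ShortComplex.exact_of_f_is_kernel _ (K.homologyIsKernel 1 0 (by simp)))

lemma homologyOneι_naturality {K L : ChainComplex D ℕ} (φ : K ⟶ L) (hK : IsZero (K.X 2))
    (hL : IsZero (L.X 2)) :
    homologyMap φ 1 ≫ homologyOneι L hL = homologyOneι K hK ≫ φ.f 1 := by
  have := (L.pOpcyclesIso 2 1 (by simp) (hL.eq_of_src _ _)).isIso_hom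
  have : IsIso (L.pOpcycles 1) := this
  rw [← cancel_mono (L.pOpcycles 1), Category.assoc, Category.assoc, homologyOneι_pOpcycles,
    ← p_opcyclesMap, ← Category.assoc _ (K.pOpcycles 1), homologyOneι_pOpcycles,
    homologyι_naturality]

variable [HasProjectiveResolutions C] (F : C ⥤ D) [F.Additive]

/-- If `0 → P₁ → P₀ → A → 0` is exact with `P₁` and `P₀` projective, then the first derived functor
of `F` at `A` is the kernel of `F(P₁) ⟶ F(P₀)`. This is the inclusion. -/
def leftDerivedOneι {S : ShortComplex C} (hS : S.ShortExact) [Projective S.X₁]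
    [Projective S.X₂] : (F.leftDerived 1).obj S.X₃ ⟶ F.obj S.X₁ :=
  ((twoTermResolution hS).isoLeftDerivedObj F 1).hom ≫
    homologyOneι ((F.mapHomologicalComplex _).obj (twoTermComplex S.f))
      (F.map_isZero (Limits.isZero_zero C))

section

variable {S : ShortComplex C} (hS : S.ShortExact) [Projective S.X₁] [Projective S.X₂]

instance : Mono (leftDerivedOneι F hS) :=
  @mono_comp _ _ _ _ _ _ inferInstance _
    (mono_homologyOneι ((F.mapHomologicalComplex _).obj (twoTermComplex S.f)) _)

lemma leftDerivedOneι_map : leftDerivedOneι F hS ≫ F.map S.f = 0 :=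
  (Category.assoc _ _ _).trans ((congrArg (_ ≫ ·) (homologyOneι_d
    ((F.mapHomologicalComplex _).obj (twoTermComplex S.f)) _)).trans comp_zero)

lemma leftDerivedOneι_exact : (ShortComplex.mk _ _ (leftDerivedOneι_map F hS)).Exact := by
  let K := (F.mapHomologicalComplex _).obj (twoTermComplex S.f)
  have hK : IsZero (K.X 2) := F.map_isZero (Limits.isZero_zero C)
  let e : ShortComplex.mk _ _ (leftDerivedOneι_map F hS) ≅
      ShortComplex.mk _ _ (homologyOneι_d K hK) :=
    ShortComplex.isoMk ((twoTermResolution hS).isoLeftDerivedObj F 1) (Iso.refl _) (Iso.refl _)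
      (Category.comp_id _).symm ((Category.id_comp _).trans (Category.comp_id _).symm)
  exact (ShortComplex.exact_iff_of_iso e).2 (homologyOneι_exact K hK)

lemma leftDerivedOneι_naturality {S' : ShortComplex C} (hS' : S'.ShortExact) [Projective S'.X₁]
    [Projective S'.X₂] (φ : S ⟶ S') :
    (F.leftDerived 1).map φ.τ₃ ≫ leftDerivedOneι F hS' =
      leftDerivedOneι F hS ≫ F.map φ.τ₁ := by
  have h := ProjectiveResolution.isoLeftDerivedObj_hom_naturality φ.τ₃ (twoTermResolution hS)
    (twoTermResolution hS') (twoTermComplexMap φ.τ₁ φ.τ₂ φ.comm₁₂) (by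
      refine (congrArg (_ ≫ ·) (ChainComplex.toSingle₀Equiv_symm_apply_f_zero _ _)).trans
        (Eq.trans ?_ (congrArg (· ≫ _) (ChainComplex.toSingle₀Equiv_symm_apply_f_zero _ _).symm))
      exact φ.comm₂₃) F 1
  refine (Category.assoc _ _ _).symm.trans ((congrArg (· ≫ _) h).trans ?_)
  refine (Category.assoc _ _ _).trans (Eq.trans ?_ (Category.assoc _ _ _).symm)
  exact congrArg (_ ≫ ·) (homologyOneι_naturality ((F.mapHomologicalComplex _).map
    (twoTermComplexMap φ.τ₁ φ.τ₂ φ.comm₁₂)) _ _)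

variable {F} in
lemma leftDerivedOneι_naturality' {G : C ⥤ D} [G.Additive] (α : F ⟶ G) :
    (NatTrans.leftDerived α 1).app S.X₃ ≫ leftDerivedOneι G hS =
      leftDerivedOneι F hS ≫ α.app S.X₁ := by
  have h := (twoTermResolution hS).leftDerived_app_eq α 1
  have h' : (NatTrans.leftDerived α 1).app S.X₃ ≫
      ((twoTermResolution hS).isoLeftDerivedObj G 1).hom =
      ((twoTermResolution hS).isoLeftDerivedObj F 1).hom ≫
        homologyMap ((NatTrans.mapHomologicalComplex α _).app (twoTermComplex S.f)) 1 := by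
    rw [h, Category.assoc, Category.assoc, Iso.inv_hom_id, Category.comp_id]
    rfl
  refine (Category.assoc _ _ _).symm.trans ((congrArg (· ≫ _) h').trans ?_)
  refine (Category.assoc _ _ _).trans (Eq.trans ?_ (Category.assoc _ _ _).symm)
  exact congrArg (_ ≫ ·) (homologyOneι_naturality
    ((NatTrans.mapHomologicalComplex α _).app (twoTermComplex S.f)) _ _)

end

end Tor

/-! ### Universal coefficients for complexes of projective abelian groups -/

section UniversalCoefficients

open HomologicalComplex

variable (K : CochainComplex AbGrp ℤ) (G : AbGrp) (n m : ℤ) (hnm : n + 1 = m)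

variable {G} in
/-- The morphism of complexes `K ⊗ G ⟶ K ⊗ H` induced by a morphism of abelian groups. -/
def tensorComplexMap {H : AbGrp} (g : G ⟶ H) :
    tensorComplex.obj (K, G) ⟶ tensorComplex.obj (K, H) where
  f i := K.X i ◁ g
  comm' _ _ _ := whisker_exchange _ _

lemma tensorComplex_map_id {H : AbGrp} (g : G ⟶ H) :
    tensorComplex.map (Prod.mkHom (𝟙 K) g) = tensorComplexMap K g := by
  ext i : 1
  refine (congrArg (· ≫ K.X i ◁ g) (id_whiskerRight (K.X i) G)).trans (Category.id_comp _)

variable {K G} in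
lemma tensorComplex_map_comp_tensorComplexMap {L : CochainComplex AbGrp ℤ} (f : K ⟶ L)
    {G' H H' : AbGrp} {a : G ⟶ H} {a' : G' ⟶ H'} {g : G ⟶ G'} {h : H ⟶ H'}
    (w : g ≫ a' = a ≫ h) :
    tensorComplex.map (Prod.mkHom f g) ≫ tensorComplexMap L a' =
      tensorComplexMap K a ≫ tensorComplex.map (Prod.mkHom f h) := by
  rw [← tensorComplex_map_id, ← tensorComplex_map_id, ← Functor.map_comp, ← Functor.map_comp]
  exact congrArg tensorComplex.map
    (Prod.ext ((Category.comp_id f).trans (Category.id_comp f).symm) w)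

lemma kunnethHom_naturality_right {H : AbGrp} (g : G ⟶ H) :
    K.homology n ◁ g ≫ kunnethHom n K H =
      kunnethHom n K G ≫ homologyMap (tensorComplexMap K g) n := by
  have h := kunnethHom_naturality n (𝟙 K) g
  rw [homologyMap_id, id_whiskerRight, Category.id_comp, tensorComplex_map_id] at h
  exact h

/-- The sequence `0 → K ⊗ P₁ → K ⊗ P₀ → K ⊗ G → 0` attached to the resolution
`0 → P₁ → P₀ → G → 0` of `G`. -/
def tensorSequence : ShortComplex (CochainComplex AbGrp ℤ) where
  f := tensorComplexMap K (resolutionAb.ι.app G)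
  g := tensorComplexMap K (resolutionAb.ε.app G)
  zero := by
    ext i : 1
    refine (whiskerLeft_comp (K.X i) _ _).symm.trans ?_
    rw [resolutionAb.ι_app_ε_app]
    exact MonoidalPreadditive.whiskerLeft_zero

instance (A : AbGrp) : Projective (resolutionAb.sequence A).X₁ := resolutionAb.flat_P₁ A

instance (A : AbGrp) : Projective (resolutionAb.sequence A).X₂ := resolutionAb.flat_P A

instance (A : AbGrp) : Projective (resolutionAb.P₁.obj A) := resolutionAb.flat_P₁ A

instance (A : AbGrp) : Projective (resolutionAb.P.obj A) := resolutionAb.flat_P A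

instance (A : AbGrp) : Epi (resolutionAb.ε.app A) := resolutionAb.epi_ε A

instance {R : Type} [CommRing R] {A B : ModuleCat.{0} R} (f : A ⟶ B) [Epi f]
    (H : ModuleCat.{0} R) : Epi (H ◁ f) :=
  (ModuleCat.epi_iff_surjective _).mpr (LinearMap.lTensor_surjective H
    ((ModuleCat.epi_iff_surjective f).mp inferInstance))

instance (A : AbGrp) [Projective A] : IsIso (kunnethHom n K A) := isIso_kunnethHom n K A

variable [∀ i, Projective (K.X i)]

lemma tensorSequence_shortExact : (tensorSequence K G).ShortExact :=
  shortExact_of_degreewise_shortExact _ fun i ↦ by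
    have := preservesFiniteLimits_tensorLeft (K.X i)
    exact (resolutionAb.sequence_shortExact G).map_of_exact ((curriedTensor AbGrp).obj (K.X i))

/-- The connecting morphism `H^n(K ⊗ G) ⟶ H^(n+1)(K ⊗ P₁)`. -/
def tensorδ : (tensorComplex.obj (K, G)).homology n ⟶
    (tensorComplex.obj (K, resolutionAb.P₁.obj G)).homology m :=
  (tensorSequence_shortExact K G).δ n m hnm

lemma tensorδ_homologyMap :
    tensorδ K G n m hnm ≫ homologyMap (tensorComplexMap K (resolutionAb.ι.app G)) m = 0 :=
  (tensorSequence_shortExact K G).δ_comp n m hnm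

lemma homologyMap_tensorδ :
    homologyMap (tensorComplexMap K (resolutionAb.ε.app G)) n ≫ tensorδ K G n m hnm = 0 :=
  (tensorSequence_shortExact K G).comp_δ n m hnm

variable {K G} in
lemma tensorδ_naturality {L : CochainComplex AbGrp ℤ} [∀ i, Projective (L.X i)] {H : AbGrp}
    (f : K ⟶ L) (g : G ⟶ H) :
    tensorδ K G n m hnm ≫
        homologyMap (tensorComplex.map (Prod.mkHom f (resolutionAb.P₁.map g))) m =
      homologyMap (tensorComplex.map (Prod.mkHom f g)) n ≫ tensorδ L H n m hnm :=
  let φ : tensorSequence K G ⟶ tensorSequence L H :=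
    { τ₁ := tensorComplex.map (Prod.mkHom f (resolutionAb.P₁.map g))
      τ₂ := tensorComplex.map (Prod.mkHom f (resolutionAb.P.map g))
      τ₃ := tensorComplex.map (Prod.mkHom f g)
      comm₁₂ := tensorComplex_map_comp_tensorComplexMap f (resolutionAb.ι.naturality g)
      comm₂₃ := tensorComplex_map_comp_tensorComplexMap f (resolutionAb.ε.naturality g) }
  HomologySequence.δ_naturality φ _ _ n m hnm

/-- The connecting morphism `H^n(K ⊗ G) ⟶ H^(n+1)(K ⊗ P₁) ≅ H^(n+1)(K) ⊗ P₁`. -/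
def torConnecting : (tensorComplex.obj (K, G)).homology n ⟶
    K.homology m ⊗ resolutionAb.P₁.obj G :=
  tensorδ K G n m hnm ≫ inv (kunnethHom m K (resolutionAb.P₁.obj G))

lemma torConnecting_kunnethHom : torConnecting K G n m hnm ≫ kunnethHom m K _ =
    tensorδ K G n m hnm := by
  rw [torConnecting, Category.assoc, IsIso.inv_hom_id, Category.comp_id]

lemma torConnecting_whiskerLeft :
    torConnecting K G n m hnm ≫ K.homology m ◁ resolutionAb.ι.app G = 0 := by
  rw [← cancel_mono (kunnethHom m K (resolutionAb.P.obj G)), Category.assoc,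
    kunnethHom_naturality_right, ← Category.assoc, torConnecting_kunnethHom, zero_comp]
  exact tensorδ_homologyMap K G n m hnm

/-- The inclusion of `Tor₁(A, G)` in `A ⊗ P₁`. -/
def torι (A : AbGrp) : ((Tor AbGrp 1).obj A).obj G ⟶ A ⊗ resolutionAb.P₁.obj G :=
  leftDerivedOneι ((tensoringLeft AbGrp).obj A) (resolutionAb.sequence_shortExact G)

instance (A : AbGrp) : Mono (torι G A) :=
  inferInstanceAs (Mono (leftDerivedOneι _ _))

lemma torι_whiskerLeft (A : AbGrp) : torι G A ≫ A ◁ resolutionAb.ι.app G = 0 :=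
  leftDerivedOneι_map ((tensoringLeft AbGrp).obj A) (resolutionAb.sequence_shortExact G)

lemma torι_exact (A : AbGrp) : (ShortComplex.mk _ _ (torι_whiskerLeft G A)).Exact :=
  leftDerivedOneι_exact ((tensoringLeft AbGrp).obj A) (resolutionAb.sequence_shortExact G)

/-- The canonical morphism `H^n(K ⊗ G) ⟶ Tor₁(H^(n+1)(K), G)`, for a complex `K` of projective
abelian groups. -/
def toTor : (tensorComplex.obj (K, G)).homology n ⟶ ((Tor AbGrp 1).obj (K.homology m)).obj G :=
  have : Mono (ShortComplex.mk _ _ (torι_whiskerLeft G (K.homology m))).f :=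
    inferInstanceAs (Mono (torι G (K.homology m)))
  (torι_exact G (K.homology m)).lift (torConnecting K G n m hnm)
    (torConnecting_whiskerLeft K G n m hnm)

lemma toTor_torι : toTor K G n m hnm ≫ torι G (K.homology m) = torConnecting K G n m hnm :=
  have : Mono (ShortComplex.mk _ _ (torι_whiskerLeft G (K.homology m))).f :=
    inferInstanceAs (Mono (torι G (K.homology m)))
  (torι_exact G (K.homology m)).lift_f _ _

lemma toTor_torι_kunnethHom : toTor K G n m hnm ≫ torι G (K.homology m) ≫ kunnethHom m K _ =
    tensorδ K G n m hnm := by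
  rw [← Category.assoc, toTor_torι, torConnecting_kunnethHom]

lemma kunnethHom_toTor : kunnethHom n K G ≫ toTor K G n m hnm = 0 := by
  rw [← cancel_mono (torι G (K.homology m) ≫ kunnethHom m K _), Category.assoc,
    toTor_torι_kunnethHom, zero_comp, ← cancel_epi (K.homology n ◁ resolutionAb.ε.app G),
    comp_zero]
  refine (Category.assoc _ _ _).symm.trans ((congrArg (· ≫ tensorδ K G n m hnm)
    (kunnethHom_naturality_right K _ n (resolutionAb.ε.app G))).trans ?_)
  exact (Category.assoc _ _ _).trans ((congrArg (_ ≫ ·) (homologyMap_tensorδ K G n m hnm)).trans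
    comp_zero)

lemma kunnethHom_toTor_exact :
    (ShortComplex.mk _ _ (kunnethHom_toTor K G n m hnm)).Exact := by
  rw [ShortComplex.moduleCat_exact_iff]
  intro x hx
  have hx' : tensorδ K G n m hnm x = 0 := by
    rw [← toTor_torι_kunnethHom]
    exact (congrArg (torι G (K.homology m) ≫ kunnethHom m K _) hx).trans (map_zero _)
  obtain ⟨y, hy⟩ := (ShortComplex.moduleCat_exact_iff _).mp
    ((tensorSequence_shortExact K G).homology_exact₃ n m hnm) x hx'
  obtain ⟨z, hz⟩ := (ModuleCat.epi_iff_surjective (kunnethHom n K (resolutionAb.P.obj G))).mp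
    inferInstance y
  refine ⟨(K.homology n ◁ resolutionAb.ε.app G) z, ?_⟩
  refine congr($(kunnethHom_naturality_right K _ n (resolutionAb.ε.app G)) z).trans ?_
  exact (congrArg (homologyMap (tensorComplexMap K (resolutionAb.ε.app G)) n) hz).trans hy

lemma epi_toTor : Epi (toTor K G n m hnm) := by
  rw [ModuleCat.epi_iff_surjective]
  intro t
  have ht : homologyMap (tensorComplexMap K (resolutionAb.ι.app G)) m
      (kunnethHom m K _ (torι G (K.homology m) t)) = 0 := by
    have h : torι G (K.homology m) ≫ kunnethHom m K _ ≫
        homologyMap (tensorComplexMap K (resolutionAb.ι.app G)) m = 0 := by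
      rw [← kunnethHom_naturality_right, ← Category.assoc, torι_whiskerLeft, zero_comp]
    exact congr($h t)
  obtain ⟨x, hx⟩ := (ShortComplex.moduleCat_exact_iff _).mp
    ((tensorSequence_shortExact K G).homology_exact₁ n m hnm) _ ht
  refine ⟨x, (ModuleCat.mono_iff_injective (torι G (K.homology m) ≫ kunnethHom m K _)).mp
    inferInstance ?_⟩
  exact congr($(toTor_torι_kunnethHom K G n m hnm) x).trans hx

/-- The exact sequence `0 → H^n(K) ⊗ G → H^n(K ⊗ G) → Tor₁(H^(n+1)(K), G) → 0` splits. -/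
lemma nonempty_splitting_kunnethHom_toTor :
    Nonempty (ShortComplex.mk _ _ (kunnethHom_toTor K G n m hnm)).Splitting := by
  obtain ⟨r, hr⟩ := exists_kunnethHom_comp_eq_id n K G
  exact ⟨ShortComplex.Splitting.ofExactOfRetraction _ (kunnethHom_toTor_exact K G n m hnm) r hr
    (epi_toTor K G n m hnm)⟩

variable {K G} in
lemma toTor_naturality {L : CochainComplex AbGrp ℤ} [∀ i, Projective (L.X i)] {H : AbGrp}
    (f : K ⟶ L) (g : G ⟶ H) :
    homologyMap (tensorComplex.map (Prod.mkHom f g)) n ≫ toTor L H n m hnm =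
      toTor K G n m hnm ≫ ((Tor AbGrp 1).map (homologyMap f m)).app G ≫
        ((Tor AbGrp 1).obj (L.homology m)).map g := by
  have h₁ : ((Tor AbGrp 1).map (homologyMap f m)).app G ≫ torι G (L.homology m) =
      torι G (K.homology m) ≫ homologyMap f m ▷ resolutionAb.P₁.obj G :=
    leftDerivedOneι_naturality' (resolutionAb.sequence_shortExact G)
      ((tensoringLeft AbGrp).map (homologyMap f m))
  have h₂ : ((Tor AbGrp 1).obj (L.homology m)).map g ≫ torι H (L.homology m) =
      torι G (L.homology m) ≫ L.homology m ◁ resolutionAb.P₁.map g :=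
    leftDerivedOneι_naturality ((tensoringLeft AbGrp).obj (L.homology m))
      (resolutionAb.sequence_shortExact G) (resolutionAb.sequence_shortExact H)
      { τ₁ := resolutionAb.P₁.map g
        τ₂ := resolutionAb.P.map g
        τ₃ := g
        comm₁₂ := resolutionAb.ι.naturality g
        comm₂₃ := resolutionAb.ε.naturality g }
  have h₃ : (homologyMap f m ▷ resolutionAb.P₁.obj G ≫ L.homology m ◁ resolutionAb.P₁.map g) ≫
      kunnethHom m L (resolutionAb.P₁.obj H) = kunnethHom m K (resolutionAb.P₁.obj G) ≫
        homologyMap (tensorComplex.map (Prod.mkHom f (resolutionAb.P₁.map g))) m :=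
    kunnethHom_naturality m f (resolutionAb.P₁.map g)
  rw [← cancel_mono (torι H (L.homology m) ≫ kunnethHom m L _), Category.assoc,
    toTor_torι_kunnethHom, ← tensorδ_naturality, ← toTor_torι_kunnethHom, Category.assoc,
    Category.assoc, ← h₃]
  simp only [Category.assoc]
  rw [reassoc_of% h₂, reassoc_of% h₁]

end UniversalCoefficients

/-! ### Universal coefficients in the derived category of abelian groups -/

section DerivedUniversalCoefficients

open HomologicalComplex

/-- The universal coefficient sequence
`0 → H^n(RK) ⊗ G → H^n(RK ⊗ G) → Tor₁(H^(n+1)(RK), G) → 0` of the projective resolution `RK` of `K`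
is natural in `K` and `G`, and it splits for each `K` and `G`. -/
lemma exists_splitting_resolution (n m : ℤ) (hnm : n + 1 = m) :
    ∃ (f : (resolutionAb.R ⋙ homologyFunctor AbGrp (.up ℤ) n).prod (𝟭 AbGrp) ⋙
          Functor.uncurry.obj (curriedTensor AbGrp) ⟶
        (resolutionAb.R.prod (𝟭 AbGrp) ⋙ tensorComplex) ⋙ homologyFunctor AbGrp (.up ℤ) n)
      (g : (resolutionAb.R.prod (𝟭 AbGrp) ⋙ tensorComplex) ⋙ homologyFunctor AbGrp (.up ℤ) n ⟶
        (resolutionAb.R ⋙ homologyFunctor AbGrp (.up ℤ) m).prod (𝟭 AbGrp) ⋙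
          Functor.uncurry.obj (Tor AbGrp 1)),
      ∀ X, ∃ h : f.app X ≫ g.app X = 0, Nonempty (ShortComplex.mk _ _ h).Splitting := by
  have hR (K : CochainComplex AbGrp ℤ) : ∀ i, Projective ((resolutionAb.R.obj K).X i) :=
    resolutionAb.flatComplex_R K
  let f : (resolutionAb.R ⋙ homologyFunctor AbGrp (.up ℤ) n).prod (𝟭 AbGrp) ⋙
      Functor.uncurry.obj (curriedTensor AbGrp) ⟶
        (resolutionAb.R.prod (𝟭 AbGrp) ⋙ tensorComplex) ⋙ homologyFunctor AbGrp (.up ℤ) n :=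
    { app X := kunnethHom n (resolutionAb.R.obj X.1) X.2
      naturality _ _ φ := kunnethHom_naturality n (resolutionAb.R.map φ.1) φ.2 }
  let g : (resolutionAb.R.prod (𝟭 AbGrp) ⋙ tensorComplex) ⋙ homologyFunctor AbGrp (.up ℤ) n ⟶
      (resolutionAb.R ⋙ homologyFunctor AbGrp (.up ℤ) m).prod (𝟭 AbGrp) ⋙
        Functor.uncurry.obj (Tor AbGrp 1) :=
    { app X := toTor (resolutionAb.R.obj X.1) X.2 n m hnm
      naturality _ _ φ := toTor_naturality n m hnm (resolutionAb.R.map φ.1) φ.2 }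
  exact ⟨f, g, fun X ↦ ⟨kunnethHom_toTor (resolutionAb.R.obj X.1) X.2 n m hnm,
    nonempty_splitting_kunnethHom_toTor (resolutionAb.R.obj X.1) X.2 n m hnm⟩⟩

variable [HasDerivedCategory.{w₁} AbGrp]

/-- The homology of a complex is that of its projective resolution. -/
def homologyResolutionIso (n : ℤ) :
    DerivedCategory.Q ⋙ DerivedCategory.homologyFunctor AbGrp n ≅
      resolutionAb.R ⋙ homologyFunctor AbGrp (.up ℤ) n :=
  Functor.isoWhiskerRight resolutionAb.isoQρ.symm (DerivedCategory.homologyFunctor AbGrp n) ≪≫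
    Functor.isoWhiskerLeft resolutionAb.R (DerivedCategory.homologyFunctorFactors AbGrp n)

/-- The universal coefficient sequences for an object of the derived category of abelian groups. -/
theorem exists_universalCoefficients (n m : ℤ) (hnm : n + 1 = m) :
    ∃ (α : (DerivedCategory.homologyFunctor AbGrp n).prod (𝟭 AbGrp) ⋙
          Functor.uncurry.obj (curriedTensor AbGrp) ⟶
        FlatResolution.derivedSingle (curriedTensor AbGrp) ⋙
          DerivedCategory.homologyFunctor AbGrp n)
      (β : FlatResolution.derivedSingle (curriedTensor AbGrp) ⋙
          DerivedCategory.homologyFunctor AbGrp n ⟶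
        (DerivedCategory.homologyFunctor AbGrp m).prod (𝟭 AbGrp) ⋙
          Functor.uncurry.obj (Tor AbGrp 1)),
      ∀ X, ∃ h : α.app X ≫ β.app X = 0, Nonempty (ShortComplex.mk _ _ h).Splitting := by
  obtain ⟨f, g, h⟩ := exists_splitting_resolution n m hnm
  have e (k : ℤ) (B : AbGrp ⥤ AbGrp ⥤ AbGrp) :
      (DerivedCategory.Q (C := AbGrp)).prod (𝟭 AbGrp) ⋙
          (DerivedCategory.homologyFunctor AbGrp k).prod (𝟭 AbGrp) ⋙ Functor.uncurry.obj B ≅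
        (resolutionAb.R ⋙ homologyFunctor AbGrp (.up ℤ) k).prod (𝟭 AbGrp) ⋙
          Functor.uncurry.obj B :=
    Functor.isoWhiskerRight (NatIso.prod (homologyResolutionIso k) (Iso.refl (𝟭 AbGrp)))
      (Functor.uncurry.obj B)
  let e₂ : (DerivedCategory.Q (C := AbGrp)).prod (𝟭 AbGrp) ⋙
      FlatResolution.derivedSingle (curriedTensor AbGrp) ⋙
        DerivedCategory.homologyFunctor AbGrp n ≅
      (resolutionAb.R.prod (𝟭 AbGrp) ⋙ tensorComplex) ⋙ homologyFunctor AbGrp (.up ℤ) n :=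
    Functor.isoWhiskerRight (resolutionAb.derivedSingleIso (fun _ h ↦ h))
      (DerivedCategory.homologyFunctor AbGrp n) ≪≫
      Functor.isoWhiskerLeft (resolutionAb.R.prod (𝟭 AbGrp) ⋙ tensorComplex)
        (DerivedCategory.homologyFunctorFactors AbGrp n)
  exact exists_splitting_of_localization ((DerivedCategory.Q (C := AbGrp)).prod (𝟭 AbGrp))
    ((quasiIso AbGrp (.up ℤ)).prod (MorphismProperty.isomorphisms AbGrp))
    (e n _) e₂ (e m _) f g h

end DerivedUniversalCoefficients

end SheafHomology

end

open CategoryTheory SheafHomology in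
/-- Universal coefficients for the homology of sheaves. -/
theorem mainTheorem5 (X : TopCat.{0})
    [HasDerivedCategory.{w₁} AbGrp] [HasDerivedCategory.{w₂} (Shv X)]
    [(constDerived.{w₁, w₂} X).IsRightAdjoint] :
    ∃ (_ : HasDerivedTensorAb.{w₁}) (_ : HasDerivedTensorShv.{w₂} X),
      Nonempty (tensorConst X ⋙ sheafHomology X ≅
        (sheafHomology X).prod (𝟭 (DerivedCategory AbGrp)) ⋙ derivedTensorAb) ∧
      ∀ i : ℤ,
        ∃ (α : (sheafHomology X ⋙ homologyAb i).prod (𝟭 AbGrp) ⋙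
              Functor.uncurry.obj (MonoidalCategory.curriedTensor AbGrp) ⟶
            (𝟭 (DerivedCategory (Shv X))).prod (DerivedCategory.singleFunctor AbGrp 0) ⋙
              tensorConst X ⋙ sheafHomology X ⋙ homologyAb i)
          (β : (𝟭 (DerivedCategory (Shv X))).prod (DerivedCategory.singleFunctor AbGrp 0) ⋙
              tensorConst X ⋙ sheafHomology X ⋙ homologyAb i ⟶
            (sheafHomology X ⋙ homologyAb (i - 1)).prod (𝟭 AbGrp) ⋙
              Functor.uncurry.obj (Tor AbGrp 1)),
          ∀ (F : DerivedCategory (Shv X)) (G : AbGrp),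
            ∃ h : α.app (F, G) ≫ β.app (F, G) = 0,
              (ShortComplex.mk _ _ h).ShortExact ∧
              Nonempty (ShortComplex.mk _ _ h).Splitting := by
  obtain ⟨Φ⟩ := nonempty_tensorConst_sheafHomology_iso X
  refine ⟨inferInstance, inferInstance, ⟨Φ⟩, fun i ↦ ?_⟩
  -- homology in degree `i` is cohomology in degree `-i`, and `-i + 1 = -(i - 1)`
  obtain ⟨α, β, H⟩ := exists_universalCoefficients (-i) (-(i - 1)) (by ring)
  let L := (sheafHomology X).prod (𝟭 AbGrp)
  let s := (𝟭 (DerivedCategory (Shv X))).prod (DerivedCategory.singleFunctor AbGrp 0)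
  let e : s ⋙ tensorConst X ⋙ sheafHomology X ⋙ homologyAb i ≅
      L ⋙ FlatResolution.derivedSingle (MonoidalCategory.curriedTensor AbGrp) ⋙ homologyAb i :=
    Functor.isoWhiskerLeft s (Functor.isoWhiskerRight Φ (homologyAb i))
  refine ⟨Functor.whiskerLeft L α ≫ e.inv, e.hom ≫ Functor.whiskerLeft L β, fun F G ↦ ?_⟩
  obtain ⟨h, ⟨σ⟩⟩ := H (L.obj (F, G))
  have h' : (Functor.whiskerLeft L α ≫ e.inv).app (F, G) ≫
      (e.hom ≫ Functor.whiskerLeft L β).app (F, G) = 0 := by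
    refine Eq.trans ?_ h
    simp [L]
  have σ' : (ShortComplex.mk _ _ h').Splitting :=
    σ.ofIso (ShortComplex.isoMk (S₂ := ShortComplex.mk _ _ h') (Iso.refl _) (e.symm.app (F, G))
      (Iso.refl _) (Category.id_comp _) (by
        refine Eq.trans ?_ (Category.comp_id _).symm
        refine (Category.assoc _ _ _).symm.trans ?_
        exact (congrArg (· ≫ _) (e.inv_hom_id_app (F, G))).trans (Category.id_comp _)))
  exact ⟨h', σ'.shortExact, ⟨σ'⟩⟩
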